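/- Let $n\ge 1$ be an integer and $0<\gamma_m<2$. Consider on $\mathbb R^3$ the system for $(T,\Sigma_\dagger,X)$ $$T'=\tfrac1n T(1-T)^2(1+q),\qquad \Sigma_\dagger'=-(1-T)(2-q)\Sigma_\dagger-nTX^{2n-1},\qquad X'=\tfrac1n(1-T)(1+q)X+T\Sigma_\dagger,$$ where $q=-1+3\Sigma_\dagger^2+\tfrac32\gamma_m\Omega_m$ and $\Omega_m=1-\Sigma_\dagger^2-X^{2n}$. It describes a scalar field with potential $\frac1{2n}(\lambda\phi)^{2n}$ and a perfect fluid with adiabatic index $\gamma_m$ in flat FLRW cosmology. The physical state space is $\mathbf S=\{0<T<1,\ \Omega_m\ge 0\}$, and its scalar field boundary is the subset $\Omega_m=0$. Put $\tilde T=T/(1-T)$ and $F(\theta)=\sqrt{(1-\cos^{2n}\theta)/(1-\cos^2\theta)}$, extended continuously by $F=\sqrt n$ where $\cos^2\theta=1$. The de Sitter points $\mathrm{dS}_\pm$ are $T=0$, $\Sigma_\dagger=0$, $X=\pm1$; they lie on the unphysical boundary $T=0$ and on $\Omega_m=0$. There are $\delta>0$ and an odd function $\Theta:\mathbb R\to\mathbb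 R$, depending only on $n$, with $$\Theta(\tilde T)=-\frac{\sqrt n}{3}\tilde T\Big[1+\frac{n}{108}\Big((3n-7)x+\frac{n}{360}(65n^2-570n+1081)x^2\Big)\Big]+O(\tilde T^7)\quad(\tilde T\to0),\qquad x=\tilde T^2,$$ such that for every $\gamma_m\in(0,2)$ and each sign $\pm$ the following holds. 1. $\mathrm{dS}_\pm$ is a fixed point, its center subspace is one-dimensional, and the curve $W_\pm=\{T<1,\ |\tilde T|<\delta,\ \Sigma_\dagger=\pm F(\theta)\sin\theta,\ X=\pm\cos\theta,\ \theta=\Theta(\tilde T)\}$ is a local center manifold of class $C^2$ of $\mathrm{dS}_\pm$ (a locally invariant graph over a neighbourhood of $0$ in the center subspace, tangent to it at $\mathrm{dS}_\pm$). Every local center manifold of class $C^1$ of $\mathrm{dS}_\pm$ coincides with $W_\pm$ near $\mathrm{dS}_\pm$. 2. $W_\pm$ is unstable: through each of its points there is a solution that stays in $W_\pm$ for all earlier times and tends to $\mathrm{dS}_\pm$ as time tends to $-\infty$. Moreover $W_\pm\subset\{\Omega_m=0\}$. 3. There is a solution (the attractor solution), defined for all times, that lies in $\mathbf S\cap\{\Omega_m=0\}$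 and tends to $\mathrm{dS}_\pm$ as time tends to $-\infty$; the set $W_\pm\cap\mathbf S$ is exactly the part of its orbit before some time. Up to a time translation it is the only solution in $\mathbf S$ that tends to $\mathrm{dS}_\pm$ as time tends to $-\infty$. -/

import Mathlib

open Filter Topology Set

noncomputable section

/-! ## Local center manifolds of a fixed point of a vector field -/

section CenterManifold

variable {E : Type*} [NormedAddCommGroup E] [NormedSpace ℝ E]

/-- The real vectors of the sum of the (complex) generalized eigenspaces of the
complexification of `A`, over the eigenvalues that lie in `s`. -/
def spectralSubspace (A : E →L[ℝ] E) (s : Set ℂ) : Submodule ℝ E :=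
  ((⨆ μ ∈ s, Module.End.maxGenEigenspace
      ((A : E →ₗ[ℝ] E).baseChange ℂ) μ).restrictScalars ℝ).comap (TensorProduct.mk ℝ ℂ E 1)

/-- The center subspace of the linearization of `f` at `p`: eigenvalues with zero real part. -/
def centerSubspace (f : E → E) (p : E) : Submodule ℝ E :=
  spectralSubspace (fderiv ℝ f p) {μ | μ.re = 0}

/-- The hyperbolic (stable plus unstable) subspace of the linearization of `f` at `p`:
eigenvalues with nonzero real part. -/
def hyperbolicSubspace (f : E → E) (p : E) : Submodule ℝ E :=
  spectralSubspace (fderiv ℝ f p) {μ | μ.re ≠ 0}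

/-- `x` solves `x' = f x` at all times in `I`. -/
def IsSolutionOn (f : E → E) (x : ℝ → E) (I : Set ℝ) : Prop :=
  ∀ t ∈ I, HasDerivAt x (f (x t)) t

/-- `W` is locally invariant under the flow of `f`: the solution through any point of `W`
stays in `W` for a short time in both directions. -/
def IsLocallyInvariant (f : E → E) (W : Set E) : Prop :=
  ∀ w ∈ W, ∃ ε > 0, ∃ x : ℝ → E, x 0 = w ∧
    IsSolutionOn f x (Ioo (-ε) ε) ∧ ∀ t ∈ Ioo (-ε) ε, x t ∈ W

/-- `W` is a local center manifold of class `C^r` of the fixed point `p` of `f`: it is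
locally invariant, and it is the graph over a neighbourhood of `0` in the center subspace of a
`C^r` map `h` into the hyperbolic subspace with `h 0 = 0` and `Dh 0 = 0`. -/
def IsLocalCenterManifold (r : WithTop ℕ∞) (f : E → E) (p : E) (W : Set E) : Prop :=
  f p = 0 ∧ IsLocallyInvariant f W ∧
  ∃ (N : Set (centerSubspace f p)) (h : centerSubspace f p → E),
    IsOpen N ∧ 0 ∈ N ∧ ContDiffOn ℝ r h N ∧
    (∀ u ∈ N, h u ∈ hyperbolicSubspace f p) ∧
    h 0 = 0 ∧ HasFDerivAt h (0 : centerSubspace f p →L[ℝ] E) 0 ∧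
    W = (fun u : centerSubspace f p => p + (u : E) + h u) '' N

/-- All orbits on `W` emanate from `p`: through every point of `W` there is a solution that stays
in `W` for all earlier times and tends to `p` as time tends to `-∞`. -/
def EmanatesFrom (f : E → E) (p : E) (W : Set E) : Prop :=
  ∀ w ∈ W, ∃ x : ℝ → E, x 0 = w ∧ IsSolutionOn f x (Iic 0) ∧ (∀ t ≤ 0, x t ∈ W) ∧
    Tendsto x atBot (𝓝 p)

end CenterManifold

/-! ## The dynamical system

A state is a triple `(T, Σ, X)`. The potential is `V(φ) = (λ φ)^(2n) / (2n)`, and `γ` is the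
adiabatic index of the perfect fluid. -/

namespace ScalarCosmology

/-- The states `(T, Σ, X)`. -/
abbrev State : Type := ℝ × ℝ × ℝ

/-- `Ω_φ = Σ² + X^(2n)`. -/
def omegaPhi (n : ℕ) (z : State) : ℝ := z.2.1 ^ 2 + z.2.2 ^ (2 * n)

/-- `Ω_m = 1 - Ω_φ`. -/
def omegaM (n : ℕ) (z : State) : ℝ := 1 - omegaPhi n z

/-- The deceleration parameter `q = -1 + 3 Σ² + (3/2) γ Ω_m`. -/
def decel (n : ℕ) (γ : ℝ) (z : State) : ℝ := -1 + 3 * z.2.1 ^ 2 + 3 / 2 * γ * omegaM n z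

/-- The right-hand side of the evolution equations for `(T, Σ, X)`. -/
def vectorField (n : ℕ) (γ : ℝ) (z : State) : State :=
  (1 / (n : ℝ) * z.1 * (1 - z.1) ^ 2 * (1 + decel n γ z),
   -(1 - z.1) * (2 - decel n γ z) * z.2.1 - (n : ℝ) * z.1 * z.2.2 ^ (2 * n - 1),
   1 / (n : ℝ) * (1 - z.1) * (1 + decel n γ z) * z.2.2 + z.1 * z.2.1)

/-- The physical state space `S`: `0 < T < 1` and `Ω_m ≥ 0`. -/
def physicalSpace (n : ℕ) : Set State := {z | 0 < z.1 ∧ z.1 < 1 ∧ 0 ≤ omegaM n z}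

/-- The pure scalar field boundary `Ω_m = 0`. -/
def scalarBoundary (n : ℕ) : Set State := {z | omegaM n z = 0}

/-- The unphysical boundary `T = 0`, where `Ω_m ≥ 0`. -/
def pastBoundary (n : ℕ) : Set State := {z | z.1 = 0 ∧ 0 ≤ omegaM n z}

/-- The de Sitter fixed point: `T = 0`, `Σ = 0`, `X = s`, where `s = 1` or `s = -1`. -/
def deSitter (s : ℝ) : State := (0, 0, s)

/-- `T̃ = T / (1 - T)`. -/
def tildeT (z : State) : ℝ := z.1 / (1 - z.1)

/-- The regular function `F(θ) = √((1 - cos^(2n) θ) / (1 - cos² θ))`, with the removable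
singularities at `cos² θ = 1` removed by summing the finite geometric series. -/
def F (n : ℕ) (θ : ℝ) : ℝ := Real.sqrt (∑ k ∈ Finset.range n, Real.cos θ ^ (2 * k))

theorem F_eq_sqrt_div (n : ℕ) (θ : ℝ) (h : Real.cos θ ^ 2 ≠ 1) :
    F n θ = Real.sqrt ((1 - Real.cos θ ^ (2 * n)) / (1 - Real.cos θ ^ 2)) := by
  unfold F
  congr 1
  simp only [pow_mul]
  rw [geom_sum_eq h, ← neg_div_neg_eq]
  ring

/-- The part `|T̃| < δ` of the curve on the scalar field boundary that is given as a graph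
`θ = Θ(T̃)` by `Σ = F(θ) sin θ`, `X = cos θ` for `s = 1`, and its image under the symmetry
`(Σ, X) ↦ -(Σ, X)`, i.e. `θ = π + Θ(T̃)`, for `s = -1`. -/
def thetaGraph (n : ℕ) (s : ℝ) (Θ : ℝ → ℝ) (δ : ℝ) : Set State :=
  {z | z.1 < 1 ∧ |tildeT z| < δ ∧
    z.2.1 = s * (F n (Θ (tildeT z)) * Real.sin (Θ (tildeT z))) ∧
    z.2.2 = s * Real.cos (Θ (tildeT z))}

/-- The expansion of the attractor solution to fifth order in `t = T̃`. -/
def attractorExpansion (n : ℕ) (t : ℝ) : ℝ :=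
  -(Real.sqrt n / 3) * t * (1 + (n : ℝ) / 108 * ((3 * (n : ℝ) - 7) * t ^ 2
    + (n : ℝ) / 360 * (65 * (n : ℝ) ^ 2 - 570 * (n : ℝ) + 1081) * (t ^ 2) ^ 2))

end ScalarCosmology

end

noncomputable section

/-! ## Autonomous differential equations with a locally Lipschitz vector field -/

section AutonomousODE

/-! On `Ω_m = 0` put `Σ = s G(θ)`, `X = s cos θ` with `G = F sin`. The flow becomes planar in `u =
log T̃` and `θ`, and `γ` drops out, so one function `Θ` serves all `γ`. With `t = T̃`, a curve `θ =
Θ(t)` is invariant when `G(Θ) (cos Θ + t Θ' sin Θ) = -(n/3) t`. This first-order equation is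
singular: the coefficient of `Θ'` is of order `t³`.

Existence. For small `t > 0` the flow enters the wedge `-(√n/2) t ≤ θ ≤ -(√n/6) t` through both
sides. Orbits started in it ever closer to `t = 0` leave it only at `t = r`, and a limit of the exit
points has its whole past in the wedge (`exists_orbit_mem_wedge`). There `t` increases strictly
along the orbit, so the past is a graph (`exists_isHalfCurve`).

Expansion and regularity. The quintic polynomial satisfies the invariance equation up to `O(t⁷)`
(`residual_isBigO`). A barrier argument turns this into `Θ - p = O(t⁷)`
(`IsHalfCurve.exists_abs_sub_le`). Each derivative costs a division by `t³`, which still leaves `Θ''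
→ 0`; so the odd extension is of class `C²` and solves the equation on both sides of `0`.

Center manifold. The linearization at `dS` has eigenvalues `0`, `-3`, `-3γ`, and the curve is
tangent to the eigenvector of `0`. On it `T̃²` grows, so all orbits come out of `dS`.

Uniqueness. The flow leaves `dS` along the center direction on both sides of `T = 0`, while the
transverse directions contract; followed backward, an orbit off the manifold is therefore driven
away. This takes two steps. On any invariant curve tangent to the center direction, `Ω_m` solves a
singular linear equation whose only solution tending to zero is zero
(`eq_zero_of_singular_linear_ode`). On `Ω_m = 0` the squared `Σ`-distance to an invariant curve does
not increase along the flow and starts at `0` (`contraction`). For physical solutions coming from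
`dS` the first step is easier because `Ω_m ≥ 0`; the second is the same. -/

theorem LocallyLipschitz.exists_lipschitzOnWith_of_isCompact {E : Type*} [NormedAddCommGroup E]
    {v : E → E} (hv : LocallyLipschitz v) {s : Set E} (hs : IsCompact s) : ∃ K, LipschitzOnWith K v s :=
  LocallyLipschitzOn.exists_lipschitzOnWith_of_compact hs hv.locallyLipschitzOn

variable {E : Type*} [NormedAddCommGroup E] [NormedSpace ℝ E]

theorem eqOn_Ioo_of_isSolutionOn {v : E → E} (hv : LocallyLipschitz v) {f g : ℝ → E} {a b t₀ : ℝ}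
    (ht₀ : t₀ ∈ Ioo a b) (hf : IsSolutionOn v f (Ioo a b)) (hg : IsSolutionOn v g (Ioo a b))
    (h : f t₀ = g t₀) : EqOn f g (Ioo a b) := by
  intro t ht
  obtain ⟨a', ha', ha''⟩ := exists_between (lt_min ht₀.1 ht.1)
  obtain ⟨b', hb', hb''⟩ := exists_between (max_lt ht₀.2 ht.2)
  rw [lt_min_iff] at ha''
  rw [max_lt_iff] at hb'
  have hsub : Icc a' b' ⊆ Ioo a b := fun r hr => ⟨ha'.trans_le hr.1, hr.2.trans_lt hb''⟩
  have hcf : ContinuousOn f (Icc a' b') :=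
    fun r hr => (hf r (hsub hr)).continuousAt.continuousWithinAt
  have hcg : ContinuousOn g (Icc a' b') :=
    fun r hr => (hg r (hsub hr)).continuousAt.continuousWithinAt
  -- Over a compact time interval both trajectories trace compact sets, and one Lipschitz constant
  -- serves on their union.
  obtain ⟨K, hK⟩ := hv.exists_lipschitzOnWith_of_isCompact
    ((isCompact_Icc.image_of_continuousOn hcf).union (isCompact_Icc.image_of_continuousOn hcg))
  refine ODE_solution_unique_of_mem_Ioo (v := fun _ => v) (fun _ _ => hK)
    (t₀ := t₀) ⟨ha''.1, hb'.1⟩ (fun r hr => ?_) (fun r hr => ?_) h ⟨ha''.2, hb'.2⟩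
  · exact ⟨hf r (hsub (Ioo_subset_Icc_self hr)), Or.inl ⟨r, Ioo_subset_Icc_self hr, rfl⟩⟩
  · exact ⟨hg r (hsub (Ioo_subset_Icc_self hr)), Or.inr ⟨r, Ioo_subset_Icc_self hr, rfl⟩⟩

theorem eqOn_Iio_of_isSolutionOn {v : E → E} (hv : LocallyLipschitz v) {f g : ℝ → E} {b t₀ : ℝ}
    (ht₀ : t₀ < b) (hf : IsSolutionOn v f (Iio b)) (hg : IsSolutionOn v g (Iio b))
    (h : f t₀ = g t₀) : EqOn f g (Iio b) := by
  intro t ht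
  have hsub : Ioo (min t t₀ - 1) b ⊆ Iio b := fun r hr => hr.2
  refine eqOn_Ioo_of_isSolutionOn hv (a := min t t₀ - 1) (b := b) (t₀ := t₀) ⟨?_, ht₀⟩
    (fun r hr => hf r (hsub hr)) (fun r hr => hg r (hsub hr)) h ⟨?_, ht⟩
  · linarith [min_le_right t t₀]
  · linarith [min_le_left t t₀]

/-- A bounded, locally Lipschitz vector field has global solutions. -/
theorem exists_isSolutionOn_univ [ProperSpace E] {v : E → E} (hv : LocallyLipschitz v) {M : ℝ}
    (hM : ∀ x, ‖v x‖ ≤ M) (x₀ : E) : ∃ x : ℝ → E, x 0 = x₀ ∧ IsSolutionOn v x univ := by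
  have hM0 : 0 ≤ M := (norm_nonneg _).trans (hM x₀)
  -- Up to time `N` a solution travels at most `M * N`. Picard–Lindelöf on that ball therefore
  -- covers the whole interval at once; the solutions for different `N` agree and are glued.
  have key : ∀ N : ℕ, ∃ α : ℝ → E, α 0 = x₀ ∧ IsSolutionOn v α (Ioo (-(N : ℝ)) N) := by
    intro N
    have hN : (0 : ℝ) ∈ Icc (-(N : ℝ)) N := ⟨by simp, by simp⟩
    obtain ⟨K, hK⟩ := hv.exists_lipschitzOnWith_of_isCompact
      (isCompact_closedBall x₀ ((M * N).toNNReal : ℝ))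
    have hP : IsPicardLindelof (fun _ => v) (⟨0, hN⟩ : Icc (-(N : ℝ)) N) x₀ (M * N).toNNReal 0
        M.toNNReal K := by
      refine IsPicardLindelof.of_time_independent (fun x _ => ?_) hK ?_
      · simpa [Real.coe_toNNReal _ hM0] using hM x
      · simp [Real.coe_toNNReal _ hM0]
    obtain ⟨α, h0, hα⟩ := hP.exists_eq_forall_mem_Icc_hasDerivWithinAt₀
    exact ⟨α, h0, fun t ht => (hα t (Ioo_subset_Icc_self ht)).hasDerivAt (Icc_mem_nhds ht.1 ht.2)⟩
  choose α h0 hα using key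
  have agree : ∀ (m n : ℕ), m ≤ n → ∀ t ∈ Ioo (-(m : ℝ)) m, α m t = α n t := by
    intro m n hmn t ht
    have hm : (0 : ℝ) < m := by
      have := ht.1.trans ht.2
      linarith
    have hmn' : (m : ℝ) ≤ n := by exact_mod_cast hmn
    exact eqOn_Ioo_of_isSolutionOn hv (t₀ := 0) ⟨by linarith, hm⟩ (hα m)
      (fun r hr => hα n r ⟨by linarith [hr.1], by linarith [hr.2]⟩) ((h0 m).trans (h0 n).symm) ht
  -- The index `⌊|t|⌋₊ + 1` is the least natural number greater than `|t|`, hence selects a solution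
  -- defined at `t`.
  have hx : ∀ (n : ℕ) (t : ℝ), t ∈ Ioo (-(n : ℝ)) n → α (⌊|t|⌋₊ + 1) t = α n t := by
    intro n t ht
    have hlt : |t| < n := abs_lt.2 ht
    refine agree _ _ ?_ t (abs_lt.1 (by push_cast; exact Nat.lt_floor_add_one _))
    exact (Nat.floor_lt (abs_nonneg t)).2 hlt
  refine ⟨fun t => α (⌊|t|⌋₊ + 1) t, by simpa using h0 1, fun t _ => ?_⟩
  obtain ⟨n, hn⟩ := exists_nat_gt |t|
  have ht : t ∈ Ioo (-(n : ℝ)) n := abs_lt.1 hn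
  have hd := hα n t ht
  rw [← hx n t ht] at hd
  refine hd.congr_of_eventuallyEq ?_
  filter_upwards [Ioo_mem_nhds ht.1 ht.2] with r hr using hx n r hr

theorem norm_sub_le_of_isSolutionOn_univ {v : E → E} {M : ℝ}
    (hM : ∀ x, ‖v x‖ ≤ M) {f : ℝ → E} (hf : IsSolutionOn v f univ) (t r : ℝ) :
    ‖f t - f r‖ ≤ M * |t - r| :=
  convex_univ.norm_image_sub_le_of_norm_hasDerivWithin_le
    (fun x hx => (hf x hx).hasDerivWithinAt) (fun x _ => hM (f x)) (mem_univ _) (mem_univ _)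

/-- Continuous dependence on the initial value, backward in time. -/
theorem tendsto_of_isSolutionOn_univ [ProperSpace E] {v : E → E} (hv : LocallyLipschitz v) {M : ℝ}
    (hM : ∀ x, ‖v x‖ ≤ M) {ι : Type*} {l : Filter ι} {f : ι → ℝ → E} {g : ℝ → E}
    (hf : ∀ i, IsSolutionOn v (f i) univ) (hg : IsSolutionOn v g univ)
    (h : Tendsto (fun i => f i 0) l (𝓝 (g 0))) {s : ℝ} (hs : 0 ≤ s) :
    Tendsto (fun i => f i (-s)) l (𝓝 (g (-s))) := by
  have hM0 : 0 ≤ M := (norm_nonneg _).trans (hM (g 0))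
  -- Grönwall's inequality for the reversed field. Trajectories starting within distance `1` of `g
  -- 0` stay in the ball of radius `M * s + 1` for time `s`.
  have hv' : LocallyLipschitz (fun x => -v x) := hv.neg
  obtain ⟨K, hK⟩ := hv'.exists_lipschitzOnWith_of_isCompact
    (isCompact_closedBall (g 0) (M * s + 1))
  have rev : ∀ f : ℝ → E, IsSolutionOn v f univ → ∀ r, HasDerivAt (fun r => f (-r)) (-v (f (-r))) r :=
    fun f hf r => by
      simpa [Function.comp_def] using (hf (-r) (mem_univ _)).scomp r (hasDerivAt_neg r)
  have hball : ∀ f : ℝ → E, IsSolutionOn v f univ → dist (f 0) (g 0) ≤ 1 → ∀ r ∈ Ico 0 s,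
      f (-r) ∈ Metric.closedBall (g 0) (M * s + 1) := by
    intro f hf h1 r hr
    have := norm_sub_le_of_isSolutionOn_univ hM hf (-r) 0
    rw [sub_zero, abs_neg, abs_of_nonneg hr.1, ← dist_eq_norm] at this
    have h2 := dist_triangle (f (-r)) (f 0) (g 0)
    have h3 : M * r ≤ M * s := mul_le_mul_of_nonneg_left hr.2.le hM0
    rw [Metric.mem_closedBall]
    linarith
  have hev : ∀ᶠ i in l, dist (f i (-s)) (g (-s)) ≤ dist (f i 0) (g 0) * Real.exp (K * s) := by
    filter_upwards [h.eventually (Metric.closedBall_mem_nhds (g 0) one_pos)] with i hi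
    have := dist_le_of_trajectories_ODE_of_mem (v := fun _ x => -v x) (K := K)
      (s := fun _ => Metric.closedBall (g 0) (M * s + 1)) (f := fun r => f i (-r))
      (g := fun r => g (-r)) (a := 0) (b := s) (δ := dist (f i 0) (g 0)) (fun _ _ => hK)
      (fun r _ => (rev _ (hf i) r).continuousAt.continuousWithinAt)
      (fun r _ => (rev _ (hf i) r).hasDerivWithinAt) (hball _ (hf i) hi)
      (fun r _ => (rev _ hg r).continuousAt.continuousWithinAt)
      (fun r _ => (rev _ hg r).hasDerivWithinAt) (hball _ hg (by simp)) (by simp) s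
      (right_mem_Icc.2 hs)
    simpa using this
  rw [tendsto_iff_dist_tendsto_zero] at h ⊢
  have h0 : Tendsto (fun i => dist (f i 0) (g 0) * Real.exp (K * s)) l (𝓝 0) := by
    simpa using h.mul_const (Real.exp (K * s))
  exact tendsto_of_tendsto_of_tendsto_of_le_of_le' tendsto_const_nhds h0
    (Eventually.of_forall fun _ => dist_nonneg) hev

theorem IsSolutionOn.comp_add_const {v : E → E} {x : ℝ → E} {I : Set ℝ} (hx : IsSolutionOn v x I)
    (c : ℝ) : IsSolutionOn v (fun t => x (t + c)) ((· + c) ⁻¹' I) := fun t ht =>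
  (hx (t + c) ht).comp_add_const t c

end AutonomousODE

/-! ## Monotonicity arguments for real functions -/

theorem le_add_mul_of_le_deriv {φ φ' : ℝ → ℝ} {b c : ℝ} (h : ∀ t ≤ b, HasDerivAt φ (φ' t) t)
    (hc : ∀ t ≤ b, c ≤ φ' t) {t : ℝ} (ht : t ≤ b) : φ t ≤ φ b + c * (t - b) := by
  have int : ∀ {t}, t ∈ interior (Iic b) → t ≤ b := fun ht => mem_Iic.1 (interior_subset ht)
  have := (convex_Iic b).mul_sub_le_image_sub_of_le_deriv (f := φ) (C := c)
    (fun t ht => (h t ht).continuousAt.continuousWithinAt)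
    (fun t ht => (h t (int ht)).differentiableAt.differentiableWithinAt)
    (fun t ht => by rw [(h t (int ht)).deriv]; exact hc t (int ht))
    t ht b self_mem_Iic ht
  linarith

/-- A function that is bounded below on a left half line cannot have a derivative bounded below
by a positive constant there. -/
theorem not_bddBelow_of_le_deriv {φ φ' : ℝ → ℝ} {b c m : ℝ} (hc0 : 0 < c)
    (h : ∀ t ≤ b, HasDerivAt φ (φ' t) t) (hc : ∀ t ≤ b, c ≤ φ' t) (hm : ∀ t ≤ b, m ≤ φ t) :
    False := by
  have hb := hm b le_rfl
  have hpos : 0 ≤ (φ b - m + 1) / c := div_nonneg (by linarith) hc0.le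
  -- At this time the linear upper bound for `φ` has dropped to `m - 1`.
  have ht : b - (φ b - m + 1) / c ≤ b := by linarith
  have h1 := le_add_mul_of_le_deriv h hc ht
  have h2 := hm _ ht
  have h3 : c * (b - (φ b - m + 1) / c - b) = -(φ b - m + 1) := by
    field_simp
    ring
  linarith

theorem nonpos_of_deriv_nonpos_of_tendsto_atBot {φ φ' : ℝ → ℝ} {b : ℝ}
    (h : ∀ t ≤ b, HasDerivAt φ (φ' t) t) (hn : ∀ t ≤ b, φ' t ≤ 0)
    (h0 : Tendsto φ atBot (𝓝 0)) {t : ℝ} (ht : t ≤ b) : φ t ≤ 0 := by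
  have int : ∀ {t}, t ∈ interior (Iic b) → t ≤ b := fun ht => mem_Iic.1 (interior_subset ht)
  have hanti : AntitoneOn φ (Iic b) := antitoneOn_of_deriv_nonpos (convex_Iic b)
    (fun t ht => (h t ht).continuousAt.continuousWithinAt)
    (fun t ht => (h t (int ht)).differentiableAt.differentiableWithinAt)
    (fun t ht => by rw [(h t (int ht)).deriv]; exact hn t (int ht))
  refine ge_of_tendsto h0 ?_
  filter_upwards [eventually_le_atBot t] with s hs
  exact hanti (mem_Iic.2 (hs.trans ht)) (mem_Iic.2 ht) hs

theorem nonpos_of_deriv_nonpos_of_tendsto_nhdsGT {φ φ' : ℝ → ℝ} {a b : ℝ}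
    (h : ∀ t ∈ Ioo a b, HasDerivAt φ (φ' t) t) (hn : ∀ t ∈ Ioo a b, φ' t ≤ 0)
    (h0 : Tendsto φ (𝓝[>] a) (𝓝 0)) {t : ℝ} (ht : t ∈ Ioo a b) : φ t ≤ 0 := by
  have hanti : AntitoneOn φ (Ioo a b) := antitoneOn_of_deriv_nonpos (convex_Ioo a b)
    (fun t ht => (h t ht).continuousAt.continuousWithinAt)
    (fun t ht => (h t (interior_subset ht)).differentiableAt.differentiableWithinAt)
    (fun t ht => by rw [(h t (interior_subset ht)).deriv]; exact hn t (interior_subset ht))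
  refine ge_of_tendsto h0 ?_
  filter_upwards [Ioo_mem_nhdsGT ht.1] with s hs
  exact hanti ⟨hs.1, hs.2.trans ht.2⟩ ht hs.2.le

/-- A function that is decreasing wherever it is positive and starts at `0` is nonpositive. -/
theorem nonpos_of_deriv_nonpos_of_pos {φ φ' : ℝ → ℝ} {a b : ℝ}
    (h : ∀ t ∈ Ioo a b, HasDerivAt φ (φ' t) t) (hn : ∀ t ∈ Ioo a b, 0 < φ t → φ' t ≤ 0)
    (h0 : Tendsto φ (𝓝[>] a) (𝓝 0)) {t : ℝ} (ht : t ∈ Ioo a b) : φ t ≤ 0 := by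
  -- The square of the positive part is differentiable also at zeros of `φ`, and its derivative is
  -- nonpositive everywhere, so plain monotonicity applies to it.
  have hψ : ∀ s ∈ Ioo a b, HasDerivAt (fun s => (max (φ s) 0) ^ 2) (2 * max (φ s) 0 * φ' s) s := by
    intro s hs
    rcases lt_trichotomy (φ s) 0 with hlt | heq | hgt
    · have hev : (fun s => (max (φ s) 0) ^ 2) =ᶠ[𝓝 s] fun _ => 0 := by
        filter_upwards [(h s hs).continuousAt.eventually (Iio_mem_nhds hlt)] with r hr
        simp [max_eq_right (le_of_lt hr)]
      simpa [max_eq_right hlt.le] using (hasDerivAt_const s (0 : ℝ)).congr_of_eventuallyEq hev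
    · have hO : (fun r => φ r - φ s) =O[𝓝 s] fun r => r - s := (h s hs).isBigO_sub
      rw [heq, max_self, mul_zero, zero_mul, hasDerivAt_iff_isLittleO]
      simp only [heq, sub_zero, max_self, smul_zero] at hO ⊢
      have h1 : (fun r => max (φ r) 0 ^ 2 - 0 ^ 2) =O[𝓝 s] fun r => (r - s) ^ 2 := by
        simp only [zero_pow two_ne_zero, sub_zero]
        refine ((Asymptotics.isBigO_of_le _ fun r => ?_).trans hO).pow 2
        rcases le_total (φ r) 0 with h | h <;> simp [h, abs_nonneg]
      refine h1.trans_isLittleO ?_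
      have h2 : (fun r : ℝ => (r - s) * (r - s)) =o[𝓝 s] fun r => (r - s) * 1 := by
        refine (Asymptotics.isBigO_refl _ _).mul_isLittleO ?_
        rw [Asymptotics.isLittleO_one_iff]
        simpa using ((continuous_id.sub continuous_const).tendsto (f := fun r : ℝ => r - s) s)
      simpa [sq] using h2
    · have hev : (fun s => (max (φ s) 0) ^ 2) =ᶠ[𝓝 s] fun s => φ s ^ 2 := by
        filter_upwards [(h s hs).continuousAt.eventually (Ioi_mem_nhds hgt)] with r hr
        simp [max_eq_left (le_of_lt hr)]
      simpa [max_eq_left hgt.le] using ((h s hs).pow 2).congr_of_eventuallyEq hev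
  have hlim : Tendsto (fun s => (max (φ s) 0) ^ 2) (𝓝[>] a) (𝓝 0) := by
    simpa using (h0.max (tendsto_const_nhds (x := (0 : ℝ)))).pow 2
  have := nonpos_of_deriv_nonpos_of_tendsto_nhdsGT hψ (fun s hs => ?_) hlim ht
  · by_contra! hpos
    rw [max_eq_left hpos.le] at this
    nlinarith
  · rcases le_or_gt (φ s) 0 with hle | hgt
    · simp [hle]
    · have := hn s hs hgt
      rw [max_eq_left hgt.le]
      nlinarith

/-! ## The parametrization of the scalar field boundary by an angle -/

namespace ScalarCosmology

/-- `Σ` as a function of the angle `θ` on the scalar field boundary. -/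
def G (n : ℕ) (θ : ℝ) : ℝ := F n θ * Real.sin θ

/-- The derivative of `G`. -/
def G' (n : ℕ) (θ : ℝ) : ℝ := n * Real.cos θ ^ (2 * n - 1) / F n θ

variable {n : ℕ}

theorem sum_cos_pow_nonneg (n : ℕ) (θ : ℝ) :
    0 ≤ ∑ k ∈ Finset.range n, Real.cos θ ^ (2 * k) :=
  Finset.sum_nonneg fun k _ => by rw [pow_mul]; positivity

theorem F_sq (n : ℕ) (θ : ℝ) : F n θ ^ 2 = ∑ k ∈ Finset.range n, Real.cos θ ^ (2 * k) :=
  Real.sq_sqrt (sum_cos_pow_nonneg n θ)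

theorem one_le_sum_cos_pow (hn : 1 ≤ n) (θ : ℝ) :
    1 ≤ ∑ k ∈ Finset.range n, Real.cos θ ^ (2 * k) := by
  have := Finset.single_le_sum (f := fun k => Real.cos θ ^ (2 * k)) (s := Finset.range n)
    (fun k _ => by simp only [pow_mul]; positivity) (Finset.mem_range.2 hn : 0 ∈ Finset.range n)
  simpa using this

theorem one_le_F (hn : 1 ≤ n) (θ : ℝ) : 1 ≤ F n θ := by
  unfold F
  rw [Real.one_le_sqrt]
  exact one_le_sum_cos_pow hn θ

theorem F_pos (hn : 1 ≤ n) (θ : ℝ) : 0 < F n θ := one_pos.trans_le (one_le_F hn θ)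

theorem F_sq_le (n : ℕ) (θ : ℝ) : F n θ ^ 2 ≤ n := by
  rw [F_sq]
  calc _ ≤ ∑ _k ∈ Finset.range n, (1 : ℝ) := Finset.sum_le_sum fun k _ => by
        rw [pow_mul]
        exact pow_le_one₀ (sq_nonneg _) (Real.cos_sq_le_one θ)
    _ = n := by simp

theorem F_zero (n : ℕ) : F n 0 = Real.sqrt n := by simp [F]

theorem F_neg (n : ℕ) (θ : ℝ) : F n (-θ) = F n θ := by simp [F]

theorem contDiff_F (hn : 1 ≤ n) {r : WithTop ℕ∞} : ContDiff ℝ r (F n) := by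
  unfold F
  refine ContDiff.sqrt (ContDiff.sum fun k _ => Real.contDiff_cos.pow _) fun θ => ?_
  exact (one_pos.trans_le (one_le_sum_cos_pow hn θ)).ne'

theorem contDiff_G (hn : 1 ≤ n) {r : WithTop ℕ∞} : ContDiff ℝ r (G n) :=
  (contDiff_F hn).mul Real.contDiff_sin

theorem contDiff_G' (hn : 1 ≤ n) {r : WithTop ℕ∞} : ContDiff ℝ r (G' n) :=
  (contDiff_const.mul (Real.contDiff_cos.pow _)).div (contDiff_F hn) fun θ => (F_pos hn θ).ne'

theorem G_zero (n : ℕ) : G n 0 = 0 := by simp [G]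

theorem G_neg (n : ℕ) (θ : ℝ) : G n (-θ) = -G n θ := by simp [G, F_neg]

theorem G'_zero (n : ℕ) : G' n 0 = Real.sqrt n := by
  simp [G', F_zero, Real.div_sqrt]

theorem F_mul_G_mul_sin (n : ℕ) (θ : ℝ) : F n θ * G n θ * Real.sin θ = G n θ ^ 2 := by
  unfold G
  ring

theorem G_mul_sin_nonneg (n : ℕ) (θ : ℝ) : 0 ≤ G n θ * Real.sin θ := by
  unfold G
  rw [mul_assoc, ← sq]
  exact mul_nonneg (Real.sqrt_nonneg _) (sq_nonneg _)

theorem sin_sq_le_G_mul_sin (hn : 1 ≤ n) (θ : ℝ) : Real.sin θ ^ 2 ≤ G n θ * Real.sin θ := by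
  unfold G
  nlinarith [one_le_F hn θ, sq_nonneg (Real.sin θ)]

theorem G_sq (n : ℕ) (θ : ℝ) : G n θ ^ 2 = 1 - Real.cos θ ^ (2 * n) := by
  have h := mul_neg_geom_sum (Real.cos θ ^ 2) n
  simp only [← pow_mul] at h
  rw [G, mul_pow, F_sq, Real.sin_sq, ← h]
  ring

theorem G_sq_le_one (n : ℕ) (θ : ℝ) : G n θ ^ 2 ≤ 1 := by
  rw [G_sq, pow_mul]
  have : 0 ≤ (Real.cos θ ^ 2) ^ n := by positivity
  linarith

theorem sin_sq_le_G_sq (hn : 1 ≤ n) (θ : ℝ) : Real.sin θ ^ 2 ≤ G n θ ^ 2 := by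
  unfold G
  rw [mul_pow]
  nlinarith [one_le_F hn θ, sq_nonneg (Real.sin θ), sq_nonneg (F n θ - 1)]

theorem hasDerivAt_G (hn : 1 ≤ n) (θ : ℝ) : HasDerivAt (G n) (G' n θ) θ := by
  have hF := F_pos hn θ
  have hsum : HasDerivAt (fun θ => ∑ k ∈ Finset.range n, Real.cos θ ^ (2 * k))
      (∑ k ∈ Finset.range n, (((2 * k : ℕ) : ℝ) * Real.cos θ ^ (2 * k - 1) * -Real.sin θ)) θ :=
    HasDerivAt.fun_sum fun k _ => (Real.hasDerivAt_cos θ).pow (2 * k)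
  have hne : (∑ k ∈ Finset.range n, Real.cos θ ^ (2 * k)) ≠ 0 :=
    (one_pos.trans_le (one_le_sum_cos_pow hn θ)).ne'
  have h := (hsum.sqrt hne).mul (Real.hasDerivAt_sin θ)
  refine h.congr_deriv ?_
  change _ / (2 * F n θ) * _ + F n θ * _ = _
  -- This is the derivative of `(∑ cos^(2k)) sin² = 1 - cos^(2m)` with one factor `sin` cancelled.
  -- Induction on `m` proves it also where `sin θ = 0`.
  have key : ∀ m : ℕ, (∑ k ∈ Finset.range m, (((2 * k : ℕ) : ℝ) * Real.cos θ ^ (2 * k - 1) *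
      -Real.sin θ)) * Real.sin θ + 2 * (∑ k ∈ Finset.range m, Real.cos θ ^ (2 * k)) * Real.cos θ
      = 2 * (m * Real.cos θ ^ (2 * m - 1)) := by
    intro m
    induction m with
    | zero => simp
    | succ m ih =>
      rw [Finset.sum_range_succ, Finset.sum_range_succ, add_mul, mul_add, add_mul,
        add_add_add_comm, ih]
      rcases m with _ | m
      · simp
      · have h1 : 2 * (m + 1) - 1 = 2 * m + 1 := by omega
        have h2 : 2 * (m + 1 + 1) - 1 = 2 * m + 3 := by omega
        rw [h1, h2]
        have hs := Real.sin_sq θ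
        push_cast
        linear_combination (-(2 * ((m : ℝ) + 1) * Real.cos θ ^ (2 * m + 1))) * hs
  have hk := key n
  rw [← F_sq] at hk
  set A := ∑ k ∈ Finset.range n, ((2 * k : ℕ) : ℝ) * Real.cos θ ^ (2 * k - 1) * -Real.sin θ
  unfold G'
  field_simp
  linear_combination hk

/-- The invariance equation of a curve `θ = Θ(t)` is `slopeForm n (t * Θ' t) (Θ t) = -(n / 3) t`. -/
def slopeForm (n : ℕ) (κ θ : ℝ) : ℝ := G n θ * (Real.cos θ + κ * Real.sin θ)

/-- The derivative of `slopeForm n κ`. -/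
def slopeForm' (n : ℕ) (κ θ : ℝ) : ℝ :=
  G' n θ * (Real.cos θ + κ * Real.sin θ) + G n θ * (-Real.sin θ + κ * Real.cos θ)

theorem hasDerivAt_slopeForm (hn : 1 ≤ n) (κ θ : ℝ) :
    HasDerivAt (slopeForm n κ) (slopeForm' n κ θ) θ :=
  (hasDerivAt_G hn θ).mul ((Real.hasDerivAt_cos θ).add ((Real.hasDerivAt_sin θ).const_mul κ))

theorem contDiff_slopeForm' (hn : 1 ≤ n) {r : WithTop ℕ∞} :
    ContDiff ℝ r (fun z : ℝ × ℝ => slopeForm' n z.1 z.2) := by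
  have h1 : ContDiff ℝ r (fun z : ℝ × ℝ => G n z.2) := (contDiff_G hn).comp contDiff_snd
  have h2 : ContDiff ℝ r (fun z : ℝ × ℝ => G' n z.2) := (contDiff_G' hn).comp contDiff_snd
  unfold slopeForm'
  fun_prop

theorem one_le_sqrt_natCast (hn : 1 ≤ n) : 1 ≤ Real.sqrt n := by
  rw [Real.one_le_sqrt]
  exact_mod_cast hn

/-- `slopeForm n κ` is strictly increasing near `0`, uniformly for small `κ`. -/
theorem exists_slopeForm_sub_ge (hn : 1 ≤ n) : ∃ r > 0, ∀ κ θ₁ θ₂ : ℝ, |κ| ≤ r → |θ₁| ≤ r →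
    |θ₂| ≤ r → θ₁ ≤ θ₂ → (θ₂ - θ₁) / 2 ≤ slopeForm n κ θ₂ - slopeForm n κ θ₁ := by
  have hc : Continuous (fun z : ℝ × ℝ => slopeForm' n z.1 z.2) :=
    (contDiff_slopeForm' hn (r := 0)).continuous
  -- The value is `√n ≥ 1`; continuity keeps it above `1 / 2` near the origin, whence the factor `1
  -- / 2` in the claim.
  have h0 : 1 / 2 < slopeForm' n 0 0 := by
    simp only [slopeForm', G'_zero, G_zero, Real.cos_zero, Real.sin_zero]
    linarith [one_le_sqrt_natCast hn]
  have hev : ∀ᶠ z in 𝓝 ((0 : ℝ), (0 : ℝ)), 1 / 2 < slopeForm' n z.1 z.2 :=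
    (hc.tendsto ((0 : ℝ), (0 : ℝ))).eventually (lt_mem_nhds h0)
  obtain ⟨r, hr, hball⟩ := Metric.eventually_nhds_iff_ball.1 hev
  refine ⟨r / 2, by positivity, fun κ θ₁ θ₂ hκ h1 h2 h12 => ?_⟩
  have := (convex_Icc (-(r / 2)) (r / 2)).mul_sub_le_image_sub_of_le_deriv (C := 1 / 2)
    (f := slopeForm n κ) (fun θ _ => (hasDerivAt_slopeForm hn κ θ).continuousAt.continuousWithinAt)
    (fun θ _ => (hasDerivAt_slopeForm hn κ θ).differentiableAt.differentiableWithinAt)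
    (fun θ hθ => ?_) θ₁ (abs_le.1 h1) θ₂ (abs_le.1 h2) h12
  · linarith
  · rw [(hasDerivAt_slopeForm hn κ θ).deriv]
    have hmem : ((κ, θ) : ℝ × ℝ) ∈ Metric.ball ((0, 0) : ℝ × ℝ) r := by
      rw [Metric.mem_ball, Prod.dist_eq, max_lt_iff]
      simp only [dist_zero_right, Real.norm_eq_abs]
      have := abs_le.2 (mem_Icc.1 (interior_subset hθ))
      constructor <;> linarith
    exact (hball _ hmem).le

/-- To first order `slopeForm` is just `G`, because `κ sin θ` is quadratic along the line and `cos
θ` tends to `1`; and `G' 0 = √n`. This decides in which direction the flow crosses `θ = m t`. -/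
theorem hasDerivAt_slopeForm_line (hn : 1 ≤ n) (m : ℝ) :
    HasDerivAt (fun t => slopeForm n (m * t) (m * t)) (Real.sqrt n * m) 0 := by
  have hl : HasDerivAt (fun t : ℝ => m * t) m 0 := by simpa using (hasDerivAt_id (0 : ℝ)).const_mul m
  have hG : HasDerivAt (fun t => G n (m * t)) (Real.sqrt n * m) 0 := by
    have := (hasDerivAt_G hn (m * 0)).comp (0 : ℝ) hl
    simpa [G'_zero, Function.comp_def] using this
  have hc : HasDerivAt (fun t => Real.cos (m * t) + m * t * Real.sin (m * t))
      (-Real.sin (m * 0) * m + (m * Real.sin (m * 0) + m * 0 * (Real.cos (m * 0) * m))) 0 := by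
    have h1 := (Real.hasDerivAt_cos (m * 0)).comp (0 : ℝ) hl
    have h2 := (Real.hasDerivAt_sin (m * 0)).comp (0 : ℝ) hl
    exact h1.add (hl.mul h2)
  refine (hG.mul hc).congr_deriv ?_
  simp [G_zero]

/-- Jordan's inequality gives `|sin θ| ≥ |θ| / 2`, and `F ≥ 1`. The two quantities are the
coefficient of `t Θ'` in the invariance equation and the factor that drives `T̃`. -/
theorem sq_div_four_le_G_mul_sin (hn : 1 ≤ n) {θ : ℝ} (hθ : |θ| ≤ 1) :
    θ ^ 2 / 4 ≤ G n θ * Real.sin θ ∧ θ ^ 2 / 4 ≤ G n θ ^ 2 := by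
  have hs : θ ^ 2 / 4 ≤ Real.sin θ ^ 2 := by
    have hpi := Real.pi_gt_three
    have hpi4 := Real.pi_le_four
    have h := Real.mul_abs_le_abs_sin (x := θ) (by linarith)
    have h2 : 1 / 2 ≤ 2 / Real.pi := by
      rw [div_le_div_iff₀ two_pos Real.pi_pos]
      linarith
    have h3 : 1 / 2 * |θ| ≤ |Real.sin θ| := le_trans (by gcongr) h
    have h4 := pow_le_pow_left₀ (by positivity) h3 2
    rw [mul_pow, sq_abs, sq_abs] at h4
    linarith
  exact ⟨hs.trans (sin_sq_le_G_mul_sin hn θ), hs.trans (sin_sq_le_G_sq hn θ)⟩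

end ScalarCosmology

/-! ## The flow on the scalar field boundary and the orbit that emanates from the origin -/

namespace ScalarCosmology

variable {n : ℕ}

/-- `1 - T` as a function of `u = log (T / (1 - T))`. -/
def lapse (u : ℝ) : ℝ := 1 / (1 + Real.exp u)

/-- The evolution equations on the scalar field boundary in the coordinates
`u = log (T / (1 - T))` and `θ`. -/
def polarField (n : ℕ) (z : ℝ × ℝ) : ℝ × ℝ :=
  (3 / n * lapse z.1 * G n z.2 ^ 2,
   F n z.2 * (-(3 / n * lapse z.1 * (G n z.2 * Real.cos z.2)) - (1 - lapse z.1)))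

theorem lapse_pos (u : ℝ) : 0 < lapse u := by
  unfold lapse
  positivity

theorem lapse_lt_one (u : ℝ) : lapse u < 1 := by
  unfold lapse
  rw [div_lt_one (by positivity)]
  linarith [Real.exp_pos u]

theorem one_sub_lapse (u : ℝ) : 1 - lapse u = Real.exp u * lapse u := by
  unfold lapse
  field_simp
  ring

theorem contDiff_lapse {r : WithTop ℕ∞} : ContDiff ℝ r lapse :=
  contDiff_const.div (contDiff_const.add Real.contDiff_exp) fun u => by positivity

theorem contDiff_polarField (hn : 1 ≤ n) {r : WithTop ℕ∞} : ContDiff ℝ r (polarField n) := by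
  have h1 : ContDiff ℝ r (fun z : ℝ × ℝ => G n z.2) := (contDiff_G hn).comp contDiff_snd
  have h2 : ContDiff ℝ r (fun z : ℝ × ℝ => F n z.2) := (contDiff_F hn).comp contDiff_snd
  have h3 : ContDiff ℝ r (fun z : ℝ × ℝ => lapse z.1) := contDiff_lapse.comp contDiff_fst
  unfold polarField
  fun_prop

theorem three_div_natCast_le (hn : 1 ≤ n) : (3 : ℝ) / n ≤ 3 :=
  div_le_self (by norm_num) (by exact_mod_cast hn)

/-- The logarithm `u` moves `T = 0` and `T = 1` to infinity and leaves a bounded field, so that all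
its solutions are global. -/
theorem norm_polarField_le (hn : 1 ≤ n) (z : ℝ × ℝ) : ‖polarField n z‖ ≤ 4 * n := by
  have hn' : (1 : ℝ) ≤ n := by exact_mod_cast hn
  have h3 := three_div_natCast_le hn
  have h30 : (0 : ℝ) ≤ 3 / n := by positivity
  have hw0 := lapse_pos z.1
  have hw1 := lapse_lt_one z.1
  have hG := G_sq_le_one n z.2
  have hF0 := F_pos hn z.2
  have hF : F n z.2 ≤ n := by nlinarith [F_sq_le n z.2, one_le_F hn z.2]
  have h3w : 3 / n * lapse z.1 ≤ 3 := by nlinarith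
  have h3w0 : 0 ≤ 3 / n * lapse z.1 := by positivity
  rw [Prod.norm_def, max_le_iff]
  constructor
  · rw [polarField, Real.norm_eq_abs, abs_of_nonneg (by positivity)]
    nlinarith [sq_nonneg (G n z.2)]
  · have hGc : |G n z.2 * Real.cos z.2| ≤ 1 := by
      rw [abs_mul]
      have := Real.abs_cos_le_one z.2
      have h1 : |G n z.2| ≤ 1 := by rwa [← sq_le_one_iff_abs_le_one]
      nlinarith [abs_nonneg (G n z.2), abs_nonneg (Real.cos z.2)]
    have h4 : |3 / n * lapse z.1 * (G n z.2 * Real.cos z.2)| ≤ 3 := by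
      rw [abs_mul, abs_of_nonneg h3w0]
      nlinarith [abs_nonneg (G n z.2 * Real.cos z.2)]
    have h5 : |-(3 / n * lapse z.1 * (G n z.2 * Real.cos z.2)) - (1 - lapse z.1)| ≤ 4 := by
      rw [abs_le] at h4 ⊢
      constructor <;> linarith [h4.1, h4.2]
    rw [polarField, Real.norm_eq_abs, abs_mul, abs_of_pos hF0]
    nlinarith [abs_nonneg (-(3 / n * lapse z.1 * (G n z.2 * Real.cos z.2)) - (1 - lapse z.1))]

/-- The velocity of `θ` relative to a curve of slope `m` in the `(T̃, θ)` plane. As `F` and `lapse`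
are positive, its sign is that of the last factor: a constant `m` yields the wedge condition, and `m
= Θ'` the invariance equation. -/
theorem polarField_snd_sub (n : ℕ) (m : ℝ) (z : ℝ × ℝ) :
    (polarField n z).2 - m * (Real.exp z.1 * (polarField n z).1) =
      F n z.2 * lapse z.1 *
        (-(3 / n * slopeForm n (m * Real.exp z.1) z.2) - Real.exp z.1) := by
  simp only [polarField, slopeForm, one_sub_lapse, ← F_mul_G_mul_sin]
  ring

/-- The states with `T / (1 - T) ≤ r` in a wedge around the center direction. -/
def wedge (n : ℕ) (r : ℝ) : Set (ℝ × ℝ) :=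
  {z | z.1 ≤ Real.log r ∧ -(Real.sqrt n / 2) * Real.exp z.1 ≤ z.2 ∧
    z.2 ≤ -(Real.sqrt n / 6) * Real.exp z.1}

theorem isClosed_wedge (n : ℕ) (r : ℝ) : IsClosed (wedge n r) := by
  have h1 : IsClosed {z : ℝ × ℝ | z.1 ≤ Real.log r} := isClosed_le (by fun_prop) (by fun_prop)
  have h2 : IsClosed {z : ℝ × ℝ | -(Real.sqrt n / 2) * Real.exp z.1 ≤ z.2} :=
    isClosed_le (by fun_prop) (by fun_prop)
  have h3 : IsClosed {z : ℝ × ℝ | z.2 ≤ -(Real.sqrt n / 6) * Real.exp z.1} :=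
    isClosed_le (by fun_prop) (by fun_prop)
  exact h1.inter (h2.inter h3)

/-- The two slopes lie on either side of the center slope `-√n/3`. The linear terms are `-(n/6) t`
and `-(n/2) t`, both at distance at least `(n/6) t` from `-(n/3) t`, so an error of `(n/12) t` is
harmless. -/
theorem eventually_slopeForm_line (hn : 1 ≤ n) : ∀ᶠ t in 𝓝[>] (0 : ℝ),
    -(n / 3 * t) < slopeForm n (-(Real.sqrt n / 6) * t) (-(Real.sqrt n / 6) * t) ∧
    slopeForm n (-(Real.sqrt n / 2) * t) (-(Real.sqrt n / 2) * t) < -(n / 3 * t) := by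
  have hn' : (0 : ℝ) < n := by exact_mod_cast hn
  have hsq : Real.sqrt n * Real.sqrt n = n := Real.mul_self_sqrt hn'.le
  have key : ∀ m : ℝ, ∀ᶠ t in 𝓝[>] (0 : ℝ),
      |slopeForm n (m * t) (m * t) - t * (Real.sqrt n * m)| ≤ n / 12 * |t| := by
    intro m
    have h := (hasDerivAt_iff_isLittleO.1 (hasDerivAt_slopeForm_line hn m)).def
      (show (0 : ℝ) < n / 12 by positivity)
    simp only [mul_zero, sub_zero, smul_eq_mul, Real.norm_eq_abs] at h
    rw [show slopeForm n 0 0 = 0 by simp [slopeForm, G_zero]] at h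
    simp only [sub_zero] at h
    exact nhdsWithin_le_nhds h
  filter_upwards [key (-(Real.sqrt n / 6)), key (-(Real.sqrt n / 2)), self_mem_nhdsWithin]
    with t h1 h2 ht
  have ht' : (0 : ℝ) < t := ht
  have hnt : 0 < (n : ℝ) * t := by positivity
  rw [abs_of_pos ht', abs_le] at h1 h2
  rw [show t * (Real.sqrt n * -(Real.sqrt n / 6)) = -(n * t) / 6 by linear_combination (-t / 6) * hsq] at h1
  rw [show t * (Real.sqrt n * -(Real.sqrt n / 2)) = -(n * t) / 2 by linear_combination (-t / 2) * hsq] at h2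
  constructor <;> linarith [h1.1, h2.2]

theorem abs_le_one_of_mem_wedge (hn : 1 ≤ n) {r : ℝ} (hr : 0 < r) (hrn : r ≤ 1 / n) {z : ℝ × ℝ}
    (hz : z ∈ wedge n r) : |z.2| ≤ 1 := by
  obtain ⟨h1, h2, h3⟩ := hz
  have hn' : (1 : ℝ) ≤ n := by exact_mod_cast hn
  have hs := one_le_sqrt_natCast hn
  have hsn : Real.sqrt n ≤ n := by
    nlinarith [Real.mul_self_sqrt (show (0 : ℝ) ≤ n by positivity)]
  have he : Real.exp z.1 ≤ 1 / n := ((Real.le_log_iff_exp_le hr).1 h1).trans hrn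
  have he' : n * Real.exp z.1 ≤ 1 := by
    rw [le_div_iff₀ (by positivity)] at he
    linarith
  have hpos := Real.exp_pos z.1
  rw [abs_le]
  constructor <;> nlinarith

theorem G_sq_ge_of_mem_wedge (hn : 1 ≤ n) {r : ℝ} (hr : 0 < r) (hrn : r ≤ 1 / n) {z : ℝ × ℝ}
    (hz : z ∈ wedge n r) : Real.exp z.1 ^ 2 / 144 ≤ G n z.2 ^ 2 := by
  have h := (sq_div_four_le_G_mul_sin hn (abs_le_one_of_mem_wedge hn hr hrn hz)).2
  have hs := one_le_sqrt_natCast hn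
  have hpos := Real.exp_pos z.1
  have h6 : 1 / 6 * Real.exp z.1 ≤ -z.2 := by nlinarith [hz.2.2]
  nlinarith [pow_le_pow_left₀ (by positivity) h6 2]

theorem _root_.IsSolutionOn.hasDerivAt_fst {v : ℝ × ℝ → ℝ × ℝ} {z : ℝ → ℝ × ℝ} {I : Set ℝ}
    (hz : IsSolutionOn v z I) {s : ℝ} (hs : s ∈ I) :
    HasDerivAt (fun s => (z s).1) (v (z s)).1 s :=
  (hasFDerivAt_fst (𝕜 := ℝ) (p := z s)).comp_hasDerivAt s (hz s hs)

theorem _root_.IsSolutionOn.hasDerivAt_snd {v : ℝ × ℝ → ℝ × ℝ} {z : ℝ → ℝ × ℝ} {I : Set ℝ}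
    (hz : IsSolutionOn v z I) {s : ℝ} (hs : s ∈ I) :
    HasDerivAt (fun s => (z s).2) (v (z s)).2 s :=
  (hasFDerivAt_snd (𝕜 := ℝ) (p := z s)).comp_hasDerivAt s (hz s hs)

theorem monotone_fst_of_isSolutionOn {z : ℝ → ℝ × ℝ} (hz : IsSolutionOn (polarField n) z univ) :
    Monotone fun s => (z s).1 := by
  refine monotone_of_hasDerivAt_nonneg (fun s => hz.hasDerivAt_fst (mem_univ s)) fun s => ?_
  have := (lapse_pos (z s).1).le
  change 0 ≤ 3 / (n : ℝ) * lapse (z s).1 * G n (z s).2 ^ 2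
  positivity

theorem hasDerivAt_exp_fst {z : ℝ → ℝ × ℝ} {I : Set ℝ} (hz : IsSolutionOn (polarField n) z I)
    {s : ℝ} (hs : s ∈ I) :
    HasDerivAt (fun s => Real.exp (z s).1) (Real.exp (z s).1 * (polarField n (z s)).1) s :=
  (hz.hasDerivAt_fst hs).exp

/-- On each side of the wedge the flow points strictly inward, so a solution cannot cross it: the
only way out is `T̃ = r`. -/
theorem mem_wedge_of_forward (hn : 1 ≤ n) {r : ℝ} (hr : 0 < r)
    (hline : ∀ t ∈ Ioc 0 r,
      -(n / 3 * t) < slopeForm n (-(Real.sqrt n / 6) * t) (-(Real.sqrt n / 6) * t) ∧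
      slopeForm n (-(Real.sqrt n / 2) * t) (-(Real.sqrt n / 2) * t) < -(n / 3 * t))
    {z : ℝ → ℝ × ℝ} (hz : IsSolutionOn (polarField n) z univ) (h0 : z 0 ∈ wedge n r) {s : ℝ}
    (hs : 0 ≤ s) (hsr : (z s).1 ≤ Real.log r) : z s ∈ wedge n r := by
  have hn' : (0 : ℝ) < n := by exact_mod_cast hn
  have hmem : ∀ x ∈ Ico 0 s, Real.exp (z x).1 ∈ Ioc 0 r := fun x hx =>
    ⟨Real.exp_pos _, (Real.le_log_iff_exp_le hr).1
      ((monotone_fst_of_isSolutionOn hz hx.2.le).trans hsr)⟩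
  have hθ : ∀ x, HasDerivAt (fun s => (z s).2) (polarField n (z x)).2 x := fun x =>
    hz.hasDerivAt_snd (mem_univ x)
  have ht : ∀ m x : ℝ, HasDerivAt (fun s => m * Real.exp (z s).1)
      (m * (Real.exp (z x).1 * (polarField n (z x)).1)) x := fun m x =>
    (hasDerivAt_exp_fst hz (mem_univ x)).const_mul m
  refine ⟨hsr, ?_, ?_⟩
  · refine image_le_of_deriv_right_lt_deriv_boundary' (b := s) (a := 0)
      (f := fun s => -(Real.sqrt n / 2) * Real.exp (z s).1) (B := fun s => (z s).2)
      (fun x _ => (ht _ x).continuousAt.continuousWithinAt) (fun x _ => (ht _ x).hasDerivWithinAt)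
      h0.2.1 (fun x _ => (hθ x).continuousAt.continuousWithinAt)
      (fun x _ => (hθ x).hasDerivWithinAt) (fun x hx hx' => ?_) (right_mem_Icc.2 hs)
    rw [← sub_pos, polarField_snd_sub]
    have := (hline _ (hmem x hx)).2
    rw [← hx']
    refine mul_pos (mul_pos (F_pos hn _) (lapse_pos _)) ?_
    have h2 : 3 / (n : ℝ) * (n / 3 * Real.exp (z x).1) = Real.exp (z x).1 := by field_simp
    have h3 := mul_lt_mul_of_pos_left this (show (0 : ℝ) < 3 / n by positivity)
    linarith
  · refine image_le_of_deriv_right_lt_deriv_boundary' (b := s) (a := 0)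
      (f := fun s => (z s).2) (B := fun s => -(Real.sqrt n / 6) * Real.exp (z s).1)
      (fun x _ => (hθ x).continuousAt.continuousWithinAt) (fun x _ => (hθ x).hasDerivWithinAt)
      h0.2.2 (fun x _ => (ht _ x).continuousAt.continuousWithinAt)
      (fun x _ => (ht _ x).hasDerivWithinAt) (fun x hx hx' => ?_) (right_mem_Icc.2 hs)
    rw [← sub_neg, polarField_snd_sub]
    have := (hline _ (hmem x hx)).1
    rw [hx']
    refine mul_neg_of_pos_of_neg (mul_pos (F_pos hn _) (lapse_pos _)) ?_
    have h2 : 3 / (n : ℝ) * (n / 3 * Real.exp (z x).1) = Real.exp (z x).1 := by field_simp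
    have h3 := mul_lt_mul_of_pos_left this (show (0 : ℝ) < 3 / n by positivity)
    linarith

/-- In the wedge `|θ|` is bounded below by a multiple of `T̃`, hence `u` grows at a definite rate
wherever it is bounded below. Forward this forces the exit at `T̃ = r`, backward it forces `u → -∞`.
-/
theorem polarField_fst_ge_of_mem_wedge (hn : 1 ≤ n) {r : ℝ} (hr : 0 < r) (hrn : r ≤ 1 / n)
    {z : ℝ × ℝ} (hz : z ∈ wedge n r) {u : ℝ} (hu : u ≤ z.1) :
    3 / n * lapse (Real.log r) * (Real.exp u ^ 2 / 144) ≤ (polarField n z).1 := by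
  have h1 : lapse (Real.log r) ≤ lapse z.1 := by
    unfold lapse
    have := Real.exp_le_exp.2 hz.1
    gcongr
  have h2 := G_sq_ge_of_mem_wedge hn hr hrn hz
  have h3 : Real.exp u ≤ Real.exp z.1 := Real.exp_le_exp.2 hu
  have h4 := (lapse_pos (Real.log r)).le
  have h5 := (lapse_pos z.1).le
  have h6 : Real.exp u ^ 2 / 144 ≤ G n z.2 ^ 2 := le_trans (by gcongr) h2
  change _ ≤ 3 / (n : ℝ) * lapse z.1 * G n z.2 ^ 2
  gcongr

theorem polarField_fst_bound_pos (hn : 1 ≤ n) (r u : ℝ) :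
    0 < 3 / n * lapse (Real.log r) * (Real.exp u ^ 2 / 144) := by
  have hn' : (0 : ℝ) < n := by exact_mod_cast hn
  have := lapse_pos (Real.log r)
  positivity

theorem exists_forward_exit (hn : 1 ≤ n) {r : ℝ} (hr : 0 < r) (hrn : r ≤ 1 / n)
    (hline : ∀ t ∈ Ioc 0 r,
      -(n / 3 * t) < slopeForm n (-(Real.sqrt n / 6) * t) (-(Real.sqrt n / 6) * t) ∧
      slopeForm n (-(Real.sqrt n / 2) * t) (-(Real.sqrt n / 2) * t) < -(n / 3 * t))
    {z : ℝ → ℝ × ℝ} (hz : IsSolutionOn (polarField n) z univ) (h0 : z 0 ∈ wedge n r) :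
    ∃ s, 0 ≤ s ∧ (z s).1 = Real.log r := by
  have hu : ∀ x, HasDerivAt (fun s => (z s).1) (polarField n (z x)).1 x := fun x =>
    hz.hasDerivAt_fst (mem_univ x)
  by_contra! hne
  have hlt : ∀ s, 0 ≤ s → (z s).1 ≤ Real.log r := by
    intro s hs
    by_contra! hgt
    obtain ⟨x, hx, hx'⟩ := intermediate_value_Icc hs
      (fun x _ => (hu x).continuousAt.continuousWithinAt) ⟨h0.1, hgt.le⟩
    exact hne x hx.1 hx'
  have hc := polarField_fst_bound_pos hn r (z 0).1
  set c := 3 / n * lapse (Real.log r) * (Real.exp (z 0).1 ^ 2 / 144) with hcdef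
  -- Time and sign are reversed to bring the forward half line into the form of the lemma.
  refine not_bddBelow_of_le_deriv (φ := fun s => -(z (-s)).1)
    (φ' := fun s => (polarField n (z (-s))).1) (b := 0) (m := -Real.log r) hc (fun t _ => ?_)
    (fun t ht => ?_) (fun t ht => ?_)
  · exact ((hu (-t)).scomp t (hasDerivAt_neg t)).neg.congr_deriv (by simp)
  · have ht' : 0 ≤ -t := by linarith
    exact polarField_fst_ge_of_mem_wedge hn hr hrn (mem_wedge_of_forward hn hr hline hz h0 ht'
      (hlt _ ht')) (monotone_fst_of_isSolutionOn hz ht')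
  · exact neg_le_neg (hlt (-t) (by linarith))

/-- There is a global solution on the scalar field boundary whose past lies in the wedge. -/
theorem exists_orbit_mem_wedge (hn : 1 ≤ n) : ∃ r : ℝ, 0 < r ∧ r ≤ 1 / n ∧ ∃ z : ℝ → ℝ × ℝ,
    IsSolutionOn (polarField n) z univ ∧ (z 0).1 = Real.log r ∧ ∀ s ≤ 0, z s ∈ wedge n r := by
  have hn' : (0 : ℝ) < n := by exact_mod_cast hn
  have hLip : LocallyLipschitz (polarField n) := (contDiff_polarField hn).locallyLipschitz
  obtain ⟨r₀, hr₀, hball⟩ := mem_nhdsGT_iff_exists_Ioc_subset.1 (eventually_slopeForm_line hn)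
  have hr₀' : (0 : ℝ) < r₀ := hr₀
  set r := min r₀ (1 / n) with hrdef
  have hr : 0 < r := lt_min hr₀' (by positivity)
  have hrn : r ≤ 1 / n := min_le_right _ _
  have hline : ∀ t ∈ Ioc 0 r,
      -(n / 3 * t) < slopeForm n (-(Real.sqrt n / 6) * t) (-(Real.sqrt n / 6) * t) ∧
      slopeForm n (-(Real.sqrt n / 2) * t) (-(Real.sqrt n / 2) * t) < -(n / 3 * t) :=
    fun t ht => hball ⟨ht.1, ht.2.trans (min_le_left _ _)⟩
  have hstart : ∀ k : ℕ, (Real.log r - k, -(Real.sqrt n / 3) * Real.exp (Real.log r - k))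
      ∈ wedge n r := by
    intro k
    have hp := mul_pos (one_pos.trans_le (one_le_sqrt_natCast hn)) (Real.exp_pos (Real.log r - k))
    refine ⟨by simp, ?_, ?_⟩ <;> simp only <;> linarith
  have hsol : ∀ k : ℕ, ∃ z : ℝ → ℝ × ℝ, ∃ s : ℝ, z 0 ∈ wedge n r ∧
      IsSolutionOn (polarField n) z univ ∧ (z s).1 = Real.log r ∧ (k : ℝ) ≤ 4 * n * s := by
    intro k
    obtain ⟨z, hz0, hz⟩ := exists_isSolutionOn_univ hLip (norm_polarField_le hn)
      (Real.log r - k, -(Real.sqrt n / 3) * Real.exp (Real.log r - k))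
    obtain ⟨s, hs0, hs⟩ := exists_forward_exit hn hr hrn hline hz (hz0 ▸ hstart k)
    refine ⟨z, s, hz0 ▸ hstart k, hz, hs, ?_⟩
    have h1 := norm_sub_le_of_isSolutionOn_univ (norm_polarField_le hn) hz s 0
    have h2 := (norm_fst_le (z s - z 0)).trans h1
    rw [Prod.fst_sub, hs, hz0, sub_zero, abs_of_nonneg hs0] at h2
    simpa using h2
  choose z s hw hz hs hk using hsol
  have hs0 : ∀ k, 0 ≤ s k := fun k => by
    have h1 := (Nat.cast_nonneg k).trans (hk k)
    exact nonneg_of_mul_nonneg_right h1 (by positivity)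
  have hend : ∀ k, z k (s k) ∈ wedge n r := fun k =>
    mem_wedge_of_forward hn hr hline (hz k) (hw k) (hs0 k) (hs k).le
  -- The exit points share `u = log r` and have bounded `θ`, so a subsequence converges. The sought
  -- orbit is the one through the limit.
  have hK : IsCompact (Icc (Real.log r) (Real.log r) ×ˢ Icc (-1 : ℝ) 1) :=
    isCompact_Icc.prod isCompact_Icc
  have hmemK : ∀ k, z k (s k) ∈ Icc (Real.log r) (Real.log r) ×ˢ Icc (-1 : ℝ) 1 := fun k =>
    ⟨⟨(hs k).ge, (hs k).le⟩, abs_le.1 (abs_le_one_of_mem_wedge hn hr hrn (hend k))⟩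
  obtain ⟨p, hp, φ, hφ, hlim⟩ := hK.tendsto_subseq hmemK
  obtain ⟨y, hy0, hy⟩ := exists_isSolutionOn_univ hLip (norm_polarField_le hn) p
  refine ⟨r, hr, hrn, y, hy, ?_, fun σ hσ => ?_⟩
  · rw [hy0]
    exact le_antisymm hp.1.2 hp.1.1
  have hshift : ∀ k, IsSolutionOn (polarField n) (fun t => z k (t + s k)) univ := fun k =>
    (hz k).comp_add_const (s k)
  have hconv := tendsto_of_isSolutionOn_univ hLip (norm_polarField_le hn)
    (l := atTop) (f := fun k t => z (φ k) (t + s (φ k))) (fun k => hshift (φ k)) hy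
    (by simpa [hy0, Function.comp_def] using hlim) (s := -σ) (by linarith)
  rw [neg_neg] at hconv
  refine (isClosed_wedge n r).mem_of_tendsto hconv ?_
  -- The speed is at most `4 n` and the `k`-th orbit starts at depth `k`, so it spends at least the
  -- time `k / (4 n)` in the wedge before its exit. For these `k` the time `σ` relative to the exit
  -- falls in that span.
  filter_upwards [eventually_ge_atTop ⌈4 * n * -σ⌉₊] with k hk'
  have h1 : 4 * n * -σ ≤ k := Nat.ceil_le.1 hk'
  have h2 : (k : ℝ) ≤ φ k := by exact_mod_cast hφ.id_le k
  have h3 : -σ ≤ s (φ k) := by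
    have := h1.trans (h2.trans (hk (φ k)))
    exact le_of_mul_le_mul_left this (by positivity)
  refine mem_wedge_of_forward hn hr hline (hz (φ k)) (hw _) (by linarith) ?_
  rw [← hs (φ k)]
  exact monotone_fst_of_isSolutionOn (hz (φ k)) (by linarith)

end ScalarCosmology

/-! ## Even expansions to fourth order -/

/-- `f t = a + b t² + c t⁴ + O(t⁶)`. -/
def HasEvenJet (f : ℝ → ℝ) (a b c : ℝ) : Prop :=
  (fun t => f t - (a + b * t ^ 2 + c * t ^ 4)) =O[𝓝 0] fun t : ℝ => t ^ 6

namespace HasEvenJet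

variable {f g : ℝ → ℝ} {a b c a' b' c' : ℝ}

theorem of_eq (h : ∀ t, f t = a + b * t ^ 2 + c * t ^ 4) : HasEvenJet f a b c := by
  simp only [HasEvenJet, h, sub_self]
  exact Asymptotics.isBigO_zero _ _

theorem isBigO_one_of_continuous {f : ℝ → ℝ} (hf : Continuous f) :
    f =O[𝓝 0] fun _ => (1 : ℝ) :=
  (hf.tendsto 0).isBigO_one ℝ

theorem isBigO_one (hf : HasEvenJet f a b c) : f =O[𝓝 0] fun _ => (1 : ℝ) := by
  have h1 : (fun t : ℝ => t ^ 6) =O[𝓝 0] fun _ => (1 : ℝ) :=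
    isBigO_one_of_continuous (by fun_prop)
  have h2 : (fun t : ℝ => a + b * t ^ 2 + c * t ^ 4) =O[𝓝 0] fun _ => (1 : ℝ) :=
    isBigO_one_of_continuous (by fun_prop)
  simpa using (Asymptotics.IsBigO.trans hf h1).add h2

theorem isBigO_pow_mul (k : ℕ) {r : ℝ → ℝ} (hr : r =O[𝓝 0] fun _ => (1 : ℝ)) :
    (fun t => t ^ k * r t) =O[𝓝 0] fun t : ℝ => t ^ k := by
  simpa using (Asymptotics.isBigO_refl (fun t : ℝ => t ^ k) (𝓝 0)).mul hr

theorem add (hf : HasEvenJet f a b c) (hg : HasEvenJet g a' b' c') :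
    HasEvenJet (fun t => f t + g t) (a + a') (b + b') (c + c') := by
  refine (Asymptotics.IsBigO.add hf hg).congr_left fun t => ?_
  ring

theorem const_mul (k : ℝ) (hf : HasEvenJet f a b c) :
    HasEvenJet (fun t => k * f t) (k * a) (k * b) (k * c) := by
  refine (Asymptotics.IsBigO.const_mul_left hf k).congr_left fun t => ?_
  ring

theorem mul (hf : HasEvenJet f a b c) (hg : HasEvenJet g a' b' c') :
    HasEvenJet (fun t => f t * g t) (a * a') (a * b' + b * a') (a * c' + b * b' + c * a') := by
  have h1 : (fun t => (f t - (a + b * t ^ 2 + c * t ^ 4)) * g t) =O[𝓝 0] fun t : ℝ => t ^ 6 := by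
    simpa using Asymptotics.IsBigO.mul hf hg.isBigO_one
  have h2 : (fun t => (a + b * t ^ 2 + c * t ^ 4) * (g t - (a' + b' * t ^ 2 + c' * t ^ 4)))
      =O[𝓝 0] fun t : ℝ => t ^ 6 := by
    simpa using (isBigO_one_of_continuous (f := fun t : ℝ => a + b * t ^ 2 + c * t ^ 4)
      (by fun_prop)).mul hg
  have h3 : (fun t : ℝ => t ^ 6 * (b * c' + c * b' + c * c' * t ^ 2)) =O[𝓝 0] fun t => t ^ 6 :=
    isBigO_pow_mul 6 (isBigO_one_of_continuous (by fun_prop))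
  refine ((h1.add h2).add h3).congr_left fun t => ?_
  ring

theorem congr_coeff (hf : HasEvenJet f a b c) (ha : a = a') (hb : b = b') (hc : c = c') :
    HasEvenJet f a' b' c' := by
  subst ha hb hc
  exact hf

theorem congr (hf : HasEvenJet f a b c) (h : ∀ t, f t = g t) : HasEvenJet g a b c := by
  rwa [← funext h]

/-- Composition with a function whose square has a jet of order `t²`. -/
theorem comp {φ : ℝ → ℝ} (hφ : HasEvenJet φ a b c) (hf : HasEvenJet (fun t => f t ^ 2) 0 b' c') :
    HasEvenJet (fun t => φ (f t)) a (b * b') (b * c' + c * b' ^ 2) := by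
  -- Only the square of `f` has an even jet (`f` itself will be odd); the bound on `f` is the square
  -- root of the bound on `f ^ 2`.
  have hf1 : f =O[𝓝 0] fun t : ℝ => t := by
    have h1 : (fun t : ℝ => t ^ 6) =O[𝓝 0] fun t : ℝ => t ^ 2 :=
      (isBigO_pow_mul 2 (isBigO_one_of_continuous (f := fun t : ℝ => t ^ 4)
        (by fun_prop))).congr_left fun t => by ring
    have h2 : (fun t : ℝ => t ^ 2 * (b' + c' * t ^ 2)) =O[𝓝 0] fun t : ℝ => t ^ 2 :=
      isBigO_pow_mul 2 (isBigO_one_of_continuous (by fun_prop))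
    have h3 : (f ^ 2) =O[𝓝 0] ((fun t : ℝ => t) ^ 2) := by
      refine ((Asymptotics.IsBigO.trans hf h1).add h2).congr (fun t => ?_) fun t => rfl
      simp only [Pi.pow_apply]
      ring
    exact h3.of_pow two_ne_zero
  have hf0 : Tendsto f (𝓝 0) (𝓝 0) := hf1.trans_tendsto tendsto_id
  have h1 : (fun t => φ (f t) - (a + b * f t ^ 2 + c * f t ^ 4)) =O[𝓝 0] fun t : ℝ => t ^ 6 :=
    (hφ.comp_tendsto hf0).trans (hf1.pow 6)
  have h2 : HasEvenJet (fun t => a + b * f t ^ 2 + c * (f t ^ 2 * f t ^ 2)) a (b * b')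
      (b * c' + c * b' ^ 2) := by
    refine (((of_eq (f := fun _ => a) (a := a) (b := 0) (c := 0) (by simp)).add
      (hf.const_mul b)).add ((hf.mul hf).const_mul c)).congr_coeff ?_ ?_ ?_ <;> ring
  refine (h1.add h2).congr_left fun t => ?_
  ring

end HasEvenJet

/-! ## Taylor polynomials of `sinc` and `cos` -/

/-- Imaginary and real part of the remainder of the exponential series at `i x` after seven terms.
-/
theorem exists_sin_cos_taylor_bound : ∃ C : ℝ, ∀ x : ℝ, |x| ≤ 1 →
    |Real.sin x - x * (1 - x ^ 2 / 6 + x ^ 4 / 120)| ≤ C * |x| ^ 7 ∧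
    |Real.cos x - (1 - x ^ 2 / 2 + x ^ 4 / 24 - x ^ 6 / 720)| ≤ C * |x| ^ 7 := by
  refine ⟨((7 : ℕ).succ : ℝ) * (((7 : ℕ).factorial : ℝ) * (7 : ℕ))⁻¹, fun x hx => ?_⟩
  have hnorm : ‖(x : ℂ) * Complex.I‖ = |x| := by simp
  have h := Complex.exp_bound (x := (x : ℂ) * Complex.I) (by rwa [hnorm]) (n := 7) (by norm_num)
  rw [hnorm, Complex.exp_mul_I, mul_comm (|x| ^ 7)] at h
  have hsum : ∑ m ∈ Finset.range 7, ((x : ℂ) * Complex.I) ^ m / (m.factorial : ℂ) =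
      ((1 - x ^ 2 / 2 + x ^ 4 / 24 - x ^ 6 / 720 : ℝ) : ℂ) +
      ((x * (1 - x ^ 2 / 6 + x ^ 4 / 120) : ℝ) : ℂ) * Complex.I := by
    simp only [Finset.sum_range_succ, Finset.sum_range_zero, mul_pow, Complex.I_sq,
      show Complex.I ^ 3 = -Complex.I from Complex.I_pow_three,
      show Complex.I ^ 4 = 1 from Complex.I_pow_four,
      show Complex.I ^ 5 = Complex.I by rw [pow_succ, Complex.I_pow_four, one_mul],
      show Complex.I ^ 6 = -1 by rw [pow_add Complex.I 4 2, Complex.I_pow_four, Complex.I_sq, one_mul]]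
    norm_num [Nat.factorial]
    ring
  rw [hsum, ← Complex.ofReal_cos, ← Complex.ofReal_sin] at h
  constructor
  · refine le_trans ?_ h
    have := Complex.abs_im_le_norm ((Real.cos x : ℂ) + (Real.sin x : ℂ) * Complex.I -
      (((1 - x ^ 2 / 2 + x ^ 4 / 24 - x ^ 6 / 720 : ℝ) : ℂ) +
      ((x * (1 - x ^ 2 / 6 + x ^ 4 / 120) : ℝ) : ℂ) * Complex.I))
    simpa only [Complex.sub_im, Complex.add_im, Complex.mul_I_im, Complex.ofReal_im,
      Complex.ofReal_re, zero_add] using this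
  · refine le_trans ?_ h
    have := Complex.abs_re_le_norm ((Real.cos x : ℂ) + (Real.sin x : ℂ) * Complex.I -
      (((1 - x ^ 2 / 2 + x ^ 4 / 24 - x ^ 6 / 720 : ℝ) : ℂ) +
      ((x * (1 - x ^ 2 / 6 + x ^ 4 / 120) : ℝ) : ℂ) * Complex.I))
    simpa only [Complex.sub_re, Complex.add_re, Complex.mul_I_re, Complex.ofReal_im,
      Complex.ofReal_re, neg_zero, add_zero] using this

theorem hasEvenJet_cos : HasEvenJet Real.cos 1 (-1 / 2) (1 / 24) := by
  obtain ⟨C, hC⟩ := exists_sin_cos_taylor_bound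
  refine Asymptotics.IsBigO.of_bound (|C| + 1) ?_
  filter_upwards [Metric.closedBall_mem_nhds (0 : ℝ) one_pos] with x hx
  rw [Metric.mem_closedBall, dist_zero_right, Real.norm_eq_abs] at hx
  have h := (hC x hx).2
  rw [Real.norm_eq_abs, norm_pow, Real.norm_eq_abs]
  have h7 : |x| ^ 7 ≤ |x| ^ 6 := pow_le_pow_of_le_one (abs_nonneg x) hx (by norm_num)
  have h1 : |Real.cos x - (1 - x ^ 2 / 2 + x ^ 4 / 24 - x ^ 6 / 720)| ≤ |C| * |x| ^ 6 :=
    h.trans (mul_le_mul (le_abs_self C) h7 (by positivity) (abs_nonneg C))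
  have h2 : |x ^ 6 / 720| ≤ |x| ^ 6 := by
    rw [abs_div, abs_pow]
    exact div_le_self (by positivity) (by norm_num)
  calc _ = |(Real.cos x - (1 - x ^ 2 / 2 + x ^ 4 / 24 - x ^ 6 / 720)) + -(x ^ 6 / 720)| := by
        congr 1
        ring
    _ ≤ _ := abs_add_le _ _
    _ ≤ _ := by rw [abs_neg]; linarith

theorem hasEvenJet_sinc : HasEvenJet Real.sinc 1 (-1 / 6) (1 / 120) := by
  obtain ⟨C, hC⟩ := exists_sin_cos_taylor_bound
  refine Asymptotics.IsBigO.of_bound C ?_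
  filter_upwards [Metric.closedBall_mem_nhds (0 : ℝ) one_pos] with x hx
  rw [Metric.mem_closedBall, dist_zero_right, Real.norm_eq_abs] at hx
  rw [Real.norm_eq_abs, norm_pow, Real.norm_eq_abs]
  rcases eq_or_ne x 0 with rfl | hx0
  · simp
  · have h := (hC x hx).1
    have hpos := abs_pos.2 hx0
    have h2 : Real.sin x - x * (1 - x ^ 2 / 6 + x ^ 4 / 120) =
        x * (Real.sinc x - (1 + -1 / 6 * x ^ 2 + 1 / 120 * x ^ 4)) := by
      rw [Real.sinc_of_ne_zero hx0]
      field_simp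
      ring
    rw [h2, abs_mul] at h
    refine le_of_mul_le_mul_left (h.trans_eq ?_) hpos
    ring

/-! ## Derivatives of analytic functions of high order -/

/-- Here `⊤` means analytic. The bound says that `f` vanishes to order at least `k + 1`, so `f = t ^
(k + 1) * g` with `g` analytic, and the product can be differentiated. -/
theorem ContDiff.deriv_isBigO_pow {f : ℝ → ℝ} (hf : ContDiff ℝ ⊤ f) {k : ℕ}
    (h : f =O[𝓝 0] fun t : ℝ => t ^ (k + 1)) : deriv f =O[𝓝 0] fun t : ℝ => t ^ k := by
  have ha : AnalyticAt ℝ f 0 := (contDiff_omega_iff_analyticOnNhd.1 hf) 0 (mem_univ 0)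
  have hord : ((k + 1 : ℕ) : ℕ∞) ≤ analyticOrderAt f 0 := by
    by_contra! hlt
    obtain ⟨j, hj⟩ := ENat.ne_top_iff_exists.1 (ne_top_of_lt hlt)
    rw [← hj] at hlt
    have hjk : j < k + 1 := by exact_mod_cast hlt
    obtain ⟨g, hg, hg0, hfg⟩ := (ha.analyticOrderAt_eq_natCast).1 hj.symm
    simp only [sub_zero, smul_eq_mul] at hfg
    have h1 : (fun t : ℝ => t ^ j * g t) =O[𝓝[≠] 0] fun t : ℝ => t ^ j * t ^ (k + 1 - j) := by
      refine ((h.congr' hfg EventuallyEq.rfl).mono nhdsWithin_le_nhds).congr_right fun t => ?_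
      rw [← pow_add, Nat.add_sub_cancel' hjk.le]
    have h2 : g =O[𝓝[≠] 0] fun t : ℝ => t ^ (k + 1 - j) := by
      obtain ⟨c, hc⟩ := h1.bound
      refine Asymptotics.IsBigO.of_bound c ?_
      filter_upwards [hc, self_mem_nhdsWithin] with t ht ht0
      rw [norm_mul, norm_mul, mul_left_comm] at ht
      exact le_of_mul_le_mul_left ht (norm_pos_iff.2 (pow_ne_zero j ht0))
    have h3 : Tendsto (fun t : ℝ => t ^ (k + 1 - j)) (𝓝[≠] 0) (𝓝 0) := by
      have := ((continuous_pow (k + 1 - j)).tendsto (0 : ℝ)).mono_left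
        (nhdsWithin_le_nhds (s := {0}ᶜ))
      rwa [zero_pow (by omega)] at this
    exact hg0 (tendsto_nhds_unique (hg.continuousAt.tendsto.mono_left nhdsWithin_le_nhds)
      (h2.trans_tendsto h3))
  obtain ⟨g, hg, hfg⟩ := (natCast_le_analyticOrderAt ha).1 hord
  simp only [sub_zero, smul_eq_mul] at hfg
  have hd : deriv f =ᶠ[𝓝 0] fun t => t ^ k * ((k + 1) * g t + t * deriv g t) := by
    refine (EventuallyEq.deriv hfg).trans ?_
    filter_upwards [hg.eventually_analyticAt] with t ht
    rw [((hasDerivAt_pow (k + 1) t).fun_mul ht.differentiableAt.hasDerivAt).deriv]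
    simp only [Nat.cast_add, Nat.cast_one, Nat.add_sub_cancel]
    ring
  refine (HasEvenJet.isBigO_pow_mul k ?_).congr' hd.symm EventuallyEq.rfl
  have hc : ContinuousAt (fun t => ((k : ℝ) + 1) * g t + t * deriv g t) 0 :=
    (continuousAt_const.mul hg.continuousAt).add (continuousAt_id.mul hg.deriv.continuousAt)
  exact hc.tendsto.isBigO_one ℝ

/-! ## The residual of the expansion of the attractor solution -/

namespace ScalarCosmology

variable {n : ℕ}

/-- Applied with `y = sin² θ`, this expands `F²`. Three terms suffice, since `y = O(t²)` along the
curve and thus `y³ = O(t⁶)`. -/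
theorem geom_sum_expansion (n : ℕ) : ∃ r : ℝ → ℝ, Continuous r ∧ ∀ y : ℝ,
    ∑ k ∈ Finset.range n, (1 - y) ^ k = n - n * (n - 1) / 2 * y +
      n * (n - 1) * (n - 2) / 6 * y ^ 2 + y ^ 3 * r y := by
  induction n with
  | zero => exact ⟨fun _ => 0, continuous_const, fun y => by simp⟩
  | succ n ih =>
    obtain ⟨r, hr, h⟩ := ih
    refine ⟨fun y => r y * (1 - y) - n * (n - 1) * (n - 2) / 6, by fun_prop, fun y => ?_⟩
    rw [geom_sum_succ, h]
    push_cast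
    ring

theorem F_sq_eq_geom_sum (n : ℕ) (θ : ℝ) :
    F n θ ^ 2 = ∑ k ∈ Finset.range n, (1 - Real.sin θ ^ 2) ^ k := by
  rw [F_sq]
  simp only [pow_mul, Real.cos_sq']

/-- The cubic coefficient in the bracket of the expansion. -/
def cubicCoeff (n : ℕ) : ℝ := n / 108 * (3 * n - 7)

/-- The quintic coefficient in the bracket of the expansion. -/
def quinticCoeff (n : ℕ) : ℝ := n / 108 * (n / 360 * (65 * (n : ℝ) ^ 2 - 570 * n + 1081))

/-- The derivative of `attractorExpansion n`. -/
def attractorExpansion' (n : ℕ) (t : ℝ) : ℝ :=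
  -(Real.sqrt n / 3) * (1 + 3 * cubicCoeff n * t ^ 2 + 5 * quinticCoeff n * t ^ 4)

/-- The second derivative of `attractorExpansion n`. -/
def attractorExpansion'' (n : ℕ) (t : ℝ) : ℝ :=
  -(Real.sqrt n / 3) * (6 * cubicCoeff n * t + 20 * quinticCoeff n * t ^ 3)

theorem attractorExpansion_eq (n : ℕ) (t : ℝ) : attractorExpansion n t =
    -(Real.sqrt n / 3) * t * (1 + cubicCoeff n * t ^ 2 + quinticCoeff n * t ^ 4) := by
  unfold attractorExpansion cubicCoeff quinticCoeff
  ring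

theorem hasDerivAt_attractorExpansion (n : ℕ) (t : ℝ) :
    HasDerivAt (attractorExpansion n) (attractorExpansion' n t) t := by
  rw [funext (attractorExpansion_eq n)]
  have h1 : HasDerivAt (fun t : ℝ => 1 + cubicCoeff n * t ^ 2 + quinticCoeff n * t ^ 4)
      (cubicCoeff n * (2 * t) + quinticCoeff n * (4 * t ^ 3)) t := by
    have h2 := (hasDerivAt_pow 2 t).const_mul (cubicCoeff n)
    have h4 := (hasDerivAt_pow 4 t).const_mul (quinticCoeff n)
    exact ((h2.const_add 1).add h4).congr_deriv (by simp)
  refine (((hasDerivAt_id t).const_mul (-(Real.sqrt n / 3))).mul h1).congr_deriv ?_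
  simp only [attractorExpansion', id]
  ring

theorem hasDerivAt_attractorExpansion' (n : ℕ) (t : ℝ) :
    HasDerivAt (attractorExpansion' n) (attractorExpansion'' n t) t := by
  have h2 := (hasDerivAt_pow 2 t).const_mul (3 * cubicCoeff n)
  have h4 := (hasDerivAt_pow 4 t).const_mul (5 * quinticCoeff n)
  refine (((h2.const_add 1).add h4).const_mul (-(Real.sqrt n / 3))).congr_deriv ?_
  simp only [attractorExpansion'', Nat.cast_ofNat]
  ring

/-- The residual of the invariance equation. -/
def residual (n : ℕ) (t : ℝ) : ℝ :=
  slopeForm n (t * attractorExpansion' n t) (attractorExpansion n t) + n / 3 * t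

theorem contDiff_residual (hn : 1 ≤ n) {r : WithTop ℕ∞} : ContDiff ℝ r (residual n) := by
  have h1 : ContDiff ℝ r (attractorExpansion n) := by
    unfold attractorExpansion
    fun_prop
  have h2 : ContDiff ℝ r (attractorExpansion' n) := by
    unfold attractorExpansion'
    fun_prop
  have h3 : ContDiff ℝ r (fun t => G n (attractorExpansion n t)) := (contDiff_G hn).comp h1
  unfold residual slopeForm
  fun_prop

/-- Squaring removes `√n` and the root in `F`, so that only even jets with coefficients polynomial
in `n` remain. That the coefficients of `t²` and `t⁴` vanish is what fixes `cubicCoeff` and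
`quinticCoeff`. -/
theorem hasEvenJet_slopeForm_sq (n : ℕ) : ∃ K : ℝ → ℝ, HasEvenJet K ((n : ℝ) ^ 2 / 9) 0 0 ∧
    ∀ t, slopeForm n (t * attractorExpansion' n t) (attractorExpansion n t) ^ 2 = t ^ 2 * K t := by
  have hsq : Real.sqrt n ^ 2 = n := Real.sq_sqrt (Nat.cast_nonneg n)
  have hQ : HasEvenJet (fun t => 1 + cubicCoeff n * t ^ 2 + quinticCoeff n * t ^ 4) 1
    (cubicCoeff n) (quinticCoeff n) := .of_eq fun t => rfl
  have hQ' : HasEvenJet (fun t => 1 + 3 * cubicCoeff n * t ^ 2 + 5 * quinticCoeff n * t ^ 4) 1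
    (3 * cubicCoeff n) (5 * quinticCoeff n) := .of_eq fun t => rfl
  have ht2 : HasEvenJet (fun t => n / 9 * t ^ 2) 0 (n / 9) 0 := .of_eq fun t => by ring
  have hP : HasEvenJet (fun t => attractorExpansion n t ^ 2) 0 (n / 9)
      (n / 9 * (2 * cubicCoeff n)) := by
    refine ((ht2.mul (hQ.mul hQ)).congr_coeff ?_ ?_ ?_).congr fun t => ?_
    · ring
    · ring
    · ring
    · rw [attractorExpansion_eq]
      simp only [mul_pow, neg_sq, div_pow, hsq]
      ring
  have hC := hasEvenJet_cos.comp hP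
  have hS := hasEvenJet_sinc.comp hP
  have hsin : ∀ t, Real.sin (attractorExpansion n t) =
      attractorExpansion n t * Real.sinc (attractorExpansion n t) := fun t => by
    rcases eq_or_ne (attractorExpansion n t) 0 with h | h
    · simp [h]
    · rw [Real.sinc_of_ne_zero h]
      field_simp
  have hY := (ht2.mul (hQ.mul hQ)).mul (hS.mul hS)
  have hy : HasEvenJet (fun t => Real.sin (attractorExpansion n t) ^ 2) 0 (n / 9)
      (n / 9 * (2 * cubicCoeff n - n / 27)) := by
    refine (hY.congr_coeff ?_ ?_ ?_).congr fun t => ?_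
    · ring
    · ring
    · ring
    · rw [hsin, attractorExpansion_eq]
      simp only [mul_pow, neg_sq, div_pow, hsq]
      ring
  have hE : HasEvenJet (fun s => ∑ k ∈ Finset.range n, (1 - s ^ 2) ^ k) n (-(n * (n - 1) / 2))
      (n * (n - 1) * (n - 2) / 6) := by
    obtain ⟨r, hr, h⟩ := geom_sum_expansion n
    refine (HasEvenJet.isBigO_pow_mul 6 (HasEvenJet.isBigO_one_of_continuous
      (f := fun s => r (s ^ 2)) (by fun_prop))).congr_left fun s => ?_
    simp only [h]
    ring
  have hF := hE.comp hy
  have hJ := hC.add ((ht2.mul (hQ.mul hQ')).mul hS)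
  have hn1 : HasEvenJet (fun _ => (n : ℝ) / 9) (n / 9) 0 0 := .of_eq fun t => by ring
  refine ⟨_, ((((hn1.mul (hQ.mul hQ)).mul (hS.mul hS)).mul hF).mul (hJ.mul hJ)).congr_coeff
    ?_ ?_ ?_, fun t => ?_⟩
  · ring
  · unfold cubicCoeff
    ring
  · unfold cubicCoeff quinticCoeff
    ring
  · have hs := hsin t
    have hpt : attractorExpansion' n t * attractorExpansion n t = n / 9 * t *
        ((1 + cubicCoeff n * t ^ 2 + quinticCoeff n * t ^ 4) *
        (1 + 3 * cubicCoeff n * t ^ 2 + 5 * quinticCoeff n * t ^ 4)) := by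
      rw [attractorExpansion_eq, attractorExpansion']
      linear_combination (t * ((1 + cubicCoeff n * t ^ 2 + quinticCoeff n * t ^ 4) *
        (1 + 3 * cubicCoeff n * t ^ 2 + 5 * quinticCoeff n * t ^ 4)) / 9) * hsq
    have hp2 : attractorExpansion n t ^ 2 = n / 9 * t ^ 2 *
        (1 + cubicCoeff n * t ^ 2 + quinticCoeff n * t ^ 4) ^ 2 := by
      rw [attractorExpansion_eq]
      simp only [mul_pow, neg_sq, div_pow, hsq]
      ring
    have hJt : Real.cos (attractorExpansion n t) + t * attractorExpansion' n t *
        Real.sin (attractorExpansion n t) = Real.cos (attractorExpansion n t) +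
        n / 9 * t ^ 2 * ((1 + cubicCoeff n * t ^ 2 + quinticCoeff n * t ^ 4) *
        (1 + 3 * cubicCoeff n * t ^ 2 + 5 * quinticCoeff n * t ^ 4)) *
        Real.sinc (attractorExpansion n t) := by
      rw [hs]
      linear_combination (t * Real.sinc (attractorExpansion n t)) * hpt
    rw [slopeForm, G, hJt, mul_pow, mul_pow, F_sq_eq_geom_sum, hs, mul_pow, hp2]
    ring

/-- The difference of squares `slopeForm² - (n t / 3)² = O(t⁸)` is the residual times `slopeForm - n
t / 3`. The latter has derivative `-2n/3 ≠ 0` at `0`, hence is comparable to `t` and can be divided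
out. -/
theorem residual_isBigO (hn : 1 ≤ n) : residual n =O[𝓝 0] fun t : ℝ => t ^ 7 := by
  have hn' : (0 : ℝ) < n := by exact_mod_cast hn
  obtain ⟨K, hK, hKt⟩ := hasEvenJet_slopeForm_sq n
  have hprod : (fun t => t * t * (K t - (n : ℝ) ^ 2 / 9)) =O[𝓝 0] fun t : ℝ => t * t * t ^ 6 := by
    refine (Asymptotics.isBigO_refl _ _).mul ?_
    simpa [HasEvenJet] using hK
  have hp := hasDerivAt_attractorExpansion n 0
  have hp0 : attractorExpansion n 0 = 0 := by simp [attractorExpansion]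
  have hG : HasDerivAt (fun t => G n (attractorExpansion n t)) (-(n / 3)) 0 := by
    refine ((hasDerivAt_G hn _).comp 0 hp).congr_deriv ?_
    rw [hp0, G'_zero]
    simp only [attractorExpansion']
    linear_combination (-1 / 3 : ℝ) * Real.mul_self_sqrt hn'.le
  have hJ : HasDerivAt (fun t => Real.cos (attractorExpansion n t) +
      t * attractorExpansion' n t * Real.sin (attractorExpansion n t)) 0 0 := by
    refine (((Real.hasDerivAt_cos _).comp 0 hp).add (((hasDerivAt_id 0).mul
      (hasDerivAt_attractorExpansion' n 0)).mul ((Real.hasDerivAt_sin _).comp 0 hp))).congr_deriv ?_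
    simp [hp0]
  have hψ : HasDerivAt (fun t => slopeForm n (t * attractorExpansion' n t)
      (attractorExpansion n t) - n / 3 * t) (-(2 * n / 3)) 0 := by
    refine ((hG.mul hJ).sub ((hasDerivAt_id 0).const_mul (n / 3 : ℝ))).congr_deriv ?_
    simp [hp0]
    ring
  have hrev := (hψ.isTheta_sub (by
    have : 0 < 2 * (n : ℝ) / 3 := by positivity
    linarith)).isBigO_symm.comp_tendsto
      (tendsto_id.prodMk (tendsto_const_pure (b := (0 : ℝ))))
  simp only [Function.comp_def, id, hp0, slopeForm, G_zero, zero_mul, mul_zero, sub_zero] at hrev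
  obtain ⟨C, hC⟩ := hprod.bound
  obtain ⟨c, hc0, hc⟩ := hrev.exists_pos
  rw [Asymptotics.isBigOWith_iff] at hc
  refine Asymptotics.IsBigO.of_bound (C * c) ?_
  filter_upwards [hC, hc] with t h1 h2
  rcases eq_or_ne t 0 with rfl | ht
  · simp [residual, hp0, slopeForm, G_zero]
  have h3 : t * t * (K t - (n : ℝ) ^ 2 / 9) = residual n t * (G n (attractorExpansion n t) *
      (Real.cos (attractorExpansion n t) +
      t * attractorExpansion' n t * Real.sin (attractorExpansion n t)) - n / 3 * t) := by
    have := hKt t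
    simp only [residual, slopeForm] at this ⊢
    linear_combination -this
  rw [h3, norm_mul] at h1
  have htp := norm_pos_iff.2 ht
  have h4 : ‖residual n t‖ * ‖t‖ ≤ C * c * ‖t ^ 7‖ * ‖t‖ := by
    have h5 := mul_le_mul_of_nonneg_left h2 (norm_nonneg (residual n t))
    rw [show t * t * t ^ 6 = t ^ 7 * t by ring, norm_mul] at h1
    nlinarith [mul_le_mul_of_nonneg_left h1 hc0.le]
  exact le_of_mul_le_mul_right h4 htp

theorem deriv_residual_isBigO (hn : 1 ≤ n) :
    deriv (residual n) =O[𝓝 0] fun t : ℝ => t ^ 6 :=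
  (contDiff_residual hn).deriv_isBigO_pow (residual_isBigO hn)

end ScalarCosmology

/-! ## The invariant curve for positive `t` -/

namespace ScalarCosmology

variable {n : ℕ}

/-- `Θ` is an invariant curve over `0 < t < r`, with derivative `Θ₁`, in the wedge around the
center direction. -/
structure IsHalfCurve (n : ℕ) (Θ Θ₁ : ℝ → ℝ) (r : ℝ) : Prop where
  pos : 0 < r
  le : r ≤ 1 / n
  lower : ∀ t ∈ Ioo 0 r, -(Real.sqrt n / 2) * t ≤ Θ t
  upper : ∀ t ∈ Ioo 0 r, Θ t ≤ -(Real.sqrt n / 6) * t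
  hasDerivAt : ∀ t ∈ Ioo 0 r, HasDerivAt Θ (Θ₁ t) t
  eq : ∀ t ∈ Ioo 0 r, slopeForm n (t * Θ₁ t) (Θ t) = -(n / 3 * t)

/-- `z` is a global solution whose past is the graph of `Θ`. -/
structure IsOrbitOf (n : ℕ) (Θ : ℝ → ℝ) (r : ℝ) (z : ℝ → ℝ × ℝ) : Prop where
  isSolutionOn : IsSolutionOn (polarField n) z univ
  strictMonoOn : StrictMonoOn (fun s => (z s).1) (Iic 0)
  fst_zero : (z 0).1 = Real.log r
  tendsto : Tendsto (fun s => (z s).1) atBot atBot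
  snd_eq : ∀ s < 0, (z s).2 = Θ (Real.exp (z s).1)

/-- Along the past of the orbit in the wedge, `u` increases strictly from `-∞` to `log r` with
nonzero speed. Time is thus a differentiable function of `T̃ = exp u`, and so is `θ`. -/
theorem exists_isHalfCurve (hn : 1 ≤ n) : ∃ (Θ Θ₁ : ℝ → ℝ) (r : ℝ) (z : ℝ → ℝ × ℝ),
    IsHalfCurve n Θ Θ₁ r ∧ IsOrbitOf n Θ r z := by
  obtain ⟨r, hr, hrn, z, hz, hz0, hw⟩ := exists_orbit_mem_wedge hn
  have hu : ∀ x, HasDerivAt (fun s => (z s).1) (polarField n (z x)).1 x := fun x =>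
    hz.hasDerivAt_fst (mem_univ x)
  have hmono := monotone_fst_of_isSolutionOn hz
  have hupos : ∀ s ≤ 0, 0 < (polarField n (z s)).1 := fun s hs =>
    (polarField_fst_bound_pos hn r (z s).1).trans_le
      (polarField_fst_ge_of_mem_wedge hn hr hrn (hw s hs) le_rfl)
  have hstrict : StrictMonoOn (fun s => (z s).1) (Iic 0) := by
    refine strictMonoOn_of_deriv_pos (convex_Iic 0)
      (fun s _ => (hu s).continuousAt.continuousWithinAt) fun s hs => ?_
    rw [(hu s).deriv]
    exact hupos s (mem_Iic.1 (interior_subset hs))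
  have hunbdd : ∀ b : ℝ, ∃ s ≤ 0, (z s).1 ≤ b := by
    intro b
    by_contra! hne
    exact not_bddBelow_of_le_deriv (polarField_fst_bound_pos hn r b) (fun t _ => hu t)
      (fun t ht => polarField_fst_ge_of_mem_wedge hn hr hrn (hw t ht) (hne t ht).le)
      fun t ht => (hne t ht).le
  have hbot : Tendsto (fun s => (z s).1) atBot atBot :=
    tendsto_atBot_atBot_of_monotone hmono fun b => (hunbdd b).imp fun s hs => hs.2
  -- Continuing `u` with slope `1` after time `0` gives an order isomorphism of `ℝ`, whose inverse
  -- is automatically continuous. Only its values below `log r` are used.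
  let U : ℝ → ℝ := fun s => (z (min s 0)).1 + max s 0
  have hUneg : ∀ s ≤ 0, U s = (z s).1 := fun s hs => by
    simp only [U, min_eq_left hs, max_eq_right hs, add_zero]
  have hUpos : ∀ s, 0 ≤ s → U s = Real.log r + s := fun s hs => by
    simp only [U, min_eq_right hs, max_eq_left hs, hz0]
  have hUcont : Continuous U := by
    have h1 : Continuous fun s => (z s).1 :=
      continuous_iff_continuousAt.2 fun s => (hu s).continuousAt
    exact (h1.comp (continuous_id.min continuous_const)).add (continuous_id.max continuous_const)
  have hUmono : StrictMono U := by
    refine StrictMonoOn.Iic_union_Ici (a := 0) (fun s hs t ht hst => ?_) (fun s hs t ht hst => ?_)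
    · rw [hUneg s hs, hUneg t ht]
      exact hstrict hs ht hst
    · rw [hUpos s hs, hUpos t ht]
      linarith
  have hUsurj : Function.Surjective U := by
    refine hUcont.surjective (tendsto_atTop_atTop_of_monotone hUmono.monotone fun b => ?_)
      (tendsto_atBot_atBot_of_monotone hUmono.monotone fun b => ?_)
    · refine ⟨max 0 (b - Real.log r), ?_⟩
      rw [hUpos _ (le_max_left _ _)]
      linarith [le_max_right 0 (b - Real.log r)]
    · obtain ⟨s, hs, hsb⟩ := hunbdd b
      exact ⟨s, by rwa [hUneg s hs]⟩
  let e := hUmono.orderIsoOfSurjective U hUsurj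
  have heU : ∀ x, U (e.symm x) = x := fun x => e.apply_symm_apply x
  have heU' : ∀ s, e.symm (U s) = s := fun s => e.symm_apply_apply s
  have hneg : ∀ x < Real.log r, e.symm x < 0 := fun x hx => by
    rw [← hUmono.lt_iff_lt, heU, hUpos 0 le_rfl]
    simpa using hx
  have hze : ∀ x < Real.log r, (z (e.symm x)).1 = x := fun x hx => by
    rw [← hUneg _ (hneg x hx).le, heU]
  have hlog : ∀ t ∈ Ioo 0 r, Real.log t < Real.log r := fun t ht => Real.log_lt_log ht.1 ht.2
  have hexp : ∀ t ∈ Ioo 0 r, Real.exp (z (e.symm (Real.log t))).1 = t := fun t ht => by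
    rw [hze _ (hlog t ht), Real.exp_log ht.1]
  have hmem : ∀ t ∈ Ioo 0 r, z (e.symm (Real.log t)) ∈ wedge n r := fun t ht =>
    hw _ (hneg _ (hlog t ht)).le
  refine ⟨fun t => (z (e.symm (Real.log t))).2, fun t =>
    (polarField n (z (e.symm (Real.log t)))).2 *
      ((polarField n (z (e.symm (Real.log t)))).1⁻¹ * t⁻¹), r, z,
    ⟨hr, hrn, fun t ht => ?_, fun t ht => ?_, fun t ht => ?_, fun t ht => ?_⟩,
    ⟨hz, hstrict, hz0, hbot, fun s hs => ?_⟩⟩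
  · simpa only [hexp t ht] using (hmem t ht).2.1
  · simpa only [hexp t ht] using (hmem t ht).2.2
  · have h1 : HasDerivAt e.symm (polarField n (z (e.symm (Real.log t)))).1⁻¹ (Real.log t) :=
      HasDerivAt.of_local_left_inverse e.symm.continuous.continuousAt (hu _)
        (hupos _ (hneg _ (hlog t ht)).le).ne'
        (by filter_upwards [Iio_mem_nhds (hlog t ht)] with x hx using hze x hx)
    exact (hz.hasDerivAt_snd (mem_univ _)).comp t (h1.comp t (Real.hasDerivAt_log ht.1.ne'))
  · have hv := (hupos _ (hneg _ (hlog t ht)).le).ne'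
    -- For `m` equal to the slope of the orbit the relative velocity vanishes, which leaves the
    -- invariance equation.
    have h := polarField_snd_sub n ((polarField n (z (e.symm (Real.log t)))).2 *
      ((polarField n (z (e.symm (Real.log t)))).1⁻¹ * t⁻¹)) (z (e.symm (Real.log t)))
    rw [hexp t ht] at h
    have ht0 := ht.1.ne'
    have hl : (polarField n (z (e.symm (Real.log t)))).2 -
        (polarField n (z (e.symm (Real.log t)))).2 *
        ((polarField n (z (e.symm (Real.log t)))).1⁻¹ * t⁻¹) *
        (t * (polarField n (z (e.symm (Real.log t)))).1) = 0 := by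
      field_simp
      ring
    rw [hl] at h
    have h2 := (mul_eq_zero.1 h.symm).resolve_left (mul_pos (F_pos hn _) (lapse_pos _)).ne'
    have hn0 : (n : ℝ) ≠ 0 := by positivity
    rw [mul_comm t]
    field_simp at h2 ⊢
    linarith
  · simp only [Real.log_exp]
    rw [← hUneg s hs.le, heU']

end ScalarCosmology

/-! ## Asymptotics of the invariant curve at `t = 0` -/

theorem ContDiffAt.isBigO_sub_comp {E F ι : Type*} [NormedAddCommGroup E] [NormedSpace ℝ E]
    [NormedAddCommGroup F] [NormedSpace ℝ F] {f : E → F} {x : E} (hf : ContDiffAt ℝ 1 f x)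
    {l : Filter ι} {a b : ι → E} (ha : Tendsto a l (𝓝 x)) (hb : Tendsto b l (𝓝 x)) :
    (fun i => f (a i) - f (b i)) =O[l] fun i => a i - b i := by
  have h := (hf.hasStrictFDerivAt one_ne_zero).isBigO_sub
  have hab : Tendsto (fun i => (a i, b i)) l (𝓝 (x, x)) := ha.prodMk_nhds hb
  exact h.comp_tendsto hab

theorem isBigO_pow_of_mul_pow {f : ℝ → ℝ} {k m : ℕ}
    (h : (fun t => f t * t ^ k) =O[𝓝[>] 0] fun t : ℝ => t ^ (m + k)) :
    f =O[𝓝[>] 0] fun t : ℝ => t ^ m := by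
  obtain ⟨c, hc⟩ := h.bound
  refine Asymptotics.IsBigO.of_bound c ?_
  filter_upwards [hc, self_mem_nhdsWithin] with t ht ht0
  rw [pow_add, norm_mul, norm_mul, ← mul_assoc] at ht
  exact le_of_mul_le_mul_right ht (norm_pos_iff.2 (pow_ne_zero k (ne_of_gt ht0)))

namespace ScalarCosmology

variable {n : ℕ} {Θ Θ₁ : ℝ → ℝ} {r : ℝ}

/-- The second derivative of an invariant curve is expressed by this function of the
curve and its first derivative. -/
def curvatureForm (n : ℕ) (z : ℝ × ℝ × ℝ) : ℝ :=
  slopeForm' n (z.1 * z.2.2) z.2.1 * z.2.2 + G n z.2.1 * Real.sin z.2.1 * z.2.2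

theorem contDiff_curvatureForm (hn : 1 ≤ n) {r : WithTop ℕ∞} : ContDiff ℝ r (curvatureForm n) := by
  have h1 : ContDiff ℝ r (fun z : ℝ × ℝ × ℝ => slopeForm' n (z.1 * z.2.2) z.2.1) :=
    (contDiff_slopeForm' hn).comp (f := fun z : ℝ × ℝ × ℝ => (z.1 * z.2.2, z.2.1)) (by fun_prop)
  have h2 : ContDiff ℝ r (fun z : ℝ × ℝ × ℝ => G n z.2.1) :=
    (contDiff_G hn).comp (f := fun z : ℝ × ℝ × ℝ => z.2.1) (by fun_prop)
  unfold curvatureForm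
  fun_prop

theorem contDiff_slopeForm (hn : 1 ≤ n) {r : WithTop ℕ∞} :
    ContDiff ℝ r (fun z : ℝ × ℝ => slopeForm n z.1 z.2) := by
  have h1 : ContDiff ℝ r (fun z : ℝ × ℝ => G n z.2) := (contDiff_G hn).comp contDiff_snd
  unfold slopeForm
  fun_prop

theorem slopeForm_sub (n : ℕ) (κ₁ κ₂ θ : ℝ) :
    slopeForm n κ₁ θ - slopeForm n κ₂ θ = (κ₁ - κ₂) * (G n θ * Real.sin θ) := by
  unfold slopeForm
  ring

theorem continuous_attractorExpansion (n : ℕ) : Continuous (attractorExpansion n) :=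
  continuous_iff_continuousAt.2 fun t => (hasDerivAt_attractorExpansion n t).continuousAt

theorem continuous_attractorExpansion' (n : ℕ) : Continuous (attractorExpansion' n) :=
  continuous_iff_continuousAt.2 fun t => (hasDerivAt_attractorExpansion' n t).continuousAt

theorem attractorExpansion_zero (n : ℕ) : attractorExpansion n 0 = 0 := by
  simp [attractorExpansion]

theorem attractorExpansion'_zero (n : ℕ) : attractorExpansion' n 0 = -(Real.sqrt n / 3) := by
  simp [attractorExpansion']

theorem attractorExpansion_isBigO (n : ℕ) : attractorExpansion n =O[𝓝 0] fun t : ℝ => t := by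
  have h := (hasDerivAt_attractorExpansion n 0).hasFDerivAt.isBigO_sub
  simpa [attractorExpansion_zero] using h

theorem attractorExpansion''_isBigO (n : ℕ) : attractorExpansion'' n =O[𝓝 0] fun t : ℝ => t := by
  have h : (fun t : ℝ => t ^ 1 * (-(Real.sqrt n / 3) * (6 * cubicCoeff n +
      20 * quinticCoeff n * t ^ 2))) =O[𝓝 0] fun t : ℝ => t ^ 1 :=
    HasEvenJet.isBigO_pow_mul 1 (HasEvenJet.isBigO_one_of_continuous (by fun_prop))
  refine h.congr (fun t => ?_) fun t => pow_one t
  unfold attractorExpansion''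
  ring

namespace IsHalfCurve

theorem mem_nhdsGT (h : IsHalfCurve n Θ Θ₁ r) : Ioo 0 r ∈ 𝓝[>] (0 : ℝ) := Ioo_mem_nhdsGT h.pos

theorem tendsto_zero (h : IsHalfCurve n Θ Θ₁ r) : Tendsto Θ (𝓝[>] 0) (𝓝 0) := by
  have hl : ∀ m : ℝ, Tendsto (fun t => -m * t) (𝓝[>] 0) (𝓝 0) := fun m => by
    have := ((continuous_const_mul (-m)).tendsto (0 : ℝ)).mono_left
      (nhdsWithin_le_nhds (s := Ioi 0))
    simpa using this
  refine tendsto_of_tendsto_of_tendsto_of_le_of_le' (hl (Real.sqrt n / 2)) (hl (Real.sqrt n / 6))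
    ?_ ?_
  · filter_upwards [h.mem_nhdsGT] with t ht using h.lower t ht
  · filter_upwards [h.mem_nhdsGT] with t ht using h.upper t ht

theorem abs_le (hn : 1 ≤ n) (h : IsHalfCurve n Θ Θ₁ r) {t : ℝ} (ht : t ∈ Ioo 0 r) :
    |Θ t| ≤ 1 ∧ t / 6 ≤ |Θ t| := by
  have hs := one_le_sqrt_natCast hn
  have hn' : (1 : ℝ) ≤ n := by exact_mod_cast hn
  have hsn : Real.sqrt n ≤ n := by
    nlinarith [Real.mul_self_sqrt (show (0 : ℝ) ≤ n by positivity)]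
  have htn : t * n ≤ 1 := by
    have := (ht.2.trans_le h.le).le
    rwa [le_div_iff₀ (by positivity)] at this
  have h1 := h.lower t ht
  have h2 := h.upper t ht
  have h0 := ht.1
  have h3 : Θ t ≤ 0 := by nlinarith
  rw [abs_of_nonpos h3]
  constructor <;> nlinarith

theorem sq_le_G_mul_sin (hn : 1 ≤ n) (h : IsHalfCurve n Θ Θ₁ r) {t : ℝ} (ht : t ∈ Ioo 0 r) :
    t ^ 2 / 144 ≤ G n (Θ t) * Real.sin (Θ t) := by
  obtain ⟨h1, h2⟩ := h.abs_le hn ht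
  refine le_trans ?_ (sq_div_four_le_G_mul_sin hn h1).1
  rw [← sq_abs (Θ t)]
  nlinarith [ht.1]

/-- Let `p` be the expansion and `D = Θ - p`. Subtracting the equations gives `t D' G(Θ) sin Θ =
slopeForm(p) - slopeForm(Θ) - residual`, both forms taken with `κ = t p'`. Where `D > 2 K t⁷`, the
slope bound `1 / 2` of `slopeForm` outweighs the residual and `D' ≤ 0`. So `D - 2 K t⁷` decreases
wherever it is positive; as it tends to `0` at `t = 0`, it is never positive. The same holds for
`-D`. -/
theorem exists_abs_sub_le (hn : 1 ≤ n) (h : IsHalfCurve n Θ Θ₁ r) :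
    ∃ C, ∀ᶠ t in 𝓝[>] 0, |Θ t - attractorExpansion n t| ≤ C * t ^ 7 := by
  obtain ⟨ρ, hρ, hmono⟩ := exists_slopeForm_sub_ge hn
  obtain ⟨K, hK0, hK⟩ := (residual_isBigO hn).exists_pos
  have hev : ∀ᶠ t in 𝓝[>] 0, t ∈ Ioo 0 r ∧ |residual n t| ≤ K * t ^ 7 ∧
      |t * attractorExpansion' n t| ≤ ρ ∧ |Θ t| ≤ ρ ∧ |attractorExpansion n t| ≤ ρ := by
    have hball : ∀ {f : ℝ → ℝ}, Tendsto f (𝓝[>] 0) (𝓝 0) → ∀ᶠ t in 𝓝[>] 0, |f t| ≤ ρ := by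
      intro f hf
      filter_upwards [hf.eventually (Metric.closedBall_mem_nhds 0 hρ)] with t ht
      simpa using ht
    have hp : Tendsto (attractorExpansion n) (𝓝[>] 0) (𝓝 0) := by
      have := ((continuous_attractorExpansion n).tendsto 0).mono_left
        (nhdsWithin_le_nhds (s := Ioi 0))
      rwa [attractorExpansion_zero] at this
    have hp' : Tendsto (fun t => t * attractorExpansion' n t) (𝓝[>] 0) (𝓝 0) := by
      refine tendsto_nhdsWithin_of_tendsto_nhds ?_
      have := (continuous_id.mul (continuous_attractorExpansion' n)).tendsto 0
      rwa [Pi.mul_apply, id, zero_mul] at this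
    filter_upwards [h.mem_nhdsGT, nhdsWithin_le_nhds hK.bound, hball hp', hball h.tendsto_zero,
      hball hp] with t h1 h2 h3 h4 h5
    refine ⟨h1, ?_, h3, h4, h5⟩
    rwa [Real.norm_eq_abs, norm_pow, Real.norm_eq_abs, abs_of_pos h1.1] at h2
  obtain ⟨b, hb, hbs⟩ := mem_nhdsGT_iff_exists_Ioo_subset.1 hev
  have hpt : ∀ (e : ℝ), Tendsto (fun t => e * (Θ t - attractorExpansion n t) - 2 * K * t ^ 7)
      (𝓝[>] 0) (𝓝 0) := by
    intro e
    have h1 : Tendsto (attractorExpansion n) (𝓝[>] 0) (𝓝 (attractorExpansion n 0)) :=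
      ((continuous_attractorExpansion n).tendsto 0).mono_left nhdsWithin_le_nhds
    have h2 : Tendsto (fun t : ℝ => 2 * K * t ^ 7) (𝓝[>] 0) (𝓝 (2 * K * 0 ^ 7)) :=
      ((by fun_prop : Continuous fun t : ℝ => 2 * K * t ^ 7).tendsto 0).mono_left
        nhdsWithin_le_nhds
    have := ((h.tendsto_zero.sub h1).const_mul e).sub h2
    simpa [attractorExpansion_zero] using this
  have hder : ∀ (e : ℝ), ∀ t ∈ Ioo 0 b,
      HasDerivAt (fun t => e * (Θ t - attractorExpansion n t) - 2 * K * t ^ 7)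
        (e * (Θ₁ t - attractorExpansion' n t) - 2 * K * (7 * t ^ 6)) t := by
    intro e t ht
    have h1 := ((h.hasDerivAt t (hbs ht).1).sub (hasDerivAt_attractorExpansion n t)).const_mul e
    exact (h1.sub ((hasDerivAt_pow 7 t).const_mul (2 * K))).congr_deriv (by simp)
  have hkey : ∀ t ∈ Ioo 0 b, t * (Θ₁ t - attractorExpansion' n t) * (G n (Θ t) * Real.sin (Θ t)) =
      slopeForm n (t * attractorExpansion' n t) (attractorExpansion n t) -
      slopeForm n (t * attractorExpansion' n t) (Θ t) - residual n t := by
    intro t ht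
    have h1 := slopeForm_sub n (t * Θ₁ t) (t * attractorExpansion' n t) (Θ t)
    rw [h.eq t (hbs ht).1] at h1
    unfold residual
    linear_combination -h1
  refine ⟨2 * K, ?_⟩
  filter_upwards [Ioo_mem_nhdsGT hb] with t ht
  rw [_root_.abs_le]
  have hup := nonpos_of_deriv_nonpos_of_pos (hder 1) (fun s hs hpos => ?_) (hpt 1) ht
  have hlo := nonpos_of_deriv_nonpos_of_pos (hder (-1)) (fun s hs hpos => ?_) (hpt (-1)) ht
  · constructor <;> linarith
  · obtain ⟨h1, h2, h3, h4, h5⟩ := hbs hs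
    have hs7 : 0 < s ^ 7 := pow_pos h1.1 7
    have hs6 : 0 < s ^ 6 := pow_pos h1.1 6
    have hle := hmono _ _ _ h3 h4 h5 (by nlinarith)
    have hk := hkey s hs
    have hG : 0 < s * (G n (Θ s) * Real.sin (Θ s)) :=
      mul_pos h1.1 (lt_of_lt_of_le (by have := h1.1; positivity) (h.sq_le_G_mul_sin hn h1))
    have := (_root_.abs_le.1 h2).2
    have hneg : 0 ≤ (Θ₁ s - attractorExpansion' n s) * (s * (G n (Θ s) * Real.sin (Θ s))) := by
      rw [show (Θ₁ s - attractorExpansion' n s) * (s * (G n (Θ s) * Real.sin (Θ s))) =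
        s * (Θ₁ s - attractorExpansion' n s) * (G n (Θ s) * Real.sin (Θ s)) by ring, hk]
      linarith
    have := nonneg_of_mul_nonneg_left hneg hG
    nlinarith
  · obtain ⟨h1, h2, h3, h4, h5⟩ := hbs hs
    have hs7 : 0 < s ^ 7 := pow_pos h1.1 7
    have hs6 : 0 < s ^ 6 := pow_pos h1.1 6
    have hle := hmono _ _ _ h3 h5 h4 (by nlinarith)
    have hk := hkey s hs
    have hG : 0 < s * (G n (Θ s) * Real.sin (Θ s)) :=
      mul_pos h1.1 (lt_of_lt_of_le (by have := h1.1; positivity) (h.sq_le_G_mul_sin hn h1))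
    have := (_root_.abs_le.1 h2).1
    have hneg : (Θ₁ s - attractorExpansion' n s) * (s * (G n (Θ s) * Real.sin (Θ s))) ≤ 0 := by
      rw [show (Θ₁ s - attractorExpansion' n s) * (s * (G n (Θ s) * Real.sin (Θ s))) =
        s * (Θ₁ s - attractorExpansion' n s) * (G n (Θ s) * Real.sin (Θ s)) by ring, hk]
      linarith
    have := nonpos_of_mul_nonpos_left hneg hG
    nlinarith

theorem sub_isBigO (hn : 1 ≤ n) (h : IsHalfCurve n Θ Θ₁ r) :
    (fun t => Θ t - attractorExpansion n t) =O[𝓝[>] 0] fun t : ℝ => t ^ 7 := by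
  obtain ⟨C, hC⟩ := h.exists_abs_sub_le hn
  refine Asymptotics.IsBigO.of_bound C ?_
  filter_upwards [hC, self_mem_nhdsWithin] with t ht ht0
  rwa [Real.norm_eq_abs, norm_pow, Real.norm_eq_abs, abs_of_pos (mem_Ioi.1 ht0)]

/-- Division by `t G(Θ) sin Θ`, which is of order `t³`. -/
theorem isBigO_of_mul (hn : 1 ≤ n) (h : IsHalfCurve n Θ Θ₁ r) {f : ℝ → ℝ} {m : ℕ}
    (hf : (fun t => f t * (t * (G n (Θ t) * Real.sin (Θ t)))) =O[𝓝[>] 0]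
      fun t : ℝ => t ^ (m + 3)) : f =O[𝓝[>] 0] fun t : ℝ => t ^ m := by
  have h3 : (fun t : ℝ => t ^ 3) =O[𝓝[>] 0] fun t => t * (G n (Θ t) * Real.sin (Θ t)) := by
    refine Asymptotics.IsBigO.of_bound 144 ?_
    filter_upwards [h.mem_nhdsGT] with t ht
    have h1 := h.sq_le_G_mul_sin hn ht
    have h0 := ht.1
    rw [Real.norm_eq_abs, Real.norm_eq_abs, abs_of_pos (by positivity),
      abs_of_nonneg (mul_nonneg h0.le (G_mul_sin_nonneg n _))]
    nlinarith
  exact isBigO_pow_of_mul_pow (((Asymptotics.isBigO_refl f _).mul h3).trans hf)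

theorem tendsto_attractorExpansion (n : ℕ) :
    Tendsto (attractorExpansion n) (𝓝[>] 0) (𝓝 0) := by
  have := ((continuous_attractorExpansion n).tendsto 0).mono_left (nhdsWithin_le_nhds (s := Ioi 0))
  rwa [attractorExpansion_zero] at this

theorem tendsto_attractorExpansion' (n : ℕ) :
    Tendsto (attractorExpansion' n) (𝓝[>] 0) (𝓝 (-(Real.sqrt n / 3))) := by
  have := ((continuous_attractorExpansion' n).tendsto 0).mono_left (nhdsWithin_le_nhds (s := Ioi 0))
  rwa [attractorExpansion'_zero] at this

/-- Solving the invariance equation for the derivative divides by a factor of order `t³`, hence the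
loss from `t⁷` to `t⁴`. -/
theorem deriv_sub_isBigO (hn : 1 ≤ n) (h : IsHalfCurve n Θ Θ₁ r) :
    (fun t => Θ₁ t - attractorExpansion' n t) =O[𝓝[>] 0] fun t : ℝ => t ^ 4 := by
  refine h.isBigO_of_mul hn (m := 4) ?_
  have hid : Tendsto (fun t : ℝ => t) (𝓝[>] 0) (𝓝 0) := nhdsWithin_le_nhds
  have hκ : Tendsto (fun t => t * attractorExpansion' n t) (𝓝[>] 0) (𝓝 0) := by
    simpa using hid.mul (tendsto_attractorExpansion' n)
  have h1 := ((contDiff_slopeForm hn (r := 1)).contDiffAt (x := ((0 : ℝ), (0 : ℝ)))).isBigO_sub_comp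
    (hκ.prodMk_nhds (tendsto_attractorExpansion n)) (hκ.prodMk_nhds h.tendsto_zero)
  have h2 : (fun t => ((t * attractorExpansion' n t, attractorExpansion n t) : ℝ × ℝ) -
      (t * attractorExpansion' n t, Θ t)) =O[𝓝[>] 0] fun t : ℝ => t ^ 7 := by
    refine Asymptotics.IsBigO.prod_left ?_ ?_
    · simp only [sub_self]
      exact Asymptotics.isBigO_zero _ _
    · exact (h.sub_isBigO hn).neg_left.congr_left fun t => by ring
  refine ((h1.trans h2).sub ((residual_isBigO hn).mono nhdsWithin_le_nhds)).congr' ?_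
    EventuallyEq.rfl
  filter_upwards [h.mem_nhdsGT] with t ht
  have h3 := slopeForm_sub n (t * Θ₁ t) (t * attractorExpansion' n t) (Θ t)
  rw [h.eq t ht] at h3
  unfold residual
  linear_combination h3

theorem tendsto_deriv (hn : 1 ≤ n) (h : IsHalfCurve n Θ Θ₁ r) :
    Tendsto Θ₁ (𝓝[>] 0) (𝓝 (-(Real.sqrt n / 3))) := by
  have h1 : Tendsto (fun t : ℝ => t ^ 4) (𝓝[>] 0) (𝓝 0) := by
    have := ((continuous_pow 4).tendsto (0 : ℝ)).mono_left (nhdsWithin_le_nhds (s := Ioi 0))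
    simpa using this
  simpa using ((h.deriv_sub_isBigO hn).trans_tendsto h1).add (tendsto_attractorExpansion' n)

/-- The second derivative of an invariant curve. -/
def secondDeriv (n : ℕ) (Θ Θ₁ : ℝ → ℝ) (t : ℝ) : ℝ :=
  (-(n / 3) - curvatureForm n (t, Θ t, Θ₁ t)) / (t * (G n (Θ t) * Real.sin (Θ t)))

theorem mul_G_mul_sin_pos (hn : 1 ≤ n) (h : IsHalfCurve n Θ Θ₁ r) {t : ℝ} (ht : t ∈ Ioo 0 r) :
    0 < t * (G n (Θ t) * Real.sin (Θ t)) := by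
  have := ht.1
  exact mul_pos ht.1 (lt_of_lt_of_le (by positivity) (h.sq_le_G_mul_sin hn ht))

theorem hasDerivAt_deriv (hn : 1 ≤ n) (h : IsHalfCurve n Θ Θ₁ r) {t : ℝ} (ht : t ∈ Ioo 0 r) :
    HasDerivAt Θ₁ (secondDeriv n Θ Θ₁ t) t := by
  have hΘ := h.hasDerivAt t ht
  have hG : HasDerivAt (fun t => G n (Θ t)) (G' n (Θ t) * Θ₁ t) t := (hasDerivAt_G hn _).comp t hΘ
  have hc : HasDerivAt (fun t => Real.cos (Θ t)) (-Real.sin (Θ t) * Θ₁ t) t :=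
    (Real.hasDerivAt_cos _).comp t hΘ
  have hs : HasDerivAt (fun t => Real.sin (Θ t)) (Real.cos (Θ t) * Θ₁ t) t :=
    (Real.hasDerivAt_sin _).comp t hΘ
  have hne := (h.mul_G_mul_sin_pos hn ht).ne'
  have hN := ((hasDerivAt_id t).const_mul (-(n / 3 : ℝ))).sub (hG.mul hc)
  have hD := (hasDerivAt_id t).mul (hG.mul hs)
  have heq : ∀ s ∈ Ioo 0 r, Θ₁ s * (s * (G n (Θ s) * Real.sin (Θ s))) =
      -(n / 3) * s - G n (Θ s) * Real.cos (Θ s) := fun s hs => by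
    have := h.eq s hs
    unfold slopeForm at this
    linear_combination this
  refine ((hN.div hD hne).congr_of_eventuallyEq ?_).congr_deriv ?_
  · filter_upwards [Ioo_mem_nhds ht.1 ht.2] with s hs
    exact eq_div_of_mul_eq (h.mul_G_mul_sin_pos hn hs).ne' (heq s hs)
  · have he := heq t ht
    simp only [id, Pi.mul_apply, Pi.sub_apply, secondDeriv, curvatureForm, slopeForm'] at hne ⊢
    rw [← he]
    field_simp
    ring

theorem continuousOn_secondDeriv (hn : 1 ≤ n) (h : IsHalfCurve n Θ Θ₁ r) :
    ContinuousOn (secondDeriv n Θ Θ₁) (Ioo 0 r) := by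
  have hΘ : ContinuousOn Θ (Ioo 0 r) := fun t ht =>
    (h.hasDerivAt t ht).continuousAt.continuousWithinAt
  have hΘ₁ : ContinuousOn Θ₁ (Ioo 0 r) := fun t ht =>
    (h.hasDerivAt_deriv hn ht).continuousAt.continuousWithinAt
  have hG : ContinuousOn (fun t => G n (Θ t)) (Ioo 0 r) :=
    (contDiff_G hn (r := 0)).continuous.comp_continuousOn hΘ
  have hs : ContinuousOn (fun t => Real.sin (Θ t)) (Ioo 0 r) :=
    Real.continuous_sin.comp_continuousOn hΘ
  have hC : ContinuousOn (fun t => curvatureForm n (t, Θ t, Θ₁ t)) (Ioo 0 r) :=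
    (contDiff_curvatureForm hn (r := 0)).continuous.comp_continuousOn
      (continuousOn_id.prodMk (hΘ.prodMk hΘ₁))
  exact (continuousOn_const.sub hC).div (continuousOn_id.mul (hG.mul hs))
    fun t ht => (h.mul_G_mul_sin_pos hn ht).ne'

/-- The derivative of the residual controls the numerator of `secondDeriv` at the expansion, and the
numerator at `Θ` differs from it by `O(t⁴)`. Division by `t³` leaves `O(t)`. With the cubic
expansion alone the same argument would leave only `O(t⁻¹)`. -/
theorem tendsto_secondDeriv (hn : 1 ≤ n) (h : IsHalfCurve n Θ Θ₁ r) :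
    Tendsto (secondDeriv n Θ Θ₁) (𝓝[>] 0) (𝓝 0) := by
  have hid : Tendsto (fun t : ℝ => t) (𝓝[>] 0) (𝓝 0) := nhdsWithin_le_nhds
  have h1 := ((contDiff_curvatureForm hn (r := 1)).contDiffAt
    (x := ((0 : ℝ), (0 : ℝ), -(Real.sqrt n / 3)))).isBigO_sub_comp
    (hid.prodMk_nhds ((tendsto_attractorExpansion n).prodMk_nhds (tendsto_attractorExpansion' n)))
    (hid.prodMk_nhds (h.tendsto_zero.prodMk_nhds (h.tendsto_deriv hn)))
  have hpow : ∀ {k : ℕ}, 4 ≤ k → (fun t : ℝ => t ^ k) =O[𝓝[>] 0] fun t : ℝ => t ^ 4 := by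
    intro k hk
    obtain ⟨j, rfl⟩ := Nat.exists_eq_add_of_le hk
    refine ((HasEvenJet.isBigO_pow_mul 4 (HasEvenJet.isBigO_one_of_continuous
      (continuous_pow j))).mono nhdsWithin_le_nhds).congr_left fun t => ?_
    rw [pow_add]
  have h2 : (fun t => ((t, attractorExpansion n t, attractorExpansion' n t) : ℝ × ℝ × ℝ) -
      (t, Θ t, Θ₁ t)) =O[𝓝[>] 0] fun t : ℝ => t ^ 4 := by
    refine Asymptotics.IsBigO.prod_left ?_ (Asymptotics.IsBigO.prod_left ?_ ?_)
    · simp only [sub_self]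
      exact Asymptotics.isBigO_zero _ _
    · exact ((h.sub_isBigO hn).trans (hpow (by norm_num))).neg_left.congr_left fun t => by ring
    · exact (h.deriv_sub_isBigO hn).neg_left.congr_left fun t => by ring
  have hR : deriv (residual n) =O[𝓝[>] 0] fun t : ℝ => t ^ 4 :=
    ((deriv_residual_isBigO hn).mono nhdsWithin_le_nhds).trans (hpow (by norm_num))
  have hdR : ∀ t, deriv (residual n) t = curvatureForm n (t, attractorExpansion n t,
      attractorExpansion' n t) + n / 3 + t * attractorExpansion'' n t *
      (G n (attractorExpansion n t) * Real.sin (attractorExpansion n t)) := by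
    intro t
    have hp := hasDerivAt_attractorExpansion n t
    have hp' := hasDerivAt_attractorExpansion' n t
    have hG := (hasDerivAt_G hn _).comp t hp
    have hc := (Real.hasDerivAt_cos _).comp t hp
    have hs := (Real.hasDerivAt_sin _).comp t hp
    have := ((hG.mul (hc.add (((hasDerivAt_id t).mul hp').mul hs))).add
      ((hasDerivAt_id t).const_mul (n / 3 : ℝ)))
    refine (HasDerivAt.deriv (f := residual n) this).trans ?_
    simp only [Function.comp, id, Pi.mul_apply, Pi.add_apply, curvatureForm, slopeForm']
    ring
  have hG : (fun t => G n (attractorExpansion n t)) =O[𝓝 0] fun t : ℝ => t := by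
    have h3 := (hasDerivAt_G hn 0).hasFDerivAt.isBigO_sub
    simp only [G_zero, sub_zero] at h3
    have hp0 : Tendsto (attractorExpansion n) (𝓝 0) (𝓝 0) := by
      simpa [attractorExpansion_zero] using (continuous_attractorExpansion n).tendsto 0
    exact (h3.comp_tendsto hp0).trans (attractorExpansion_isBigO n)
  have hs : (fun t => Real.sin (attractorExpansion n t)) =O[𝓝 0] fun t : ℝ => t :=
    (Asymptotics.isBigO_of_le _ fun t => by
      simpa only [Real.norm_eq_abs] using Real.abs_sin_le_abs).trans (attractorExpansion_isBigO n)
  have hrest : (fun t => t * attractorExpansion'' n t *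
      (G n (attractorExpansion n t) * Real.sin (attractorExpansion n t))) =O[𝓝[>] 0]
      fun t : ℝ => t ^ 4 :=
    ((((Asymptotics.isBigO_refl (fun t : ℝ => t) _).mul (attractorExpansion''_isBigO n)).mul
      (hG.mul hs)).mono nhdsWithin_le_nhds).congr_right fun t => by ring
  have hO : secondDeriv n Θ Θ₁ =O[𝓝[>] 0] fun t : ℝ => t ^ 1 := by
    refine h.isBigO_of_mul hn (m := 1) ?_
    refine (((h1.trans h2).add hrest).sub hR).congr' ?_ EventuallyEq.rfl
    filter_upwards [h.mem_nhdsGT] with t ht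
    rw [secondDeriv, div_mul_cancel₀ _ (h.mul_G_mul_sin_pos hn ht).ne', hdR]
    ring
  exact hO.trans_tendsto (by simpa using hid)

end IsHalfCurve

end ScalarCosmology

/-! ## Odd extensions -/

/-- A function which is differentiable near a point, where it is continuous, with derivative
continuous at the point, is differentiable at the point. -/
theorem hasDerivAt_of_eventually_hasDerivAt_of_ne {f g : ℝ → ℝ} {x : ℝ}
    (h : ∀ᶠ y in 𝓝[≠] x, HasDerivAt f (g y) y) (hf : ContinuousAt f x) (hg : ContinuousAt g x) :
    HasDerivAt f (g x) x := by
  have hgt : {y | HasDerivAt f (g y) y} ∈ 𝓝[>] x :=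
    nhdsWithin_mono x (fun y hy => ne_of_gt hy) h
  have hlt : {y | HasDerivAt f (g y) y} ∈ 𝓝[<] x :=
    nhdsWithin_mono x (fun y hy => ne_of_lt hy) h
  have hdiff : DifferentiableOn ℝ f {y | HasDerivAt f (g y) y} := fun y hy =>
    (HasDerivAt.differentiableAt hy).differentiableWithinAt
  have A := hasDerivWithinAt_Ici_of_tendsto_deriv hdiff hf.continuousWithinAt hgt
    ((hg.tendsto.mono_left nhdsWithin_le_nhds).congr' (by
      filter_upwards [hgt] with y hy using (HasDerivAt.deriv hy).symm))
  have B := hasDerivWithinAt_Iic_of_tendsto_deriv hdiff hf.continuousWithinAt hlt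
    ((hg.tendsto.mono_left nhdsWithin_le_nhds).congr' (by
      filter_upwards [hlt] with y hy using (HasDerivAt.deriv hy).symm))
  simpa using B.union A

/-- The odd function that agrees with `f` on positive numbers. -/
def oddExtension (f : ℝ → ℝ) (t : ℝ) : ℝ := if 0 < t then f t else if t < 0 then -f (-t) else 0

/-- The even function that agrees with `f` on positive numbers and takes the value `m` at `0`. -/
def evenExtension (f : ℝ → ℝ) (m t : ℝ) : ℝ :=
  if 0 < t then f t else if t < 0 then f (-t) else m

section OddExtension

variable {f f' : ℝ → ℝ} {m r : ℝ}

theorem oddExtension_of_pos {t : ℝ} (ht : 0 < t) : oddExtension f t = f t := if_pos ht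

theorem oddExtension_of_neg {t : ℝ} (ht : t < 0) : oddExtension f t = -f (-t) := by
  rw [oddExtension, if_neg ht.not_gt, if_pos ht]

theorem oddExtension_zero : oddExtension f 0 = 0 := by simp [oddExtension]

theorem evenExtension_of_pos {t : ℝ} (ht : 0 < t) : evenExtension f m t = f t := if_pos ht

theorem evenExtension_of_neg {t : ℝ} (ht : t < 0) : evenExtension f m t = f (-t) := by
  rw [evenExtension, if_neg ht.not_gt, if_pos ht]

theorem evenExtension_zero : evenExtension f m 0 = m := by simp [evenExtension]

theorem odd_oddExtension : Function.Odd (oddExtension f) := by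
  intro t
  rcases lt_trichotomy t 0 with h | rfl | h
  · rw [oddExtension_of_pos (neg_pos.2 h), oddExtension_of_neg h, neg_neg]
  · simp [oddExtension_zero]
  · rw [oddExtension_of_neg (neg_neg_of_pos h), oddExtension_of_pos h, neg_neg]

theorem tendsto_neg_nhdsLT_zero : Tendsto (fun t : ℝ => -t) (𝓝[<] 0) (𝓝[>] 0) := by
  simpa using tendsto_neg_nhdsLT (a := (0 : ℝ))

theorem continuousAt_oddExtension (h : Tendsto f (𝓝[>] 0) (𝓝 0)) :
    ContinuousAt (oddExtension f) 0 := by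
  rw [continuousAt_iff_continuous_left'_right', ContinuousWithinAt, ContinuousWithinAt,
    oddExtension_zero]
  constructor
  · have := (h.comp tendsto_neg_nhdsLT_zero).neg
    rw [neg_zero] at this
    refine this.congr' ?_
    filter_upwards [self_mem_nhdsWithin] with t ht using (oddExtension_of_neg ht).symm
  · refine h.congr' ?_
    filter_upwards [self_mem_nhdsWithin] with t ht using (oddExtension_of_pos ht).symm

theorem continuousAt_evenExtension (h : Tendsto f (𝓝[>] 0) (𝓝 m)) :
    ContinuousAt (evenExtension f m) 0 := by
  rw [continuousAt_iff_continuous_left'_right', ContinuousWithinAt, ContinuousWithinAt,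
    evenExtension_zero]
  constructor
  · refine (h.comp tendsto_neg_nhdsLT_zero).congr' ?_
    filter_upwards [self_mem_nhdsWithin] with t ht using (evenExtension_of_neg ht).symm
  · refine h.congr' ?_
    filter_upwards [self_mem_nhdsWithin] with t ht using (evenExtension_of_pos ht).symm

theorem eventuallyEq_oddExtension_of_pos {t : ℝ} (ht : 0 < t) : oddExtension f =ᶠ[𝓝 t] f := by
  filter_upwards [Ioi_mem_nhds ht] with s hs using oddExtension_of_pos hs

theorem eventuallyEq_oddExtension_of_neg {t : ℝ} (ht : t < 0) :
    oddExtension f =ᶠ[𝓝 t] fun s => -f (-s) := by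
  filter_upwards [Iio_mem_nhds ht] with s hs using oddExtension_of_neg hs

theorem eventuallyEq_evenExtension_of_pos {t : ℝ} (ht : 0 < t) :
    evenExtension f m =ᶠ[𝓝 t] f := by
  filter_upwards [Ioi_mem_nhds ht] with s hs using evenExtension_of_pos hs

theorem eventuallyEq_evenExtension_of_neg {t : ℝ} (ht : t < 0) :
    evenExtension f m =ᶠ[𝓝 t] fun s => f (-s) := by
  filter_upwards [Iio_mem_nhds ht] with s hs using evenExtension_of_neg hs

theorem eventually_mem_Ioo_ne (hr : 0 < r) : ∀ᶠ t in 𝓝[≠] (0 : ℝ), t ∈ Ioo (-r) r ∧ t ≠ 0 :=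
  (eventually_mem_nhdsWithin.and (nhdsWithin_le_nhds (Ioo_mem_nhds (neg_lt_zero.2 hr) hr))).mono
    fun _ h => ⟨h.2, h.1⟩

theorem hasDerivAt_oddExtension (h : ∀ t ∈ Ioo 0 r, HasDerivAt f (f' t) t)
    (h0 : Tendsto f (𝓝[>] 0) (𝓝 0)) (h0' : Tendsto f' (𝓝[>] 0) (𝓝 m)) {t : ℝ}
    (ht : t ∈ Ioo (-r) r) : HasDerivAt (oddExtension f) (evenExtension f' m t) t := by
  have hne : ∀ t ∈ Ioo (-r) r, t ≠ 0 → HasDerivAt (oddExtension f) (evenExtension f' m t) t := by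
    intro t ht h0
    rcases h0.lt_or_gt with hlt | hgt
    · rw [evenExtension_of_neg hlt]
      refine HasDerivAt.congr_of_eventuallyEq ?_ (eventuallyEq_oddExtension_of_neg hlt)
      have := (h (-t) ⟨neg_pos.2 hlt, by linarith [ht.1]⟩).scomp t (hasDerivAt_neg t)
      exact this.neg.congr_deriv (by simp)
    · rw [evenExtension_of_pos hgt]
      exact (h t ⟨hgt, ht.2⟩).congr_of_eventuallyEq (eventuallyEq_oddExtension_of_pos hgt)
  rcases eq_or_ne t 0 with rfl | ht0
  · refine hasDerivAt_of_eventually_hasDerivAt_of_ne ?_ (continuousAt_oddExtension h0)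
      (continuousAt_evenExtension h0')
    filter_upwards [eventually_mem_Ioo_ne ht.2] with s hs using hne s hs.1 hs.2
  · exact hne t ht ht0

theorem hasDerivAt_evenExtension (h : ∀ t ∈ Ioo 0 r, HasDerivAt f (f' t) t)
    (h0 : Tendsto f (𝓝[>] 0) (𝓝 m)) (h0' : Tendsto f' (𝓝[>] 0) (𝓝 0)) {t : ℝ}
    (ht : t ∈ Ioo (-r) r) : HasDerivAt (evenExtension f m) (oddExtension f' t) t := by
  have hne : ∀ t ∈ Ioo (-r) r, t ≠ 0 → HasDerivAt (evenExtension f m) (oddExtension f' t) t := by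
    intro t ht h0
    rcases h0.lt_or_gt with hlt | hgt
    · rw [oddExtension_of_neg hlt]
      refine HasDerivAt.congr_of_eventuallyEq ?_ (eventuallyEq_evenExtension_of_neg hlt)
      have := (h (-t) ⟨neg_pos.2 hlt, by linarith [ht.1]⟩).scomp t (hasDerivAt_neg t)
      exact this.congr_deriv (by simp)
    · rw [oddExtension_of_pos hgt]
      exact (h t ⟨hgt, ht.2⟩).congr_of_eventuallyEq (eventuallyEq_evenExtension_of_pos hgt)
  rcases eq_or_ne t 0 with rfl | ht0
  · refine hasDerivAt_of_eventually_hasDerivAt_of_ne ?_ (continuousAt_evenExtension h0)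
      (continuousAt_oddExtension h0')
    filter_upwards [eventually_mem_Ioo_ne ht.2] with s hs using hne s hs.1 hs.2
  · exact hne t ht ht0

theorem continuousOn_oddExtension (h : ContinuousOn f (Ioo 0 r))
    (h0 : Tendsto f (𝓝[>] 0) (𝓝 0)) : ContinuousOn (oddExtension f) (Ioo (-r) r) := by
  intro t ht
  refine ContinuousAt.continuousWithinAt ?_
  rcases lt_trichotomy t 0 with hlt | rfl | hgt
  · have h1 : ContinuousAt f (-t) :=
      h.continuousAt (Ioo_mem_nhds (neg_pos.2 hlt) (by linarith [ht.1]))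
    exact (h1.comp (f := fun s => -s) continuous_neg.continuousAt).neg.congr
      (eventuallyEq_oddExtension_of_neg hlt).symm
  · exact continuousAt_oddExtension h0
  · exact (h.continuousAt (Ioo_mem_nhds hgt ht.2)).congr (eventuallyEq_oddExtension_of_pos hgt).symm

end OddExtension

theorem contDiffOn_two_of_hasDerivAt {f f' f'' : ℝ → ℝ} {s : Set ℝ} (hs : IsOpen s)
    (h : ∀ t ∈ s, HasDerivAt f (f' t) t) (h' : ∀ t ∈ s, HasDerivAt f' (f'' t) t)
    (h'' : ContinuousOn f'' s) : ContDiffOn ℝ 2 f s := by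
  rw [show (2 : WithTop ℕ∞) = 1 + 1 from by norm_num, contDiffOn_succ_iff_deriv_of_isOpen hs]
  refine ⟨fun t ht => (h t ht).differentiableAt.differentiableWithinAt, by simp, ?_⟩
  refine ContDiffOn.congr (f := f') ?_ fun t ht => (h t ht).deriv
  rw [show (1 : WithTop ℕ∞) = 0 + 1 from by norm_num, contDiffOn_succ_iff_deriv_of_isOpen hs]
  refine ⟨fun t ht => (h' t ht).differentiableAt.differentiableWithinAt, by simp, ?_⟩
  rw [contDiffOn_zero]
  exact h''.congr fun t ht => (h' t ht).deriv

/-! ## The invariant curve through the origin -/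

namespace ScalarCosmology

variable {n : ℕ}

/-- `Θ` is an odd invariant curve of class `C²` over `|t| < r`, with derivative `Θ₁`. -/
structure IsCenterCurve (n : ℕ) (Θ Θ₁ : ℝ → ℝ) (r : ℝ) : Prop where
  pos : 0 < r
  le : r ≤ 1 / n
  odd : Function.Odd Θ
  contDiffOn : ContDiffOn ℝ 2 Θ (Ioo (-r) r)
  hasDerivAt : ∀ t ∈ Ioo (-r) r, HasDerivAt Θ (Θ₁ t) t
  deriv_zero : Θ₁ 0 = -(Real.sqrt n / 3)
  eq : ∀ t ∈ Ioo (-r) r, slopeForm n (t * Θ₁ t) (Θ t) = -(n / 3 * t)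
  abs_le_one : ∀ t ∈ Ioo (-r) r, |Θ t| ≤ 1
  le_abs : ∀ t ∈ Ioo (-r) r, |t| / 6 ≤ |Θ t|

theorem slopeForm_neg (n : ℕ) (κ θ : ℝ) : slopeForm n κ (-θ) = -slopeForm n (-κ) θ := by
  simp only [slopeForm, G_neg, Real.cos_neg, Real.sin_neg]
  ring

/-- The invariance equation is unchanged under `(t, θ) ↦ (-t, -θ)`. The second derivative of the odd
extension is odd, so its continuity at `0` requires precisely that `Θ''` tends to `0`. -/
theorem IsHalfCurve.isCenterCurve (hn : 1 ≤ n) {Θ Θ₁ : ℝ → ℝ} {r : ℝ}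
    (h : IsHalfCurve n Θ Θ₁ r) :
    IsCenterCurve n (oddExtension Θ) (evenExtension Θ₁ (-(Real.sqrt n / 3))) r := by
  have hd : ∀ t ∈ Ioo (-r) r, HasDerivAt (oddExtension Θ)
      (evenExtension Θ₁ (-(Real.sqrt n / 3)) t) t := fun t ht =>
    hasDerivAt_oddExtension h.hasDerivAt h.tendsto_zero (h.tendsto_deriv hn) ht
  have hbd : ∀ t ∈ Ioo (-r) r, |oddExtension Θ t| ≤ 1 ∧ |t| / 6 ≤ |oddExtension Θ t| := by
    intro t ht
    rcases lt_trichotomy t 0 with hlt | rfl | hgt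
    · rw [oddExtension_of_neg hlt, abs_neg, abs_of_neg hlt]
      exact h.abs_le hn ⟨neg_pos.2 hlt, by linarith [ht.1]⟩
    · simp [oddExtension_zero]
    · rw [oddExtension_of_pos hgt, abs_of_pos hgt]
      exact h.abs_le hn ⟨hgt, ht.2⟩
  refine ⟨h.pos, h.le, odd_oddExtension, ?_, hd, evenExtension_zero, ?_, fun t ht => (hbd t ht).1,
    fun t ht => (hbd t ht).2⟩
  · exact contDiffOn_two_of_hasDerivAt isOpen_Ioo hd
      (fun t ht => hasDerivAt_evenExtension (fun t ht => h.hasDerivAt_deriv hn ht)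
        (h.tendsto_deriv hn) (h.tendsto_secondDeriv hn) ht)
      (continuousOn_oddExtension (h.continuousOn_secondDeriv hn) (h.tendsto_secondDeriv hn))
  · intro t ht
    rcases lt_trichotomy t 0 with hlt | rfl | hgt
    · have := h.eq (-t) ⟨neg_pos.2 hlt, by linarith [ht.1]⟩
      rw [oddExtension_of_neg hlt, evenExtension_of_neg hlt, slopeForm_neg]
      rw [neg_mul] at this
      rw [this]
      ring
    · simp [oddExtension_zero, slopeForm, G_zero]
    · rw [oddExtension_of_pos hgt, evenExtension_of_pos hgt]
      exact h.eq t ⟨hgt, ht.2⟩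

theorem attractorExpansion_neg (n : ℕ) (t : ℝ) :
    attractorExpansion n (-t) = -attractorExpansion n t := by
  unfold attractorExpansion
  ring

theorem IsHalfCurve.oddExtension_sub_isBigO (hn : 1 ≤ n) {Θ Θ₁ : ℝ → ℝ} {r : ℝ}
    (h : IsHalfCurve n Θ Θ₁ r) :
    (fun t => oddExtension Θ t - attractorExpansion n t) =O[𝓝 0] fun t : ℝ => t ^ 7 := by
  obtain ⟨C, hC⟩ := (h.sub_isBigO hn).bound
  rw [eventually_nhdsWithin_iff, Metric.eventually_nhds_iff_ball] at hC
  obtain ⟨ε, hε, hC⟩ := hC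
  refine Asymptotics.IsBigO.of_bound C ?_
  filter_upwards [Metric.ball_mem_nhds (0 : ℝ) hε] with t ht
  rcases lt_trichotomy t 0 with hlt | rfl | hgt
  · have h1 := hC (-t) (by simpa using ht) (neg_pos.2 hlt)
    rw [attractorExpansion_neg, norm_pow, norm_neg, ← norm_pow] at h1
    rw [oddExtension_of_neg hlt, ← norm_neg]
    refine le_trans (le_of_eq ?_) h1
    congr 1
    ring
  · simp [oddExtension_zero, attractorExpansion_zero]
  · rw [oddExtension_of_pos hgt]
    exact hC t ht hgt

/-- The invariant curve, together with the orbit of which it is the past for `t > 0`. -/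
theorem exists_isCenterCurve (hn : 1 ≤ n) : ∃ (Θ Θ₁ : ℝ → ℝ) (r : ℝ) (z : ℝ → ℝ × ℝ),
    IsCenterCurve n Θ Θ₁ r ∧
    ((fun t => Θ t - attractorExpansion n t) =O[𝓝 0] fun t : ℝ => t ^ 7) ∧
    IsOrbitOf n Θ r z := by
  obtain ⟨Θ, Θ₁, r, z, h, hz⟩ := exists_isHalfCurve hn
  refine ⟨oddExtension Θ, _, r, z, h.isCenterCurve hn, h.oddExtension_sub_isBigO hn, hz.1, hz.2,
    hz.3, hz.4, fun s hs => ?_⟩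
  rw [oddExtension_of_pos (Real.exp_pos _)]
  exact hz.snd_eq s hs

end ScalarCosmology

/-! ## Spectral subspaces -/

section SpectralSubspace

variable {E : Type*} [NormedAddCommGroup E] [NormedSpace ℝ E]

theorem mem_spectralSubspace_of_apply_eq_smul {A : E →L[ℝ] E} {s : Set ℂ} {c : ℝ} {v : E}
    (hv : A v = c • v) (hc : (c : ℂ) ∈ s) : v ∈ spectralSubspace A s := by
  change (1 : ℂ) ⊗ₜ[ℝ] v ∈ ⨆ μ ∈ s, Module.End.maxGenEigenspace
    ((A : E →ₗ[ℝ] E).baseChange ℂ) μ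
  refine Submodule.mem_iSup_of_mem (c : ℂ) (Submodule.mem_iSup_of_mem hc ?_)
  refine Module.End.mem_maxGenEigenspace _ _ _ |>.2 ⟨1, ?_⟩
  rw [pow_one, LinearMap.sub_apply, LinearMap.baseChange_tmul, LinearMap.smul_apply,
    Module.End.one_apply, ContinuousLinearMap.coe_coe, hv, 
    ← TensorProduct.smul_tmul, TensorProduct.smul_tmul', sub_eq_zero]
  congr 1

/-- A left eigenvector whose eigenvalue lies outside `s` vanishes on the spectral subspace of
`s`. -/
theorem eq_zero_of_mem_spectralSubspace {A : E →L[ℝ] E} {s : Set ℂ} {c : ℝ} {ℓ : E →ₗ[ℝ] ℝ}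
    (hℓ : ∀ v, ℓ (A v) = c * ℓ v) (hc : (c : ℂ) ∉ s) {v : E} (hv : v ∈ spectralSubspace A s) :
    ℓ v = 0 := by
  let φ : TensorProduct ℝ ℂ E →ₗ[ℂ] ℂ :=
    (TensorProduct.AlgebraTensorModule.rid ℝ ℂ ℂ).toLinearMap ∘ₗ ℓ.baseChange ℂ
  have hφt : ∀ (w : ℂ) (v : E), φ (w ⊗ₜ[ℝ] v) = ℓ v • w := fun w v => by simp [φ]
  have hφA : ∀ x, φ ((A : E →ₗ[ℝ] E).baseChange ℂ x) = c * φ x := by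
    intro x
    induction x with
    | zero => simp
    | tmul w v =>
      rw [LinearMap.baseChange_tmul, hφt, hφt, ContinuousLinearMap.coe_coe, hℓ]
      simp only [Complex.real_smul, Complex.ofReal_mul]
      ring
    | add x y hx hy => rw [map_add, map_add, hx, hy, map_add, mul_add]
  have hle : (⨆ μ ∈ s, Module.End.maxGenEigenspace ((A : E →ₗ[ℝ] E).baseChange ℂ) μ) ≤
      LinearMap.ker φ := by
    refine iSup₂_le fun μ hμ x hx => ?_
    obtain ⟨k, hk⟩ := (Module.End.mem_maxGenEigenspace _ _ _).1 hx
    -- On values of `φ` the operator `A - μ` acts as the scalar `c - μ`, which is nonzero for `μ ∈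
    -- s`; so `φ` kills everything that a power of `A - μ` kills.
    have hpow : ∀ (k : ℕ) (x : TensorProduct ℝ ℂ E),
        φ (((((A : E →ₗ[ℝ] E).baseChange ℂ) - μ • 1) ^ k) x) = ((c : ℂ) - μ) ^ k * φ x := by
      intro k
      induction k with
      | zero => simp
      | succ k ih =>
        intro x
        rw [pow_succ, Module.End.mul_apply, ih, LinearMap.sub_apply, map_sub, hφA,
          LinearMap.smul_apply, Module.End.one_apply, map_smul, smul_eq_mul]
        ring
    have h := hpow k x
    rw [hk, map_zero] at h
    have hne : ((c : ℂ) - μ) ^ k ≠ 0 := pow_ne_zero k fun h0 => hc (by rwa [sub_eq_zero.1 h0])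
    exact LinearMap.mem_ker.2 ((mul_eq_zero.1 h.symm).resolve_left hne)
  have h : φ ((1 : ℂ) ⊗ₜ[ℝ] v) = 0 := hle hv
  rw [hφt] at h
  simpa using h

end SpectralSubspace

/-! ## The linearization at the de Sitter points -/

namespace ScalarCosmology

variable {n : ℕ} {γ s : ℝ}

theorem sign_sq (hs : s = 1 ∨ s = -1) : s ^ 2 = 1 := by
  rcases hs with rfl | rfl <;> norm_num

theorem sign_pow_two_mul (hs : s = 1 ∨ s = -1) (n : ℕ) : s ^ (2 * n) = 1 := by
  rw [pow_mul, sign_sq hs, one_pow]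

theorem pow_two_mul_sub_one_mul (hn : 1 ≤ n) (x : ℝ) : x ^ (2 * n - 1) * x = x ^ (2 * n) :=
  pow_sub_one_mul (by omega) x

theorem sign_pow_two_mul_sub_one (hn : 1 ≤ n) (hs : s = 1 ∨ s = -1) : s ^ (2 * n - 1) = s := by
  have h := pow_two_mul_sub_one_mul hn s
  rw [sign_pow_two_mul hs] at h
  have h2 := sign_sq hs
  linear_combination s * h - s ^ (2 * n - 1) * h2

theorem contDiff_vectorField (n : ℕ) (γ : ℝ) {r : WithTop ℕ∞} :
    ContDiff ℝ r (vectorField n γ) := by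
  unfold vectorField decel omegaM omegaPhi
  fun_prop

theorem omegaM_deSitter (n : ℕ) (hs : s = 1 ∨ s = -1) :
    omegaM n (deSitter s) = 0 := by
  simp [omegaM, omegaPhi, deSitter, sign_pow_two_mul hs]

theorem decel_deSitter (n : ℕ) (γ : ℝ) (hs : s = 1 ∨ s = -1) :
    decel n γ (deSitter s) = -1 := by
  rw [decel, omegaM_deSitter n hs]
  simp [deSitter]

theorem vectorField_deSitter (n : ℕ) (γ : ℝ) (hs : s = 1 ∨ s = -1) :
    vectorField n γ (deSitter s) = 0 := by
  rw [vectorField, decel_deSitter n γ hs]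
  simp [deSitter]

/-- The derivative of `Ω_m` at `z` in the direction `v`. -/
def omegaM' (n : ℕ) (z v : State) : ℝ :=
  -(2 * z.2.1 * v.2.1) - 2 * n * z.2.2 ^ (2 * n - 1) * v.2.2

theorem _root_.HasDerivAt.state_coords {z : ℝ → State} {v : State} {t : ℝ} (h : HasDerivAt z v t) :
    HasDerivAt (fun t => (z t).1) v.1 t ∧ HasDerivAt (fun t => (z t).2.1) v.2.1 t ∧
      HasDerivAt (fun t => (z t).2.2) v.2.2 t := by
  have h1 := (hasFDerivAt_fst (𝕜 := ℝ) (p := z t)).comp_hasDerivAt t h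
  have h2 := (hasFDerivAt_snd (𝕜 := ℝ) (p := z t)).comp_hasDerivAt t h
  have h3 := (hasFDerivAt_fst (𝕜 := ℝ) (p := (z t).2)).comp_hasDerivAt t h2
  have h4 := (hasFDerivAt_snd (𝕜 := ℝ) (p := (z t).2)).comp_hasDerivAt t h2
  exact ⟨h1, h3, h4⟩

theorem hasDerivAt_omegaM {z : ℝ → State} {v : State} {t : ℝ} (h : HasDerivAt z v t) :
    HasDerivAt (fun t => omegaM n (z t)) (omegaM' n (z t) v) t := by
  obtain ⟨-, h2, h3⟩ := h.state_coords
  refine (((h2.pow 2).add (h3.pow (2 * n))).const_sub 1).congr_deriv ?_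
  simp only [omegaM', Nat.cast_mul, Nat.cast_ofNat]
  ring

/-- `Ω_m` obeys a homogeneous linear equation along the flow. Near a de Sitter point `1 + q` is
small and the rate is close to `-3γ`, which drives the first step of uniqueness. -/
theorem omegaM'_vectorField (hn : 1 ≤ n) (γ : ℝ) (z : State) :
    omegaM' n z (vectorField n γ z) =
      (1 - z.1) * (2 * (1 + decel n γ z) - 3 * γ) * omegaM n z := by
  have hn0 : (n : ℝ) ≠ 0 := by positivity
  have hX := pow_two_mul_sub_one_mul hn z.2.2
  have h1 : omegaM' n z (vectorField n γ z) = (1 - z.1) * (2 * (2 - decel n γ z) * z.2.1 ^ 2 -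
      2 * (1 + decel n γ z) * z.2.2 ^ (2 * n)) := by
    rw [← hX]
    simp only [omegaM', vectorField]
    field_simp
    ring
  rw [h1]
  simp only [decel, omegaM, omegaPhi]
  ring

theorem fderiv_vectorField_deSitter (hn : 1 ≤ n) (γ : ℝ) (hs : s = 1 ∨ s = -1) (v : State) :
    fderiv ℝ (vectorField n γ) (deSitter s) v =
      (0, -3 * v.2.1 - n * s * v.1, -(3 * γ) * v.2.2) := by
  have hn0 : (n : ℝ) ≠ 0 := by positivity
  have hl : HasDerivAt (fun t : ℝ => deSitter s + t • v) v 0 := by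
    simpa using ((hasDerivAt_id (0 : ℝ)).smul_const v).const_add (deSitter s)
  have hp : deSitter s + (0 : ℝ) • v = deSitter s := by simp
  have h1 := (((contDiff_vectorField n γ (r := 1)).differentiable one_ne_zero
    (deSitter s + (0 : ℝ) • v)).hasFDerivAt).comp_hasDerivAt 0 hl
  rw [hp] at h1
  have hΩ := hasDerivAt_omegaM (n := n) hl
  obtain ⟨hT, hS, hX⟩ := hl.state_coords
  have hq : HasDerivAt (fun t : ℝ => decel n γ (deSitter s + t • v)) (-(3 * γ * n * s * v.2.2)) 0 := by
    refine ((((hS.pow 2).const_mul 3).const_add (-1)).add (hΩ.const_mul (3 / 2 * γ))).congr_deriv ?_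
    rw [hp]
    simp only [omegaM', deSitter, sign_pow_two_mul_sub_one hn hs]
    ring
  have hd := decel_deSitter n γ hs
  have hf1 := (((hT.const_mul (1 / n : ℝ)).mul ((hT.const_sub 1).pow 2)).mul (hq.const_add 1))
  have hf2 := ((((hT.const_sub 1).neg).mul (hq.const_sub 2)).mul hS).sub
    ((hT.const_mul (n : ℝ)).mul (hX.pow (2 * n - 1)))
  have hf3 := ((((hT.const_sub 1).const_mul (1 / n : ℝ)).mul (hq.const_add 1)).mul hX).add
    (hT.mul hS)
  have h2 := h1.unique (hf1.prodMk (hf2.prodMk hf3))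
  rw [h2]
  simp only [Pi.mul_apply, Pi.pow_apply, Pi.neg_apply, hp, hd]
  simp only [deSitter, sign_pow_two_mul_sub_one hn hs, Prod.mk.injEq]
  refine ⟨by ring, by ring, ?_⟩
  field_simp
  linear_combination (-(3 * γ * n * v.2.2)) * sign_sq hs

/-- The direction of the center subspace of a de Sitter point. -/
def centerDirection (n : ℕ) (s : ℝ) : State := (1, -(n * s / 3), 0)

/-- The left eigenvectors `Σ + (n s / 3) T` and `X` of `-3` and `-3γ` must vanish on the center
subspace, which leaves one line; that line consists of eigenvectors of `0`. -/
theorem mem_centerSubspace_iff (hn : 1 ≤ n) (hγ : 0 < γ) (hs : s = 1 ∨ s = -1) {v : State} :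
    v ∈ centerSubspace (vectorField n γ) (deSitter s) ↔ v = v.1 • centerDirection n s := by
  constructor
  · intro hv
    have h1 := eq_zero_of_mem_spectralSubspace (c := -3)
      (ℓ := (LinearMap.fst ℝ ℝ ℝ) ∘ₗ (LinearMap.snd ℝ ℝ (ℝ × ℝ)) +
        (n * s / 3 : ℝ) • LinearMap.fst ℝ ℝ (ℝ × ℝ)) (fun v => by
        rw [fderiv_vectorField_deSitter hn γ hs]
        simp
        ring) (by simp) hv
    have h2 := eq_zero_of_mem_spectralSubspace (c := -(3 * γ))
      (ℓ := (LinearMap.snd ℝ ℝ ℝ) ∘ₗ (LinearMap.snd ℝ ℝ (ℝ × ℝ))) (fun v => by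
        rw [fderiv_vectorField_deSitter hn γ hs]
        simp) (by simp [hγ.ne']) hv
    simp at h1 h2
    ext
    · simp [centerDirection]
    · simp [centerDirection]
      linarith
    · simpa [centerDirection] using h2
  · intro hv
    refine mem_spectralSubspace_of_apply_eq_smul (c := 0) ?_ (by simp)
    rw [fderiv_vectorField_deSitter hn γ hs, zero_smul, hv]
    simp only [centerDirection, Prod.smul_mk, smul_eq_mul, Prod.mk_eq_zero]
    refine ⟨trivial, by ring, by ring⟩

/-- The `Σ` and `X` axes are genuine eigenvectors also for `γ = 1`, where the eigenvalues coincide.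
-/
theorem mem_hyperbolicSubspace_iff (hn : 1 ≤ n) (hγ : 0 < γ) (hs : s = 1 ∨ s = -1) {v : State} :
    v ∈ hyperbolicSubspace (vectorField n γ) (deSitter s) ↔ v.1 = 0 := by
  constructor
  · intro hv
    exact eq_zero_of_mem_spectralSubspace (c := 0) (ℓ := LinearMap.fst ℝ ℝ (ℝ × ℝ)) (fun v => by
      rw [fderiv_vectorField_deSitter hn γ hs]
      simp) (by simp) hv
  · intro hv
    have h : v = ((0 : ℝ), v.2.1, (0 : ℝ)) + ((0 : ℝ), (0 : ℝ), v.2.2) := by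
      ext <;> simp [hv]
    rw [h]
    refine Submodule.add_mem _ ?_ ?_
    · refine mem_spectralSubspace_of_apply_eq_smul (c := -3) ?_ (by simp)
      rw [fderiv_vectorField_deSitter hn γ hs]
      simp
    · refine mem_spectralSubspace_of_apply_eq_smul (c := -(3 * γ)) ?_ (by simp [hγ.ne'])
      rw [fderiv_vectorField_deSitter hn γ hs]
      simp

theorem finrank_centerSubspace (hn : 1 ≤ n) (hγ : 0 < γ) (hs : s = 1 ∨ s = -1) :
    Module.finrank ℝ (centerSubspace (vectorField n γ) (deSitter s)) = 1 := by
  have h : centerSubspace (vectorField n γ) (deSitter s) =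
      Submodule.span ℝ {centerDirection n s} := by
    ext v
    rw [mem_centerSubspace_iff hn hγ hs, Submodule.mem_span_singleton]
    constructor
    · exact fun h => ⟨v.1, h.symm⟩
    · rintro ⟨a, rfl⟩
      simp [centerDirection]
  rw [h]
  exact finrank_span_singleton (by simp [centerDirection])

end ScalarCosmology

/-! ## The invariant curve in the state space -/

namespace ScalarCosmology

variable {n : ℕ} {γ s r δ : ℝ} {Θ Θ₁ : ℝ → ℝ}

/-- The point with parameter `t = T / (1 - T)` on the curve given by `Θ`. -/
def stateCurve (n : ℕ) (s : ℝ) (Θ : ℝ → ℝ) (t : ℝ) : State :=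
  (t / (1 + t), s * G n (Θ t), s * Real.cos (Θ t))

/-- The speed of the parameter `t` along the curve. -/
def curveSpeed (n : ℕ) (Θ : ℝ → ℝ) (t : ℝ) : ℝ := 3 / n * (t / (1 + t)) * G n (Θ t) ^ 2

/-- The tangent vector of the curve. -/
def stateCurve' (n : ℕ) (s : ℝ) (Θ Θ₁ : ℝ → ℝ) (t : ℝ) : State :=
  (1 / (1 + t) ^ 2, s * (G' n (Θ t) * Θ₁ t), s * (-Real.sin (Θ t) * Θ₁ t))

theorem omegaM_angle (n : ℕ) (hs : s = 1 ∨ s = -1) (T θ : ℝ) :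
    omegaM n (T, s * G n θ, s * Real.cos θ) = 0 := by
  simp only [omegaM, omegaPhi, mul_pow, sign_sq hs, sign_pow_two_mul hs, G_sq]
  ring

theorem decel_of_omegaM_eq_zero {z : State} (hz : omegaM n z = 0) (γ : ℝ) :
    decel n γ z = -1 + 3 * z.2.1 ^ 2 := by
  rw [decel, hz]
  ring

theorem decel_angle (n : ℕ) (hs : s = 1 ∨ s = -1) (γ T θ : ℝ) :
    decel n γ (T, s * G n θ, s * Real.cos θ) = -1 + 3 * G n θ ^ 2 := by
  rw [decel_of_omegaM_eq_zero (omegaM_angle n hs T θ)]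
  simp only [mul_pow, sign_sq hs, one_mul]

theorem G'_mul_F (hn : 1 ≤ n) (θ : ℝ) : G' n θ * F n θ = n * Real.cos θ ^ (2 * n - 1) :=
  div_mul_cancel₀ _ (F_pos hn θ).ne'

/-- The tangent vectors of the scalar field boundary: the evolution equations for the angle. -/
theorem vectorField_angle (hn : 1 ≤ n) (hs : s = 1 ∨ s = -1) (γ T θ : ℝ) :
    vectorField n γ (T, s * G n θ, s * Real.cos θ) =
      (3 / n * T * (1 - T) ^ 2 * G n θ ^ 2,
       s * (G' n θ * (F n θ * (-(3 / n * (1 - T) * (G n θ * Real.cos θ)) - T))),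
       s * (-Real.sin θ * (F n θ * (-(3 / n * (1 - T) * (G n θ * Real.cos θ)) - T)))) := by
  have hn0 : (n : ℝ) ≠ 0 := by positivity
  have hsq := sign_sq hs
  have hG := G_sq n θ
  have hX := pow_two_mul_sub_one_mul hn (Real.cos θ)
  rw [vectorField, decel_angle n hs]
  simp only [mul_pow, sign_pow_two_mul_sub_one hn hs, Prod.mk.injEq]
  refine ⟨?_, ?_, ?_⟩
  · ring
  · rw [← mul_assoc (G' n θ), G'_mul_F hn]
    field_simp
    rw [hG, ← hX]
    ring
  · have hF : Real.sin θ * F n θ = G n θ := by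
      unfold G
      ring
    linear_combination (s * (-(3 / n * (1 - T) * (G n θ * Real.cos θ)) - T)) * hF

namespace IsCenterCurve

theorem r_le_one (hn : 1 ≤ n) (hc : IsCenterCurve n Θ Θ₁ r) : r ≤ 1 :=
  hc.le.trans (div_le_self zero_le_one (by exact_mod_cast hn))

theorem one_add_pos (hn : 1 ≤ n) (hc : IsCenterCurve n Θ Θ₁ r) {t : ℝ} (ht : t ∈ Ioo (-r) r) :
    0 < 1 + t := by
  linarith [hc.r_le_one hn, ht.1]

theorem zero_mem (hc : IsCenterCurve n Θ Θ₁ r) : (0 : ℝ) ∈ Ioo (-r) r :=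
  ⟨neg_lt_zero.2 hc.pos, hc.pos⟩

theorem apply_zero (hc : IsCenterCurve n Θ Θ₁ r) : Θ 0 = 0 := hc.odd.map_zero

theorem stateCurve_zero (hc : IsCenterCurve n Θ Θ₁ r) (s : ℝ) :
    stateCurve n s Θ 0 = deSitter s := by
  simp [stateCurve, deSitter, hc.apply_zero, G_zero]

theorem hasDerivAt_G_comp (hn : 1 ≤ n) (hc : IsCenterCurve n Θ Θ₁ r) {t : ℝ}
    (ht : t ∈ Ioo (-r) r) : HasDerivAt (fun t => G n (Θ t)) (G' n (Θ t) * Θ₁ t) t :=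
  (hasDerivAt_G hn _).comp t (hc.hasDerivAt t ht)

theorem hasDerivAt_stateCurve (hn : 1 ≤ n) (hc : IsCenterCurve n Θ Θ₁ r) (s : ℝ) {t : ℝ}
    (ht : t ∈ Ioo (-r) r) : HasDerivAt (stateCurve n s Θ) (stateCurve' n s Θ Θ₁ t) t := by
  have hpos := (hc.one_add_pos hn ht).ne'
  have h1 : HasDerivAt (fun t : ℝ => t / (1 + t)) (1 / (1 + t) ^ 2) t := by
    refine ((hasDerivAt_id t).div ((hasDerivAt_id t).const_add 1) hpos).congr_deriv ?_
    simp
  have h2 := (hc.hasDerivAt_G_comp hn ht).const_mul s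
  have h3 : HasDerivAt (fun t => s * Real.cos (Θ t)) (s * (-Real.sin (Θ t) * Θ₁ t)) t :=
    ((Real.hasDerivAt_cos _).comp t (hc.hasDerivAt t ht)).const_mul s
  exact h1.prodMk (h2.prodMk h3)

/-- The invariance equation. -/
theorem curveSpeed_mul_deriv (hn : 1 ≤ n) (hc : IsCenterCurve n Θ Θ₁ r) {t : ℝ}
    (ht : t ∈ Ioo (-r) r) : curveSpeed n Θ t * Θ₁ t = F n (Θ t) *
      (-(3 / n * (1 / (1 + t)) * (G n (Θ t) * Real.cos (Θ t))) - t / (1 + t)) := by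
  have hn0 : (n : ℝ) ≠ 0 := by positivity
  have hpos := (hc.one_add_pos hn ht).ne'
  have h := hc.eq t ht
  rw [curveSpeed, ← F_mul_G_mul_sin]
  unfold slopeForm at h
  field_simp at h ⊢
  linear_combination F n (Θ t) * h

/-- The field is tangent to the curve for every `γ` at once, because `γ` enters only through `γ
Ω_m`, which is zero here. -/
theorem vectorField_stateCurve (hn : 1 ≤ n) (hc : IsCenterCurve n Θ Θ₁ r) (hs : s = 1 ∨ s = -1)
    (γ : ℝ) {t : ℝ} (ht : t ∈ Ioo (-r) r) : vectorField n γ (stateCurve n s Θ t) =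
      curveSpeed n Θ t • stateCurve' n s Θ Θ₁ t := by
  have hpos := (hc.one_add_pos hn ht).ne'
  have h1 : 1 - t / (1 + t) = 1 / (1 + t) := by
    field_simp
    ring
  have h2 := hc.curveSpeed_mul_deriv hn ht
  rw [stateCurve, vectorField_angle hn hs, h1, ← h2]
  simp only [stateCurve', Prod.smul_mk, smul_eq_mul, Prod.mk.injEq]
  refine ⟨?_, by ring, by ring⟩
  simp only [curveSpeed]
  field_simp

theorem sq_le_G_sq (hn : 1 ≤ n) (hc : IsCenterCurve n Θ Θ₁ r) {t : ℝ} (ht : t ∈ Ioo (-r) r) :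
    t ^ 2 / 144 ≤ G n (Θ t) ^ 2 := by
  refine le_trans ?_ (sq_div_four_le_G_mul_sin hn (hc.abs_le_one t ht)).2
  have h := pow_le_pow_left₀ (by positivity) (hc.le_abs t ht) 2
  rw [div_pow, sq_abs, sq_abs] at h
  linarith

theorem contDiffOn_curveSpeed (hn : 1 ≤ n) (hc : IsCenterCurve n Θ Θ₁ r) :
    ContDiffOn ℝ 1 (curveSpeed n Θ) (Ioo (-r) r) := by
  have hΘ : ContDiffOn ℝ 1 Θ (Ioo (-r) r) := hc.contDiffOn.of_le (by norm_num)
  have hG : ContDiffOn ℝ 1 (fun t => G n (Θ t)) (Ioo (-r) r) := (contDiff_G hn).comp_contDiffOn hΘ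
  have hd : ContDiffOn ℝ 1 (fun t : ℝ => t / (1 + t)) (Ioo (-r) r) :=
    contDiffOn_id.div (contDiffOn_const.add contDiffOn_id) fun t ht => (hc.one_add_pos hn ht).ne'
  exact (contDiffOn_const.mul hd).mul (hG.pow 2)

end IsCenterCurve

/-- Truncation to the interval `[-δ, δ]`. -/
def clamp (δ t : ℝ) : ℝ := max (-δ) (min δ t)

theorem clamp_mem (hδ : 0 ≤ δ) (t : ℝ) : clamp δ t ∈ Icc (-δ) δ :=
  ⟨le_max_left _ _, max_le (by linarith) (min_le_left _ _)⟩

theorem clamp_of_abs_le {t : ℝ} (ht : |t| ≤ δ) : clamp δ t = t := by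
  obtain ⟨h1, h2⟩ := abs_le.1 ht
  rw [clamp, min_eq_right h2, max_eq_right h1]

theorem mul_clamp_nonneg (hδ : 0 ≤ δ) (t : ℝ) : 0 ≤ t * clamp δ t := by
  rcases le_total 0 t with h | h
  · exact mul_nonneg h (le_max_of_le_right (le_min hδ h))
  · exact mul_nonneg_of_nonpos_of_nonpos h
      (max_le (by linarith) ((min_le_right _ _).trans h))

theorem lipschitzWith_clamp (δ : ℝ) : LipschitzWith 1 (clamp δ) :=
  (LipschitzWith.id.const_min δ).const_max (-δ)

/-- The flow of the parameter along the curve. -/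
theorem IsCenterCurve.exists_parameter_solution (hn : 1 ≤ n) (hc : IsCenterCurve n Θ Θ₁ r)
    (hδ : 0 < δ) (hδr : δ < r) {t₀ : ℝ} (ht₀ : |t₀| < δ) : ∃ φ : ℝ → ℝ, φ 0 = t₀ ∧
      (∃ ε > 0, ∀ σ < ε, |φ σ| < δ ∧ HasDerivAt φ (curveSpeed n Θ (φ σ)) σ) ∧
      Tendsto φ atBot (𝓝 0) := by
  have hn' : (0 : ℝ) < n := by exact_mod_cast hn
  have hsub : Icc (-δ) δ ⊆ Ioo (-r) r := fun t ht =>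
    ⟨by linarith [ht.1], by linarith [ht.2]⟩
  have hC1 := (hc.contDiffOn_curveSpeed hn).mono hsub
  obtain ⟨K, hK⟩ := hC1.exists_lipschitzOnWith one_ne_zero (convex_Icc _ _) isCompact_Icc
  obtain ⟨M, hM⟩ := isCompact_Icc.exists_bound_of_continuousOn hC1.continuousOn
  -- Clamping makes the speed globally Lipschitz and bounded, so a global solution exists. Where
  -- `|φ| < δ` the clamp has no effect.
  have hLip : LipschitzWith (K * 1) (curveSpeed n Θ ∘ clamp δ) := by
    rw [← lipschitzOnWith_univ]
    exact hK.comp (lipschitzOnWith_univ.2 (lipschitzWith_clamp δ))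
      fun t _ => clamp_mem hδ.le t
  obtain ⟨φ, hφ0, hφ⟩ := exists_isSolutionOn_univ hLip.locallyLipschitz
    (fun t => hM _ (clamp_mem hδ.le t)) t₀
  have hφd : ∀ σ, HasDerivAt φ (curveSpeed n Θ (clamp δ (φ σ))) σ := fun σ => hφ σ (mem_univ σ)
  have hsq : ∀ σ, HasDerivAt (fun σ => φ σ ^ 2) (2 * φ σ * curveSpeed n Θ (clamp δ (φ σ))) σ :=
    fun σ => ((hφd σ).pow 2).congr_deriv (by simp)
  -- The speed has the sign of `t`, so `φ²` grows on both sides of `0`; backward in time `|φ|`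
  -- cannot exceed `|t₀|`.
  have hmono : Monotone fun σ => φ σ ^ 2 := by
    refine monotone_of_hasDerivAt_nonneg hsq fun σ => ?_
    have h1 := mul_clamp_nonneg hδ.le (φ σ)
    have h2 := hc.one_add_pos hn (hsub (clamp_mem hδ.le (φ σ)))
    have h3 : 2 * φ σ * curveSpeed n Θ (clamp δ (φ σ)) = φ σ * clamp δ (φ σ) *
        (2 * (3 / n) / (1 + clamp δ (φ σ)) * G n (Θ (clamp δ (φ σ))) ^ 2) := by
      unfold curveSpeed
      ring
    simp only [Pi.zero_apply]
    rw [h3]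
    positivity
  have hneg : ∀ σ ≤ 0, |φ σ| < δ := by
    intro σ hσ
    have := hmono hσ
    simp only [hφ0] at this
    exact (sq_le_sq.1 this).trans_lt ht₀
  refine ⟨φ, hφ0, ?_, ?_⟩
  · have hev : ∀ᶠ σ in 𝓝 (0 : ℝ), |φ σ| < δ := by
      have : ContinuousAt (fun σ => |φ σ|) 0 := (hφd 0).continuousAt.abs
      exact this.eventually (Iio_mem_nhds (by simpa [hφ0] using ht₀))
    obtain ⟨ε, hε, hball⟩ := Metric.eventually_nhds_iff_ball.1 hev
    refine ⟨ε, hε, fun σ hσ => ?_⟩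
    have h1 : |φ σ| < δ := by
      rcases le_or_gt σ 0 with h | h
      · exact hneg σ h
      · exact hball σ (by rwa [Metric.mem_ball, dist_zero_right, Real.norm_eq_abs, abs_of_pos h])
    refine ⟨h1, ?_⟩
    have := hφd σ
    rwa [clamp_of_abs_le h1.le] at this
  -- If `φ²` stayed above `m`, its derivative would have a positive lower bound, because `G(Θ(t))² ≥
  -- t² / 144`; then `φ²` would become negative in the past.
  · have hsmall : ∀ m > 0, ∃ σ ≤ 0, φ σ ^ 2 < m := by
      intro m hm
      by_contra! hge
      refine not_bddBelow_of_le_deriv (φ := fun σ => φ σ ^ 2) (b := 0) (m := m)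
        (c := 3 / n * m * (m / 144)) (by positivity) (fun σ _ => hsq σ) (fun σ hσ => ?_) hge
      have h1 := hneg σ hσ
      have hmem : φ σ ∈ Ioo (-r) r := hsub (abs_le.1 h1.le)
      have h2 := hc.sq_le_G_sq hn hmem
      have h3 := hc.one_add_pos hn hmem
      have h4 : 1 + φ σ ≤ 2 := by linarith [hmem.2, hc.r_le_one hn]
      have h5 := hge σ hσ
      rw [clamp_of_abs_le h1.le]
      have h6 : 2 * φ σ * curveSpeed n Θ (φ σ) =
          3 / n * (φ σ ^ 2 * (2 / (1 + φ σ))) * G n (Θ (φ σ)) ^ 2 := by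
        unfold curveSpeed
        ring
      have h7 : 1 ≤ 2 / (1 + φ σ) := by rwa [le_div_iff₀ h3, one_mul]
      have h8 : m ≤ φ σ ^ 2 * (2 / (1 + φ σ)) := by nlinarith
      have h9 : m / 144 ≤ G n (Θ (φ σ)) ^ 2 := by linarith
      rw [h6]
      gcongr
    rw [Metric.tendsto_nhds]
    intro ε hε
    obtain ⟨σ, -, hσ⟩ := hsmall (ε ^ 2) (by positivity)
    filter_upwards [eventually_le_atBot σ] with x hx
    rw [dist_zero_right, Real.norm_eq_abs]
    have := (hmono hx).trans_lt hσ
    exact abs_lt_of_sq_lt_sq this hε.le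

theorem tildeT_div (t : ℝ) (ht : 0 < 1 + t) : t / (1 + t) / (1 - t / (1 + t)) = t := by
  have : 1 - t / (1 + t) = 1 / (1 + t) := by
    field_simp
    ring
  rw [this]
  field_simp

theorem tildeT_one_add_pos {T : ℝ} (hT : T < 1) : 1 + T / (1 - T) = 1 / (1 - T) := by
  have : 1 - T ≠ 0 := by linarith
  field_simp
  ring

theorem div_one_add_tildeT {T : ℝ} (hT : T < 1) : T / (1 - T) / (1 + T / (1 - T)) = T := by
  have : 1 - T ≠ 0 := by linarith
  rw [tildeT_one_add_pos hT]
  field_simp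

theorem mem_thetaGraph_iff (hδ : δ ≤ 1) {z : State} :
    z ∈ thetaGraph n s Θ δ ↔ ∃ t ∈ Ioo (-δ) δ, stateCurve n s Θ t = z := by
  constructor
  · rintro ⟨h1, h2, h3, h4⟩
    refine ⟨tildeT z, abs_lt.1 h2, ?_⟩
    ext
    · exact div_one_add_tildeT h1
    · exact h3.symm
    · exact h4.symm
  · rintro ⟨t, ht, rfl⟩
    have hpos : 0 < 1 + t := by linarith [ht.1]
    have h : tildeT (stateCurve n s Θ t) = t := tildeT_div t hpos
    refine ⟨?_, ?_, ?_, ?_⟩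
    · change t / (1 + t) < 1
      rw [div_lt_one hpos]
      linarith
    · rw [h]
      exact abs_lt.2 ht
    · rw [h]
      rfl
    · rw [h]
      rfl

namespace IsCenterCurve

theorem isSolution_stateCurve_comp (hn : 1 ≤ n) (hc : IsCenterCurve n Θ Θ₁ r)
    (hs : s = 1 ∨ s = -1) (γ : ℝ) {φ : ℝ → ℝ} {σ : ℝ} (hσ : φ σ ∈ Ioo (-r) r)
    (hφ : HasDerivAt φ (curveSpeed n Θ (φ σ)) σ) :
    HasDerivAt (fun σ => stateCurve n s Θ (φ σ)) (vectorField n γ (stateCurve n s Θ (φ σ))) σ := by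
  rw [hc.vectorField_stateCurve hn hs γ hσ]
  exact (hc.hasDerivAt_stateCurve hn s hσ).scomp σ hφ

theorem isLocallyInvariant (hn : 1 ≤ n) (hc : IsCenterCurve n Θ Θ₁ r) (hs : s = 1 ∨ s = -1)
    (γ : ℝ) (hδ : 0 < δ) (hδr : δ < r) :
    IsLocallyInvariant (vectorField n γ) (thetaGraph n s Θ δ) := by
  intro w hw
  have hδ1 := hδr.le.trans (hc.r_le_one hn)
  obtain ⟨t, ht, rfl⟩ := (mem_thetaGraph_iff hδ1).1 hw
  obtain ⟨φ, hφ0, ⟨ε, hε, hφ⟩, -⟩ := hc.exists_parameter_solution hn hδ hδr (abs_lt.2 ht)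
  refine ⟨ε, hε, fun σ => stateCurve n s Θ (φ σ), by simp [hφ0], fun σ hσ => ?_, fun σ hσ => ?_⟩
  · obtain ⟨h1, h2⟩ := hφ σ hσ.2
    exact hc.isSolution_stateCurve_comp hn hs γ (abs_lt.1 (h1.trans hδr)) h2
  · exact (mem_thetaGraph_iff hδ1).2 ⟨_, abs_lt.1 (hφ σ hσ.2).1, rfl⟩

theorem emanatesFrom (hn : 1 ≤ n) (hc : IsCenterCurve n Θ Θ₁ r) (hs : s = 1 ∨ s = -1)
    (γ : ℝ) (hδ : 0 < δ) (hδr : δ < r) :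
    EmanatesFrom (vectorField n γ) (deSitter s) (thetaGraph n s Θ δ) := by
  intro w hw
  have hδ1 := hδr.le.trans (hc.r_le_one hn)
  obtain ⟨t, ht, rfl⟩ := (mem_thetaGraph_iff hδ1).1 hw
  obtain ⟨φ, hφ0, ⟨ε, hε, hφ⟩, hlim⟩ := hc.exists_parameter_solution hn hδ hδr (abs_lt.2 ht)
  refine ⟨fun σ => stateCurve n s Θ (φ σ), by simp [hφ0], fun σ hσ => ?_, fun σ hσ => ?_, ?_⟩
  · obtain ⟨h1, h2⟩ := hφ σ (lt_of_le_of_lt hσ hε)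
    exact hc.isSolution_stateCurve_comp hn hs γ (abs_lt.1 (h1.trans hδr)) h2
  · exact (mem_thetaGraph_iff hδ1).2 ⟨_, abs_lt.1 (hφ σ (lt_of_le_of_lt hσ hε)).1, rfl⟩
  · have := (hc.hasDerivAt_stateCurve hn s hc.zero_mem).continuousAt.tendsto.comp hlim
    rwa [hc.stateCurve_zero] at this

theorem thetaGraph_subset_scalarBoundary (hs : s = 1 ∨ s = -1) :
    thetaGraph n s Θ δ ⊆ scalarBoundary n := by
  rintro z ⟨-, -, h3, h4⟩
  have hz : z = (z.1, s * G n (Θ (tildeT z)), s * Real.cos (Θ (tildeT z))) :=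
    Prod.ext rfl (Prod.ext h3 h4)
  change omegaM n z = 0
  rw [hz]
  exact omegaM_angle n hs _ _

/-- The deviation of the curve from the center subspace, as a function of `T`. -/
def graphMap (n : ℕ) (s : ℝ) (Θ : ℝ → ℝ) (T : ℝ) : State :=
  (0, s * G n (Θ (T / (1 - T))) + n * s / 3 * T, s * Real.cos (Θ (T / (1 - T))) - s)

/-- The values of `T` with `T < 1` and `|T / (1 - T)| < δ`. -/
def graphDomain (δ : ℝ) : Set ℝ := Iio 1 ∩ (fun T : ℝ => T / (1 - T)) ⁻¹' Ioo (-δ) δ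

theorem isOpen_graphDomain (δ : ℝ) : IsOpen (graphDomain δ) := by
  refine ContinuousOn.isOpen_inter_preimage ?_ isOpen_Iio isOpen_Ioo
  exact continuousOn_id.div (continuousOn_const.sub continuousOn_id) fun T hT =>
    (sub_pos.2 (mem_Iio.1 hT)).ne'

theorem contDiffOn_graphMap (hn : 1 ≤ n) (hc : IsCenterCurve n Θ Θ₁ r) (hδr : δ < r) :
    ContDiffOn ℝ 2 (graphMap n s Θ) (graphDomain δ) := by
  have hd : ContDiffOn ℝ 2 (fun T : ℝ => T / (1 - T)) (graphDomain δ) :=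
    contDiffOn_id.div (contDiffOn_const.sub contDiffOn_id) fun T hT =>
      (sub_pos.2 (mem_Iio.1 hT.1)).ne'
  have hΘ : ContDiffOn ℝ 2 (fun T => Θ (T / (1 - T))) (graphDomain δ) :=
    hc.contDiffOn.comp hd fun T hT => ⟨by linarith [hT.2.1], by linarith [hT.2.2]⟩
  have hG : ContDiffOn ℝ 2 (fun T => G n (Θ (T / (1 - T)))) (graphDomain δ) :=
    (contDiff_G hn).comp_contDiffOn hΘ
  have hcos : ContDiffOn ℝ 2 (fun T => Real.cos (Θ (T / (1 - T)))) (graphDomain δ) :=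
    Real.contDiff_cos.comp_contDiffOn hΘ
  exact contDiffOn_const.prodMk (((contDiffOn_const.mul hG).add
    (contDiffOn_const.mul contDiffOn_id)).prodMk ((contDiffOn_const.mul hcos).sub contDiffOn_const))

/-- Tangency: `dΣ/dT = s √n (-√n/3) = -n s / 3` is the slope of `centerDirection`, and `X` has no
linear term. -/
theorem hasDerivAt_graphMap (hn : 1 ≤ n) (hc : IsCenterCurve n Θ Θ₁ r) (s : ℝ) :
    HasDerivAt (graphMap n s Θ) 0 0 := by
  have hd : HasDerivAt (fun T : ℝ => T / (1 - T)) 1 0 :=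
    ((hasDerivAt_id (0 : ℝ)).div ((hasDerivAt_id (0 : ℝ)).const_sub 1) (by simp)).congr_deriv
      (by simp)
  have h0 : (0 : ℝ) / (1 - 0) ∈ Ioo (-r) r := by simpa using hc.zero_mem
  have hG := (hc.hasDerivAt_G_comp hn h0).comp 0 hd
  have hcos := (Real.hasDerivAt_cos _).comp 0 ((hc.hasDerivAt _ h0).comp 0 hd)
  refine ((hasDerivAt_const (0 : ℝ) (0 : ℝ)).prodMk (((hG.const_mul s).add
    ((hasDerivAt_id (0 : ℝ)).const_mul (n * s / 3))).prodMk
    ((hcos.const_mul s).sub_const s))).congr_deriv ?_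
  have hsq := Real.mul_self_sqrt (Nat.cast_nonneg (α := ℝ) n)
  simp only [zero_div, hc.apply_zero, hc.deriv_zero, G'_zero, Function.comp, Real.sin_zero]
  simp only [Prod.mk_eq_zero]
  refine ⟨trivial, ?_, by ring⟩
  linear_combination (-s / 3) * hsq

theorem isLocalCenterManifold (hn : 1 ≤ n) (hc : IsCenterCurve n Θ Θ₁ r) (hs : s = 1 ∨ s = -1)
    (hγ : 0 < γ) (hδ : 0 < δ) (hδr : δ < r) :
    IsLocalCenterManifold 2 (vectorField n γ) (deSitter s) (thetaGraph n s Θ δ) := by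
  have hδ1 := hδr.le.trans (hc.r_le_one hn)
  let L : centerSubspace (vectorField n γ) (deSitter s) →L[ℝ] ℝ :=
    (ContinuousLinearMap.fst ℝ ℝ (ℝ × ℝ)).comp (Submodule.subtypeL _)
  have hpoint : ∀ u : centerSubspace (vectorField n γ) (deSitter s), L u ∈ graphDomain δ →
      deSitter s + (u : State) + graphMap n s Θ (L u) =
        stateCurve n s Θ (L u / (1 - L u)) := by
    intro u hu
    have h1 : (u : State) = L u • centerDirection n s :=
      (mem_centerSubspace_iff hn hγ hs).1 u.2
    rw [h1]
    ext
    · simp only [deSitter, centerDirection, graphMap, stateCurve, Prod.smul_mk, Prod.mk_add_mk,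
        smul_eq_mul, mul_one, add_zero, zero_add]
      exact (div_one_add_tildeT hu.1).symm
    · simp [deSitter, centerDirection, graphMap, stateCurve]
      ring
    · simp [deSitter, centerDirection, graphMap, stateCurve]
  refine ⟨vectorField_deSitter n γ hs, hc.isLocallyInvariant hn hs γ hδ hδr, L ⁻¹' graphDomain δ,
    fun u => graphMap n s Θ (L u), (isOpen_graphDomain δ).preimage L.continuous, ?_,
    (hc.contDiffOn_graphMap hn hδr).comp L.contDiff.contDiffOn fun u hu => hu,
    fun u _ => (mem_hyperbolicSubspace_iff hn hγ hs).2 rfl, ?_, ?_, ?_⟩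
  · rw [mem_preimage, map_zero]
    exact ⟨by simp, by simpa using hδ⟩
  · simp [graphMap, hc.apply_zero, G_zero]
  · have h1 : HasFDerivAt (graphMap n s Θ) (0 : ℝ →L[ℝ] State) (L 0) := by
      rw [map_zero]
      simpa using (hc.hasDerivAt_graphMap hn s).hasFDerivAt
    have h2 := h1.comp 0 L.hasFDerivAt
    rwa [ContinuousLinearMap.zero_comp] at h2
  · ext z
    rw [mem_thetaGraph_iff hδ1]
    constructor
    · rintro ⟨t, ht, rfl⟩
      have hpos : 0 < 1 + t := by linarith [ht.1]
      have htt := tildeT_div t hpos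
      have hmem : (t / (1 + t)) • centerDirection n s ∈
          centerSubspace (vectorField n γ) (deSitter s) :=
        (mem_centerSubspace_iff hn hγ hs).2 (by simp [centerDirection])
      have hL : L ⟨_, hmem⟩ = t / (1 + t) := by simp [L, centerDirection]
      have hdom : L ⟨_, hmem⟩ ∈ graphDomain δ := by
        rw [hL]
        refine ⟨?_, ?_⟩
        · rw [mem_Iio, div_lt_one hpos]
          linarith
        · rwa [mem_preimage, htt]
      refine ⟨⟨_, hmem⟩, hdom, ?_⟩
      exact (hpoint _ hdom).trans (by rw [hL, htt])
    · rintro ⟨u, hu, rfl⟩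
      exact ⟨_, hu.2, (hpoint u hu).symm⟩

end IsCenterCurve

end ScalarCosmology

/-! ## Uniqueness of the center manifold -/

/-- A solution of a singular linear equation `τ (3 w + c Ω) Ω' = λ Ω`, `λ < 0`, that tends to zero
as `τ → 0` vanishes. -/
theorem eq_zero_of_singular_linear_ode {Ω Ω' w k lam : ℝ → ℝ} {r c c₀ lam₀ : ℝ} (hc : 0 < c)
    (hc₀ : 0 < c₀) (hlam₀ : 0 < lam₀) (hΩ : ∀ τ ∈ Ioo 0 r, HasDerivAt Ω (Ω' τ) τ)
    (hw : ContinuousOn w (Ioo 0 r)) (hw₀ : ∀ τ ∈ Ioo 0 r, c₀ * τ ^ 2 ≤ w τ)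
    (hk : ∀ τ ∈ Ioo 0 r, 0 < k τ) (hlam : ∀ τ ∈ Ioo 0 r, lam τ ≤ -lam₀)
    (hke : ∀ τ ∈ Ioo 0 r, k τ * |3 * w τ + c * Ω τ| ≤ lam₀ / 3)
    (heq : ∀ τ ∈ Ioo 0 r, τ * (k τ * (3 * w τ + c * Ω τ)) * Ω' τ = lam τ * Ω τ)
    (hlim : Tendsto Ω (𝓝[>] 0) (𝓝 0)) {τ : ℝ} (hτ : τ ∈ Ioo 0 r) : Ω τ = 0 := by
  -- At a zero of this factor the equation would force `Ω = 0`, hence `w = 0`, against `w ≥ c₀ τ²`.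
  -- So the factor has a constant sign.
  have hne : ∀ τ ∈ Ioo 0 r, 3 * w τ + c * Ω τ ≠ 0 := by
    intro τ hτ h0
    have h1 := heq τ hτ
    rw [h0, mul_zero, mul_zero, zero_mul, eq_comm, mul_eq_zero] at h1
    have h2 : Ω τ = 0 := h1.resolve_left (by linarith [hlam τ hτ])
    rw [h2] at h0
    have h3 : 0 < c₀ * τ ^ 2 := mul_pos hc₀ (pow_pos hτ.1 2)
    linarith [hw₀ τ hτ]
  have hcont : ContinuousOn (fun τ => 3 * w τ + c * Ω τ) (Ioo 0 r) :=
    (continuousOn_const.mul hw).add (continuousOn_const.mul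
      fun τ hτ => (hΩ τ hτ).continuousAt.continuousWithinAt)
  -- A center manifold may a priori enter `Ω < 0`, so the negative sign must be excluded. It would
  -- give `-Ω > (3 c₀ / c) τ²`; but `hke` gives `τ (-Ω)' ≥ 3 (-Ω)`, so `-Ω / τ³` is increasing and
  -- `-Ω = O(τ³)`, a contradiction for small `τ`.
  by_cases hneg : ∃ τ₁ ∈ Ioo 0 r, 3 * w τ₁ + c * Ω τ₁ < 0
  · exfalso
    obtain ⟨τ₁, hτ₁, he₁⟩ := hneg
    have he : ∀ τ ∈ Ioo 0 r, 3 * w τ + c * Ω τ < 0 := by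
      intro τ hτ
      by_contra! hge
      obtain ⟨σ, hσ, h0⟩ := isPreconnected_Ioo.intermediate_value hτ₁ hτ hcont ⟨he₁.le, hge⟩
      exact hne σ hσ h0
    have hlow : ∀ τ ∈ Ioo 0 r, 3 * c₀ / c * τ ^ 2 < -Ω τ := by
      intro τ hτ
      rw [div_mul_eq_mul_div, div_lt_iff₀ hc]
      linarith [hw₀ τ hτ, he τ hτ]
    have hd : ∀ τ ∈ Ioo 0 r, HasDerivAt (fun τ => -Ω τ / τ ^ 3)
        ((-Ω' τ * τ ^ 3 - -Ω τ * (3 * τ ^ 2)) / (τ ^ 3) ^ 2) τ := fun τ hτ =>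
      ((hΩ τ hτ).neg.div (hasDerivAt_pow 3 τ) (pow_pos hτ.1 3).ne').congr_deriv (by norm_num)
    have hmono : MonotoneOn (fun τ => -Ω τ / τ ^ 3) (Ioo 0 r) := by
      refine monotoneOn_of_deriv_nonneg (convex_Ioo 0 r)
        (fun τ hτ => (hd τ hτ).continuousAt.continuousWithinAt)
        (fun τ hτ => (hd τ (interior_subset hτ)).differentiableAt.differentiableWithinAt)
        fun τ hτ => ?_
      have hτ := interior_subset hτ
      rw [(hd τ hτ).deriv]
      refine div_nonneg ?_ (by positivity)
      have h1 := heq τ hτ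
      have h2 := hke τ hτ
      have h3 := he τ hτ
      have h4 := hlam τ hτ
      have h5 : 0 < -Ω τ := lt_of_le_of_lt (by have := hτ.1; positivity) (hlow τ hτ)
      rw [abs_of_neg h3] at h2
      have h6 : 0 < k τ * -(3 * w τ + c * Ω τ) := mul_pos (hk τ hτ) (by linarith)
      have h7 : 3 * -Ω τ ≤ τ * -Ω' τ := by
        have h8 : (k τ * -(3 * w τ + c * Ω τ)) * (τ * -Ω' τ) = -lam τ * -Ω τ := by
          linear_combination h1
        have h9 : (k τ * -(3 * w τ + c * Ω τ)) * (3 * -Ω τ) ≤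
            (k τ * -(3 * w τ + c * Ω τ)) * (τ * -Ω' τ) := by
          rw [h8]
          nlinarith
        exact le_of_mul_le_mul_left h9 h6
      have h8 : -Ω' τ * τ ^ 3 - -Ω τ * (3 * τ ^ 2) = τ ^ 2 * (τ * -Ω' τ - 3 * -Ω τ) := by ring
      rw [h8]
      exact mul_nonneg (by positivity) (by linarith)
    set C := -Ω τ₁ / τ₁ ^ 3
    have hup : ∀ τ ∈ Ioo 0 τ₁, 3 * c₀ / c < C * τ := by
      intro τ hτ
      have hτ' : τ ∈ Ioo 0 r := ⟨hτ.1, hτ.2.trans hτ₁.2⟩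
      have h1 := hmono hτ' hτ₁ hτ.2.le
      have h2 := hlow τ hτ'
      have h3 : -Ω τ ≤ C * τ ^ 3 := (div_le_iff₀ (pow_pos hτ.1 3)).1 h1
      have h4 : 3 * c₀ / c * τ ^ 2 < C * τ * τ ^ 2 := by linarith
      exact lt_of_mul_lt_mul_right h4 (by positivity)
    have hlimC : Tendsto (fun τ : ℝ => C * τ) (𝓝[>] 0) (𝓝 0) := by
      have : Tendsto (fun τ : ℝ => C * τ) (𝓝 0) (𝓝 (C * 0)) := tendsto_id.const_mul C
      rw [mul_zero] at this
      exact this.mono_left nhdsWithin_le_nhds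
    have hle : 3 * c₀ / c ≤ 0 := by
      refine ge_of_tendsto hlimC ?_
      filter_upwards [Ioo_mem_nhdsGT hτ₁.1] with τ hτ using (hup τ hτ).le
    have : 0 < 3 * c₀ / c := by positivity
    linarith
  · push Not at hneg
    have hpos : ∀ τ ∈ Ioo 0 r, 0 < 3 * w τ + c * Ω τ := fun τ hτ =>
      lt_of_le_of_ne (hneg τ hτ) (hne τ hτ).symm
    -- With the positive sign, `Ω` and `Ω'` have opposite signs; `Ω²` does not increase, and it
    -- starts at `0`.
    have hsq : Ω τ ^ 2 ≤ 0 := by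
      refine nonpos_of_deriv_nonpos_of_tendsto_nhdsGT (φ := fun τ => Ω τ ^ 2)
        (φ' := fun τ => 2 * Ω τ * Ω' τ) (fun τ hτ => ((hΩ τ hτ).pow 2).congr_deriv (by simp))
        (fun τ hτ => ?_) (by simpa using hlim.pow 2) hτ
      have h1 : 0 < τ * (k τ * (3 * w τ + c * Ω τ)) :=
        mul_pos hτ.1 (mul_pos (hk τ hτ) (hpos τ hτ))
      have h2 : (τ * (k τ * (3 * w τ + c * Ω τ))) * (2 * Ω τ * Ω' τ) =
          2 * (lam τ * Ω τ ^ 2) := by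
        linear_combination 2 * Ω τ * heq τ hτ
      have h3 : lam τ * Ω τ ^ 2 ≤ 0 :=
        mul_nonpos_of_nonpos_of_nonneg (by linarith [hlam τ hτ]) (sq_nonneg _)
      by_contra! h4
      have h5 := mul_pos h1 h4
      linarith
    exact pow_eq_zero_iff two_ne_zero |>.1 (le_antisymm hsq (sq_nonneg _))

/-! ### Contraction in `Σ` on the scalar field boundary near a de Sitter point -/

namespace ScalarCosmology

variable {n : ℕ} {γ s : ℝ}

theorem omegaM'_smul (n : ℕ) (z v : State) (a : ℝ) : omegaM' n z (a • v) = a * omegaM' n z v := by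
  simp only [omegaM', Prod.smul_fst, Prod.smul_snd, smul_eq_mul]
  ring

/-- A neighbourhood of the de Sitter point on which the flow contracts towards invariant
graphs. -/
def IsNearDeSitter (n : ℕ) (s : ℝ) (z : State) : Prop :=
  n * |z.1| < 1 / 12 ∧ |z.2.1| < 1 / 3 ∧ 1 / 2 < s * z.2.2

theorem eventually_isNearDeSitter (n : ℕ) (hs : s = 1 ∨ s = -1) :
    ∀ᶠ z in 𝓝 (deSitter s), IsNearDeSitter n s z := by
  have hs1 : s * s = 1 := by rw [← sq, sign_sq hs]
  refine Eventually.and ?_ (Eventually.and ?_ ?_)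
  · have : Continuous fun z : State => (n : ℝ) * |z.1| := by fun_prop
    exact this.continuousAt.eventually (Iio_mem_nhds (by simp [deSitter]))
  · have : Continuous fun z : State => |z.2.1| := by fun_prop
    exact this.continuousAt.eventually (Iio_mem_nhds (by simp [deSitter]))
  · have : Continuous fun z : State => s * z.2.2 := by fun_prop
    exact this.continuousAt.eventually (Ioi_mem_nhds (by simp [deSitter, hs1]; norm_num))

theorem abs_pow_sub_pow_le (hn : 1 ≤ n) {x y : ℝ} (hx : 1 / 2 < x) (hy : 1 / 2 < y) :
    |x ^ (2 * n - 1) - y ^ (2 * n - 1)| ≤ 2 * |x ^ (2 * n) - y ^ (2 * n)| := by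
  wlog hxy : x ≤ y generalizing x y
  · rw [abs_sub_comm, abs_sub_comm (x ^ (2 * n))]
    exact this hy hx (le_of_not_ge hxy)
  have h1 : x ^ (2 * n - 1) ≤ y ^ (2 * n - 1) := pow_le_pow_left₀ (by linarith) hxy _
  have h2 : x ^ (2 * n) ≤ y ^ (2 * n) := pow_le_pow_left₀ (by linarith) hxy _
  have h3 : 0 ≤ x ^ (2 * n - 1) := pow_nonneg (by linarith) _
  rw [abs_sub_comm, abs_sub_comm (x ^ (2 * n)), abs_of_nonneg (sub_nonneg.2 h1),
    abs_of_nonneg (sub_nonneg.2 h2), ← pow_two_mul_sub_one_mul hn x,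
    ← pow_two_mul_sub_one_mul hn y]
  nlinarith

/-- On the boundary `X^(2n) = 1 - Σ²`, and `|X| > 1/2`. The force term in the `Σ` equation is
therefore controlled by `Σ` alone, with a constant independent of `n`. -/
theorem abs_state_pow_sub_le (hn : 1 ≤ n) (hs : s = 1 ∨ s = -1) {z z' : State}
    (hz : IsNearDeSitter n s z) (hz' : IsNearDeSitter n s z') (h : omegaM n z = 0)
    (h' : omegaM n z' = 0) : |z.2.2 ^ (2 * n - 1) - z'.2.2 ^ (2 * n - 1)| ≤
      2 * |z.2.1 ^ 2 - z'.2.1 ^ 2| := by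
  have h1 := abs_pow_sub_pow_le hn hz.2.2 hz'.2.2
  simp only [mul_pow, sign_pow_two_mul hs, sign_pow_two_mul_sub_one hn hs, one_mul] at h1
  have hs1 : |s| = 1 := by rcases hs with rfl | rfl <;> simp
  rw [← mul_sub, abs_mul, hs1, one_mul] at h1
  have h2 : z.2.2 ^ (2 * n) - z'.2.2 ^ (2 * n) = -(z.2.1 ^ 2 - z'.2.1 ^ 2) := by
    simp only [omegaM, omegaPhi] at h h'
    linarith
  rwa [h2, abs_neg] at h1

theorem eq_of_omegaM_eq_zero (hn : 1 ≤ n) (hs : s = 1 ∨ s = -1) {z z' : State}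
    (hz : IsNearDeSitter n s z) (hz' : IsNearDeSitter n s z') (h : omegaM n z = 0)
    (h' : omegaM n z' = 0) (h1 : z.1 = z'.1) (h2 : z.2.1 = z'.2.1) : z = z' := by
  refine Prod.ext h1 (Prod.ext h2 ?_)
  have h3 : (s * z.2.2) ^ (2 * n) = (s * z'.2.2) ^ (2 * n) := by
    rw [mul_pow, mul_pow, sign_pow_two_mul hs]
    simp only [omegaM, omegaPhi, h2] at h h'
    linarith
  have h4 := (pow_left_inj₀ (by linarith [hz.2.2]) (by linarith [hz'.2.2])
    (by omega : 2 * n ≠ 0)).1 h3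
  exact mul_left_cancel₀ (by rcases hs with rfl | rfl <;> norm_num) h4

/-- The first term is the decay at rate close to `3` and contributes at most `-(11/6) (σ - ρ)²`. The
force difference and the difference of the speeds of `T` carry a factor `T` and cost at most `1/9`
and `1/3` of `(σ - ρ)²`. -/
theorem contraction_of_abs_le {N T σ ρ P P' m : ℝ} (hN : 1 ≤ N) (hT : N * |T| < 1 / 12)
    (hσ : |σ| < 1 / 3) (hρ : |ρ| < 1 / 3) (hP : |P - P'| ≤ 2 * |σ ^ 2 - ρ ^ 2|) (hm : |m| ≤ N) :
    -(3 * (1 - T) * (1 - (σ ^ 2 + σ * ρ + ρ ^ 2)) * (σ - ρ) ^ 2) +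
      -(N * T * ((P - P') * (σ - ρ))) +
      -(3 * (T * (1 - T) ^ 2 * ((σ ^ 2 - ρ ^ 2) * (σ - ρ)) * (m / N))) ≤ 0 := by
  have hN0 : 0 < N := by linarith
  have hT1 : |T| ≤ 1 / 12 := by nlinarith [abs_nonneg T]
  obtain ⟨hTl, hTu⟩ := abs_le.1 hT1
  obtain ⟨hσl, hσu⟩ := abs_lt.1 hσ
  obtain ⟨hρl, hρu⟩ := abs_lt.1 hρ
  have hsum : |σ + ρ| ≤ 2 / 3 := abs_le.2 ⟨by linarith, by linarith⟩
  have hfac : |σ ^ 2 - ρ ^ 2| ≤ 2 / 3 * |σ - ρ| := by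
    rw [show σ ^ 2 - ρ ^ 2 = (σ + ρ) * (σ - ρ) by ring, abs_mul]
    exact mul_le_mul_of_nonneg_right hsum (abs_nonneg _)
  have hfac2 : |(σ ^ 2 - ρ ^ 2) * (σ - ρ)| ≤ 2 / 3 * (σ - ρ) ^ 2 := by
    rw [abs_mul, ← sq_abs (σ - ρ), sq |σ - ρ|, ← mul_assoc]
    exact mul_le_mul_of_nonneg_right hfac (abs_nonneg _)
  have hP2 : |(P - P') * (σ - ρ)| ≤ 4 / 3 * (σ - ρ) ^ 2 := by
    rw [abs_mul, ← sq_abs (σ - ρ), sq |σ - ρ|, ← mul_assoc]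
    exact mul_le_mul_of_nonneg_right (by linarith) (abs_nonneg _)
  have hd := sq_nonneg (σ - ρ)
  have hA : 11 / 6 * (σ - ρ) ^ 2 ≤
      3 * (1 - T) * (1 - (σ ^ 2 + σ * ρ + ρ ^ 2)) * (σ - ρ) ^ 2 := by
    refine mul_le_mul_of_nonneg_right ?_ hd
    have hσ2 : σ ^ 2 ≤ 1 / 9 := by nlinarith
    have hρ2 : ρ ^ 2 ≤ 1 / 9 := by nlinarith
    have hq : 2 / 3 ≤ 1 - (σ ^ 2 + σ * ρ + ρ ^ 2) := by nlinarith [sq_nonneg (σ - ρ)]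
    have h := mul_le_mul (show 11 / 4 ≤ 3 * (1 - T) by linarith) hq (by norm_num) (by linarith)
    linarith
  have hB : |N * T * ((P - P') * (σ - ρ))| ≤ 1 / 12 * (4 / 3 * (σ - ρ) ^ 2) := by
    rw [abs_mul, abs_mul, abs_of_pos hN0]
    exact mul_le_mul hT.le hP2 (abs_nonneg _) (by norm_num)
  have hC : |T * (1 - T) ^ 2 * ((σ ^ 2 - ρ ^ 2) * (σ - ρ)) * (m / N)| ≤
      1 / 12 * 2 * (2 / 3 * (σ - ρ) ^ 2) * 1 := by
    have hmN : |m / N| ≤ 1 := by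
      rw [abs_div, abs_of_pos hN0, div_le_one hN0]
      exact hm
    have h2 : |(1 - T) ^ 2| ≤ 2 := by
      rw [abs_of_nonneg (sq_nonneg _)]
      nlinarith
    rw [abs_mul _ (m / N), abs_mul _ ((σ ^ 2 - ρ ^ 2) * (σ - ρ)), abs_mul T]
    exact mul_le_mul (mul_le_mul (mul_le_mul hT1 h2 (abs_nonneg _) (by norm_num)) hfac2
      (abs_nonneg _) (by norm_num)) hmN (abs_nonneg _) (by positivity)
  have hB' := (abs_le.1 hB).1
  have hC' := (abs_le.1 hC).1
  linarith

/-- The flow contracts in the direction of `Σ` towards an invariant curve with tangent `v`. -/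
theorem contraction (hn : 1 ≤ n) (hs : s = 1 ∨ s = -1) {z z' v : State}
    (hz : IsNearDeSitter n s z) (hz' : IsNearDeSitter n s z') (h : omegaM n z = 0)
    (h' : omegaM n z' = 0) (h1 : z.1 = z'.1)
    (hv : vectorField n γ z' = (vectorField n γ z').1 • v) (hvn : |v.2.1| ≤ n) :
    ((vectorField n γ z).2.1 - (vectorField n γ z).1 * v.2.1) * (z.2.1 - z'.2.1) ≤ 0 := by
  -- Subtracting the `Σ` component of the invariance at `z'` splits the left side into the three
  -- terms of `contraction_of_abs_le`, with `m` the slope of the curve.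
  refine le_of_eq_of_le ?_ (contraction_of_abs_le (by exact_mod_cast hn) hz.1 hz.2.1 hz'.2.1
    (abs_state_pow_sub_le hn hs hz hz' h h') hvn)
  have hv2 := congrArg (fun w : State => w.2.1) hv
  simp only [vectorField, decel_of_omegaM_eq_zero h, decel_of_omegaM_eq_zero h', Prod.smul_snd,
    Prod.smul_fst, smul_eq_mul, ← h1] at hv2 ⊢
  linear_combination (z.2.1 - z'.2.1) * hv2

/-- A differentiable invariant curve through the de Sitter point, parametrized by `T`, that is
tangent to the center subspace. -/
structure IsInvariantCurve (n : ℕ) (γ s : ℝ) (c c' : ℝ → State) (ρ : ℝ) : Prop where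
  pos : 0 < ρ
  zero : c 0 = deSitter s
  fst : ∀ T ∈ Ioo (-ρ) ρ, (c T).1 = T
  hasDerivAt : ∀ T ∈ Ioo (-ρ) ρ, HasDerivAt c (c' T) T
  deriv_zero : c' 0 = centerDirection n s
  continuousAt_deriv : ContinuousAt c' 0
  invariant : ∀ T ∈ Ioo (-ρ) ρ, vectorField n γ (c T) = (vectorField n γ (c T)).1 • c' T

/-- The hyperbolic subspace is `T = 0`, so `T` is a coordinate on every center manifold. -/
theorem exists_isInvariantCurve (hn : 1 ≤ n) (hγ : 0 < γ) (hs : s = 1 ∨ s = -1) {W : Set State}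
    (hW : IsLocalCenterManifold 1 (vectorField n γ) (deSitter s) W) :
    ∃ c c' ρ, IsInvariantCurve n γ s c c' ρ ∧ ∀ z : State, z.1 ∈ Ioo (-ρ) ρ →
      (z ∈ W ↔ z = c z.1) := by
  obtain ⟨-, hinv, N, h, hN, h0N, hC1, hhyp, hh0, hdh, rfl⟩ := hW
  have hmem : ∀ T : ℝ, T • centerDirection n s ∈
      centerSubspace (vectorField n γ) (deSitter s) := fun T =>
    (mem_centerSubspace_iff hn hγ hs).2 (by simp [centerDirection])
  let e : ℝ →L[ℝ] centerSubspace (vectorField n γ) (deSitter s) :=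
    ContinuousLinearMap.toSpanSingleton ℝ ⟨centerDirection n s, by simpa using hmem 1⟩
  have he : ∀ T, (e T : State) = T • centerDirection n s := fun T => rfl
  obtain ⟨ρ, hρ, hball⟩ := Metric.isOpen_iff.1 (hN.preimage e.continuous) 0 (by simpa using h0N)
  rw [Real.ball_eq_Ioo, zero_sub, zero_add] at hball
  let c : ℝ → State := fun T => deSitter s + (e T : State) + h (e T)
  have hh1 : ∀ u ∈ N, (h u).1 = 0 := fun u hu =>
    (mem_hyperbolicSubspace_iff hn hγ hs).1 (hhyp u hu)
  have hfst : ∀ T ∈ Ioo (-ρ) ρ, (c T).1 = T := by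
    intro T hT
    change 0 + (T • centerDirection n s).1 + (h (e T)).1 = T
    rw [hh1 _ (hball hT)]
    simp [centerDirection]
  have hcC1 : ContDiffOn ℝ 1 c (Ioo (-ρ) ρ) := by
    refine (contDiffOn_const.add ?_).add (hC1.comp e.contDiff.contDiffOn fun T hT => hball hT)
    exact ((Submodule.subtypeL _).contDiff.comp e.contDiff).contDiffOn
  have hcd : ∀ T ∈ Ioo (-ρ) ρ, HasDerivAt c (deriv c T) T := fun T hT =>
    ((hcC1.differentiableOn one_ne_zero).differentiableAt (isOpen_Ioo.mem_nhds hT)).hasDerivAt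
  have h0 : (0 : ℝ) ∈ Ioo (-ρ) ρ := ⟨neg_lt_zero.2 hρ, hρ⟩
  have hW : ∀ z : State, z.1 ∈ Ioo (-ρ) ρ →
      (z ∈ (fun u : centerSubspace (vectorField n γ) (deSitter s) =>
        deSitter s + (u : State) + h u) '' N ↔ z = c z.1) := by
    intro z hz
    constructor
    · rintro ⟨u, hu, rfl⟩
      have h1 : (deSitter s + (u : State) + h u).1 = (u : State).1 := by
        simp [hh1 u hu, deSitter]
      have h2 : e (u : State).1 = u :=
        Subtype.ext ((he _).trans ((mem_centerSubspace_iff hn hγ hs).1 u.2).symm)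
      simp only [h1, c, h2]
    · intro h1
      rw [h1]
      exact ⟨e z.1, hball hz, rfl⟩
  refine ⟨c, deriv c, ρ, ⟨hρ, by simp [c, hh0], hfst, hcd, ?_, ?_, ?_⟩, hW⟩
  · have h1 : HasFDerivAt h (0 : centerSubspace (vectorField n γ) (deSitter s) →L[ℝ] State)
        (e 0) := by rwa [map_zero]
    have h2 := (h1.comp 0 e.hasFDerivAt).hasDerivAt
    have h3 : HasDerivAt (fun T => (e T : State)) (centerDirection n s) 0 := by
      simpa [he] using (hasDerivAt_id (0 : ℝ)).smul_const (centerDirection n s)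
    have h4 := (h3.const_add (deSitter s)).add h2
    rw [ContinuousLinearMap.zero_comp, zero_apply, add_zero] at h4
    exact h4.deriv
  · exact (hcC1.continuousOn_deriv_of_isOpen isOpen_Ioo le_rfl).continuousAt (isOpen_Ioo.mem_nhds h0)
  · intro T hT
    have hcT : (c T).1 ∈ Ioo (-ρ) ρ := by rwa [hfst T hT]
    obtain ⟨ε, hε, x, hx0, hx, hxW⟩ := hinv (c T) ((hW _ hcT).2 (by rw [hfst T hT]))
    have hε0 : (0 : ℝ) ∈ Ioo (-ε) ε := ⟨neg_lt_zero.2 hε, hε⟩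
    have hx' := hx 0 hε0
    rw [hx0] at hx'
    obtain ⟨h1, -, -⟩ := hx'.state_coords
    -- A solution on the graph satisfies `x = c(x.1)`; its derivative at `0` says that the field is
    -- parallel to the tangent of the curve.
    have hev : x =ᶠ[𝓝 0] fun t => c (x t).1 := by
      have h2 : ∀ᶠ t in 𝓝 (0 : ℝ), (x t).1 ∈ Ioo (-ρ) ρ :=
        h1.continuousAt.eventually (isOpen_Ioo.mem_nhds (by rwa [← hx0] at hcT))
      filter_upwards [h2, isOpen_Ioo.mem_nhds hε0] with t ht ht'
      exact (hW _ ht).1 (hxW t ht')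
    have h3 : HasDerivAt c (deriv c T) (x 0).1 := by
      rw [hx0, hfst T hT]
      exact hcd T hT
    have h4 := h3.scomp (0 : ℝ) h1
    exact hx'.unique (h4.congr_of_eventuallyEq hev)

end ScalarCosmology

/-! ### Uniqueness of the invariant curve: vanishing of `Ω_m`, then of the `Σ`-distance -/

namespace ScalarCosmology

variable {n : ℕ} {γ s ρ : ℝ} {c c' : ℝ → State}

theorem decel_add_one (n : ℕ) (γ : ℝ) (z : State) :
    1 + decel n γ z = 3 * z.2.1 ^ 2 + 3 / 2 * γ * omegaM n z := by
  rw [decel]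
  ring

theorem continuous_omegaM (n : ℕ) : Continuous (omegaM n) := by
  unfold omegaM omegaPhi
  fun_prop

namespace IsInvariantCurve

theorem zero_mem (hc : IsInvariantCurve n γ s c c' ρ) : (0 : ℝ) ∈ Ioo (-ρ) ρ :=
  ⟨neg_lt_zero.2 hc.pos, hc.pos⟩

theorem eventually_mem (hc : IsInvariantCurve n γ s c c' ρ) : ∀ᶠ T in 𝓝 0, T ∈ Ioo (-ρ) ρ :=
  isOpen_Ioo.mem_nhds hc.zero_mem

theorem tendsto (hc : IsInvariantCurve n γ s c c' ρ) : Tendsto c (𝓝 0) (𝓝 (deSitter s)) := by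
  have := (hc.hasDerivAt 0 hc.zero_mem).continuousAt.tendsto
  rwa [hc.zero] at this

/-- Along an invariant curve `Σ` has a simple zero at the de Sitter point. -/
theorem eventually_sq_le (hn : 1 ≤ n) (hs : s = 1 ∨ s = -1)
    (hc : IsInvariantCurve n γ s c c' ρ) : ∀ᶠ T in 𝓝 0, 1 / 36 * T ^ 2 ≤ (c T).2.1 ^ 2 := by
  have hn' : (1 : ℝ) ≤ n := by exact_mod_cast hn
  obtain ⟨-, h, -⟩ := (hc.hasDerivAt 0 hc.zero_mem).state_coords
  rw [hc.deriv_zero] at h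
  have ho := (hasDerivAt_iff_isLittleO.1 h).def (show (0 : ℝ) < n / 6 by positivity)
  filter_upwards [ho] with T hT
  simp only [hc.zero, deSitter, centerDirection, sub_zero, smul_eq_mul, Real.norm_eq_abs] at hT
  have hs1 : |s| = 1 := by rcases hs with rfl | rfl <;> simp
  have h1 : |T * -(n * s / 3)| = n / 3 * |T| := by
    rw [show T * -(n * s / 3) = -(n / 3 * (T * s)) by ring, abs_neg, abs_mul, abs_mul, hs1,
      abs_of_pos (by positivity), mul_one]
  have h2 : |T| / 6 ≤ |(c T).2.1| := by
    have h3 := abs_sub_abs_le_abs_sub (T * -(n * s / 3)) (c T).2.1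
    rw [abs_sub_comm, h1] at h3
    have h4 : 1 * |T| ≤ n * |T| := mul_le_mul_of_nonneg_right hn' (abs_nonneg T)
    linarith
  have h5 := pow_le_pow_left₀ (by positivity) h2 2
  rw [div_pow, sq_abs, sq_abs] at h5
  linarith

theorem eventually_abs_deriv_le (hn : 1 ≤ n) (hs : s = 1 ∨ s = -1)
    (hc : IsInvariantCurve n γ s c c' ρ) : ∀ᶠ T in 𝓝 0, |(c' T).2.1| ≤ n := by
  have hn' : (1 : ℝ) ≤ n := by exact_mod_cast hn
  have h1 : Tendsto (fun T => |(c' T).2.1|) (𝓝 0) (𝓝 |(c' 0).2.1|) :=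
    (continuous_fst.comp continuous_snd).abs.continuousAt.comp hc.continuousAt_deriv
  have hs1 : |s| = 1 := by rcases hs with rfl | rfl <;> simp
  have h2 : |(c' 0).2.1| < n := by
    rw [hc.deriv_zero, centerDirection, abs_neg, abs_div, abs_mul, hs1, Nat.abs_cast]
    norm_num
    linarith
  exact (h1.eventually (Iio_mem_nhds h2)).mono fun T hT => le_of_lt hT

theorem hasDerivAt_comp_sign_mul (hc : IsInvariantCurve n γ s c c' ρ) (ε : ℝ) {τ : ℝ}
    (hτ : ε * τ ∈ Ioo (-ρ) ρ) : HasDerivAt (fun τ => c (ε * τ)) (ε • c' (ε * τ)) τ := by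
  have h1 : HasDerivAt (fun τ : ℝ => ε * τ) ε τ := by
    simpa using (hasDerivAt_id τ).const_mul ε
  exact (hc.hasDerivAt _ hτ).scomp τ h1

end IsInvariantCurve

theorem tendsto_sign_mul (ε : ℝ) : Tendsto (fun τ : ℝ => ε * τ) (𝓝[>] 0) (𝓝 0) := by
  have : Tendsto (fun τ : ℝ => ε * τ) (𝓝 0) (𝓝 (ε * 0)) := tendsto_id.const_mul ε
  rw [mul_zero] at this
  exact this.mono_left nhdsWithin_le_nhds

/-- A property that holds on each half line near zero and at zero holds near zero. -/
theorem eventually_of_forall_sign {P : ℝ → Prop} {r : ℝ} (hr : 0 < r) (h0 : P 0)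
    (h : ∀ ε : ℝ, ε = 1 ∨ ε = -1 → ∀ τ ∈ Ioo 0 r, P (ε * τ)) : ∀ᶠ T in 𝓝 0, P T := by
  filter_upwards [Ioo_mem_nhds (neg_lt_zero.2 hr) hr] with T hT
  rcases lt_trichotomy T 0 with hneg | rfl | hpos
  · simpa using h (-1) (Or.inr rfl) (-T) ⟨by linarith, by linarith [hT.1]⟩
  · exact h0
  · simpa using h 1 (Or.inl rfl) T ⟨hpos, hT.2⟩

theorem sign_mul_mem_Ioo {ε τ r : ℝ} (hε : ε = 1 ∨ ε = -1) (hτ : τ ∈ Ioo 0 r) :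
    ε * τ ∈ Ioo (-r) r := by
  obtain ⟨h1, h2⟩ := hτ
  rcases hε with rfl | rfl <;> constructor <;> linarith

/-- Near the de Sitter point invariant curves lie on the scalar field boundary. -/
theorem IsInvariantCurve.eventually_omegaM_eq_zero (hn : 1 ≤ n) (hγ : 0 < γ)
    (hs : s = 1 ∨ s = -1) (hc : IsInvariantCurve n γ s c c' ρ) :
    ∀ᶠ T in 𝓝 0, omegaM n (c T) = 0 := by
  have hn' : (1 : ℝ) ≤ n := by exact_mod_cast hn
  have hn0 : (n : ℝ) ≠ 0 := by positivity
  have hΩlim : Tendsto (fun T => omegaM n (c T)) (𝓝 0) (𝓝 0) := by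
    have := ((continuous_omegaM n).tendsto _).comp hc.tendsto
    rwa [omegaM_deSitter n hs] at this
  -- The quantity is `1 + q`. The bound `γ / 3` yields both `2 (1 + q) - 3γ ≤ -2γ` and, as `k ≤ 2`,
  -- the bound `2γ / 3` needed for `hke`.
  have he : ∀ᶠ T in 𝓝 0, |3 * (c T).2.1 ^ 2 + 3 / 2 * γ * omegaM n (c T)| < γ / 3 := by
    have h1 : Continuous fun z : State => |3 * z.2.1 ^ 2 + 3 / 2 * γ * omegaM n z| := by
      have := continuous_omegaM n
      fun_prop
    have h2 := (h1.tendsto _).comp hc.tendsto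
    refine h2.eventually (Iio_mem_nhds ?_)
    rw [omegaM_deSitter n hs]
    simp only [deSitter]
    norm_num
    exact hγ
  obtain ⟨r, hr, hball⟩ := Metric.eventually_nhds_iff_ball.1
    ((he.and (hc.eventually_sq_le hn hs)).and (hc.eventually_mem.and
      (Ioo_mem_nhds (show (-1 / 2 : ℝ) < 0 by norm_num) (show (0 : ℝ) < 1 / 2 by norm_num))))
  rw [Real.ball_eq_Ioo, zero_sub, zero_add] at hball
  refine eventually_of_forall_sign hr (by rw [hc.zero, omegaM_deSitter n hs]) fun ε hε τ hτ => ?_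
  have hε2 := sign_sq hε
  -- With `T = ε τ` each half of the curve is treated as a function of `|T|`. The equation for
  -- `Ω_m`, written with `T` as parameter and divided by `1 - T`, takes the form of the lemma.
  refine eq_zero_of_singular_linear_ode (Ω := fun τ => omegaM n (c (ε * τ)))
    (Ω' := fun τ => omegaM' n (c (ε * τ)) (ε • c' (ε * τ))) (w := fun τ => (c (ε * τ)).2.1 ^ 2)
    (k := fun τ => 1 / n * (1 - ε * τ)) (c := 3 / 2 * γ) (c₀ := 1 / 36) (lam₀ := 2 * γ) (r := r)
    (lam := fun τ => 2 * (1 + decel n γ (c (ε * τ))) - 3 * γ)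
    (by positivity) (by norm_num) (by positivity) ?_ ?_ ?_ ?_ ?_ ?_ ?_
    (hΩlim.comp (tendsto_sign_mul ε)) hτ
  · exact fun τ hτ => hasDerivAt_omegaM
      (hc.hasDerivAt_comp_sign_mul ε (hball _ (sign_mul_mem_Ioo hε hτ)).2.1)
  · exact fun τ hτ => ((hc.hasDerivAt_comp_sign_mul ε
      (hball _ (sign_mul_mem_Ioo hε hτ)).2.1).state_coords.2.1.continuousAt.pow 2).continuousWithinAt
  · intro τ hτ
    have h := (hball _ (sign_mul_mem_Ioo hε hτ)).1.2
    rwa [mul_pow, hε2, one_mul] at h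
  · intro τ hτ
    have h := (hball _ (sign_mul_mem_Ioo hε hτ)).2.2.2
    have : 0 < 1 - ε * τ := by linarith
    positivity
  · intro τ hτ
    have h := (abs_lt.1 (hball _ (sign_mul_mem_Ioo hε hτ)).1.1).2
    simp only [decel_add_one]
    linarith
  · intro τ hτ
    have h := (hball _ (sign_mul_mem_Ioo hε hτ)).1.1
    have h1 := (hball _ (sign_mul_mem_Ioo hε hτ)).2.2
    have h2 : 1 / (n : ℝ) ≤ 1 := div_le_self zero_le_one hn'
    have h3 : 0 < 1 - ε * τ := by linarith [h1.2]
    have h4 : 1 / n * (1 - ε * τ) ≤ 1 * 2 :=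
      mul_le_mul h2 (by linarith [h1.1]) h3.le zero_le_one
    have h5 := mul_le_mul h4 h.le (abs_nonneg _) (by norm_num)
    linarith
  · intro τ hτ
    have hmem := hball _ (sign_mul_mem_Ioo hε hτ)
    have h1 := hmem.2.2.2
    have h3 : 1 - ε * τ ≠ 0 := by linarith
    have h4 := omegaM'_vectorField hn γ (c (ε * τ))
    rw [hc.invariant _ hmem.2.1, omegaM'_smul] at h4
    simp only [vectorField, hc.fst _ hmem.2.1] at h4
    simp only [omegaM'_smul, ← decel_add_one]
    refine mul_left_cancel₀ h3 ?_
    linear_combination h4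

/-- Uniqueness of the invariant curve near the de Sitter point. -/
theorem IsInvariantCurve.eventually_eq (hn : 1 ≤ n) (hγ : 0 < γ) (hs : s = 1 ∨ s = -1)
    {b b' : ℝ → State} {ρ' : ℝ} (hc : IsInvariantCurve n γ s c c' ρ)
    (hb : IsInvariantCurve n γ s b b' ρ') : ∀ᶠ T in 𝓝 0, c T = b T := by
  have hn' : (1 : ℝ) ≤ n := by exact_mod_cast hn
  obtain ⟨r, hr, hball⟩ := Metric.eventually_nhds_iff_ball.1
    (((hc.eventually_omegaM_eq_zero hn hγ hs).and (hb.eventually_omegaM_eq_zero hn hγ hs)).and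
    (((hc.tendsto.eventually (eventually_isNearDeSitter n hs)).and
      (hb.tendsto.eventually (eventually_isNearDeSitter n hs))).and
    (((hc.eventually_mem).and hb.eventually_mem).and
      ((hb.eventually_abs_deriv_le hn hs).and (hc.eventually_sq_le hn hs)))))
  rw [Real.ball_eq_Ioo, zero_sub, zero_add] at hball
  refine eventually_of_forall_sign hr (by rw [hc.zero, hb.zero]) fun ε hε τ hτ => ?_
  have hlim : Tendsto (fun τ => ((c (ε * τ)).2.1 - (b (ε * τ)).2.1) ^ 2) (𝓝[>] 0) (𝓝 0) := by
    have h1 := hc.tendsto.comp (tendsto_sign_mul ε)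
    have h2 := hb.tendsto.comp (tendsto_sign_mul ε)
    have h3 := (((continuous_fst.comp continuous_snd).tendsto _).comp h1).sub
      (((continuous_fst.comp continuous_snd).tendsto _).comp h2)
    simpa using h3.pow 2
  -- On `Ω_m = 0` the field moves `T` strictly away from `0`, since `Σ ≠ 0` off the fixed point.
  -- Increasing `|T|` thus follows the flow, and `contraction` applies.
  have hD : ((c (ε * τ)).2.1 - (b (ε * τ)).2.1) ^ 2 ≤ 0 := by
    refine nonpos_of_deriv_nonpos_of_tendsto_nhdsGT (b := r)
      (φ := fun τ => ((c (ε * τ)).2.1 - (b (ε * τ)).2.1) ^ 2)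
      (φ' := fun τ => 2 * ((c (ε * τ)).2.1 - (b (ε * τ)).2.1) *
        (ε * ((c' (ε * τ)).2.1 - (b' (ε * τ)).2.1))) (fun τ hτ => ?_) (fun τ hτ => ?_) hlim hτ
    · obtain ⟨-, -, ⟨hm1, hm2⟩, -⟩ := hball _ (sign_mul_mem_Ioo hε hτ)
      have h1 := (hc.hasDerivAt_comp_sign_mul ε hm1).state_coords.2.1
      have h2 := (hb.hasDerivAt_comp_sign_mul ε hm2).state_coords.2.1
      refine ((h1.sub h2).pow 2).congr_deriv ?_
      simp only [Prod.smul_fst, Prod.smul_snd, smul_eq_mul, Pi.sub_apply]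
      ring
    · obtain ⟨⟨hΩ1, hΩ2⟩, ⟨hN1, hN2⟩, ⟨hm1, hm2⟩, hb', hsq⟩ := hball _ (sign_mul_mem_Ioo hε hτ)
      have hcon := contraction hn hs hN1 hN2 hΩ1 hΩ2 (by rw [hc.fst _ hm1, hb.fst _ hm2])
        (hb.invariant _ hm2) hb'
      have hinv := congrArg (fun w : State => w.2.1) (hc.invariant _ hm1)
      simp only [Prod.smul_snd, Prod.smul_fst, smul_eq_mul] at hinv
      rw [hinv, ← mul_sub] at hcon
      have hT : |ε * τ| < 1 / 12 := by
        have := hN1.1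
        rw [hc.fst _ hm1] at this
        nlinarith [abs_nonneg (ε * τ)]
      have hf1 : (vectorField n γ (c (ε * τ))).1 =
          3 / n * (1 - ε * τ) ^ 2 * (c (ε * τ)).2.1 ^ 2 * τ * ε := by
        simp only [vectorField, decel_of_omegaM_eq_zero hΩ1, hc.fst _ hm1]
        ring
      have hT1 : 0 < 1 - ε * τ := by linarith [(abs_lt.1 hT).2]
      have hsq' : 0 < (c (ε * τ)).2.1 ^ 2 := by
        refine lt_of_lt_of_le ?_ hsq
        rw [mul_pow, sign_sq hε, one_mul]
        have := hτ.1
        positivity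
      have hpos : 0 < 3 / n * (1 - ε * τ) ^ 2 * (c (ε * τ)).2.1 ^ 2 * τ := by
        have := hτ.1
        positivity
      rw [hf1] at hcon
      by_contra! hgt
      nlinarith [mul_pos hpos hgt]
  obtain ⟨⟨hΩ1, hΩ2⟩, ⟨hN1, hN2⟩, ⟨hm1, hm2⟩, -⟩ := hball _ (sign_mul_mem_Ioo hε hτ)
  exact eq_of_omegaM_eq_zero hn hs hN1 hN2 hΩ1 hΩ2 (by rw [hc.fst _ hm1, hb.fst _ hm2])
    (sub_eq_zero.1 (pow_eq_zero_iff two_ne_zero |>.1 (le_antisymm hD (sq_nonneg _))))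

/-- Local uniqueness of the center manifold of class `C¹`. -/
theorem eventually_mem_iff_of_isLocalCenterManifold (hn : 1 ≤ n) (hγ : 0 < γ)
    (hs : s = 1 ∨ s = -1) {V W : Set State}
    (hV : IsLocalCenterManifold 1 (vectorField n γ) (deSitter s) V)
    (hW : IsLocalCenterManifold 1 (vectorField n γ) (deSitter s) W) :
    ∀ᶠ z in 𝓝 (deSitter s), z ∈ W ↔ z ∈ V := by
  obtain ⟨b, b', ρ', hb, hbV⟩ := exists_isInvariantCurve hn hγ hs hV
  obtain ⟨c, c', ρ, hc, hcW⟩ := exists_isInvariantCurve hn hγ hs hW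
  have hfst : Tendsto (fun z : State => z.1) (𝓝 (deSitter s)) (𝓝 0) :=
    continuous_fst.tendsto (deSitter s)
  filter_upwards [hfst.eventually hc.eventually_mem, hfst.eventually hb.eventually_mem,
    hfst.eventually (hc.eventually_eq hn hγ hs hb)] with z h1 h2 h3
  rw [hcW z h1, hbV z h2, h3]

end ScalarCosmology

/-! ## The attractor solution -/

theorem IsLocalCenterManifold.of_le {E : Type*} [NormedAddCommGroup E] [NormedSpace ℝ E]
    {r r' : WithTop ℕ∞} {f : E → E} {p : E} {W : Set E} (h : IsLocalCenterManifold r f p W)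
    (hr : r' ≤ r) : IsLocalCenterManifold r' f p W := by
  obtain ⟨h1, h2, N, g, hN, h0, hC, h3⟩ := h
  exact ⟨h1, h2, N, g, hN, h0, hC.of_le hr, h3⟩

namespace ScalarCosmology

variable {n : ℕ} {γ s r δ : ℝ} {Θ Θ₁ : ℝ → ℝ} {z : ℝ → ℝ × ℝ}

/-- The state with the coordinates `u = log (T / (1 - T))` and `θ` on the scalar field boundary. -/
def polarState (n : ℕ) (s : ℝ) (z : ℝ × ℝ) : State :=
  (1 - lapse z.1, s * G n z.2, s * Real.cos z.2)

theorem hasDerivAt_lapse (u : ℝ) : HasDerivAt lapse (-(Real.exp u * lapse u ^ 2)) u := by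
  have h : HasDerivAt (fun u => 1 / (1 + Real.exp u))
      ((0 * (1 + Real.exp u) - 1 * Real.exp u) / (1 + Real.exp u) ^ 2) u :=
    (hasDerivAt_const u (1 : ℝ)).div ((Real.hasDerivAt_exp u).const_add 1) (by positivity)
  refine h.congr_deriv ?_
  unfold lapse
  field_simp
  ring

theorem isSolutionOn_polarState (hn : 1 ≤ n) (hs : s = 1 ∨ s = -1) (γ : ℝ)
    (hz : IsSolutionOn (polarField n) z univ) :
    IsSolutionOn (vectorField n γ) (fun τ => polarState n s (z τ)) univ := by
  intro τ _
  have h1 := hz.hasDerivAt_fst (mem_univ τ)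
  have h2 := hz.hasDerivAt_snd (mem_univ τ)
  have hT := ((hasDerivAt_lapse _).comp τ h1).const_sub 1
  have hS := ((hasDerivAt_G hn _).comp τ h2).const_mul s
  have hX := ((Real.hasDerivAt_cos _).comp τ h2).const_mul s
  refine (hT.prodMk (hS.prodMk hX)).congr_deriv ?_
  change _ = vectorField n γ (1 - lapse (z τ).1, s * G n (z τ).2, s * Real.cos (z τ).2)
  rw [vectorField_angle hn hs]
  have hl := one_sub_lapse (z τ).1
  simp only [polarField, Prod.mk.injEq, sub_sub_cancel]
  refine ⟨?_, trivial⟩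
  rw [hl]
  ring

theorem polarState_mem (n : ℕ) (hs : s = 1 ∨ s = -1) (z : ℝ × ℝ) :
    polarState n s z ∈ physicalSpace n ∩ scalarBoundary n := by
  have h : omegaM n (polarState n s z) = 0 := omegaM_angle n hs _ _
  exact ⟨⟨sub_pos.2 (lapse_lt_one _), sub_lt_self _ (lapse_pos _), h.ge⟩, h⟩

theorem stateCurve_exp (n : ℕ) (s : ℝ) (Θ : ℝ → ℝ) (u : ℝ) :
    stateCurve n s Θ (Real.exp u) = polarState n s (u, Θ (Real.exp u)) := by
  rw [stateCurve, polarState, one_sub_lapse, lapse, mul_one_div]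

namespace IsOrbitOf

theorem polarState_eq (hz : IsOrbitOf n Θ r z) (s : ℝ) {τ : ℝ} (hτ : τ < 0) :
    polarState n s (z τ) = stateCurve n s Θ (Real.exp (z τ).1) := by
  rw [stateCurve_exp, ← hz.snd_eq τ hτ]

theorem exists_fst_eq (hz : IsOrbitOf n Θ r z) {v : ℝ} (hv : v < Real.log r) :
    ∃ τ < 0, (z τ).1 = v := by
  have hcont : Continuous fun τ => (z τ).1 := continuous_iff_continuousAt.2 fun τ =>
    (hz.isSolutionOn.hasDerivAt_fst (mem_univ τ)).continuousAt
  obtain ⟨a, ha, ha0⟩ := ((hz.tendsto.eventually (eventually_le_atBot v)).and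
    (eventually_le_atBot 0)).exists
  obtain ⟨τ, hτ, h⟩ := intermediate_value_Icc ha0 hcont.continuousOn
    (show v ∈ Icc (z a).1 (z 0).1 from ⟨ha, by rw [hz.fst_zero]; exact hv.le⟩)
  refine ⟨τ, lt_of_le_of_ne hτ.2 ?_, h⟩
  rintro rfl
  rw [← h, ← hz.fst_zero] at hv
  exact lt_irrefl _ hv

theorem tendsto_polarState (hn : 1 ≤ n) (hc : IsCenterCurve n Θ Θ₁ r) (hz : IsOrbitOf n Θ r z)
    (s : ℝ) : Tendsto (fun τ => polarState n s (z τ)) atBot (𝓝 (deSitter s)) := by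
  have h1 : Tendsto (fun τ => Real.exp (z τ).1) atBot (𝓝 0) :=
    Real.tendsto_exp_atBot.comp hz.tendsto
  have h2 := (hc.hasDerivAt_stateCurve hn s hc.zero_mem).continuousAt.tendsto.comp h1
  rw [hc.stateCurve_zero] at h2
  refine h2.congr' ?_
  filter_upwards [eventually_lt_atBot 0] with τ hτ using (hz.polarState_eq s hτ).symm

/-- The physical part of the curve is the half `0 < T̃ < δ`, and the orbit runs through these values
in increasing order; `τ₀` is the time at which it reaches `T̃ = δ`. -/
theorem exists_thetaGraph_inter_eq (hn : 1 ≤ n) (hc : IsCenterCurve n Θ Θ₁ r)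
    (hz : IsOrbitOf n Θ r z) (hs : s = 1 ∨ s = -1) (hδ : 0 < δ) (hδr : δ < r) :
    ∃ τ₀, thetaGraph n s Θ δ ∩ physicalSpace n = (fun τ => polarState n s (z τ)) '' Iio τ₀ := by
  have hδ1 := hδr.le.trans (hc.r_le_one hn)
  obtain ⟨τ₀, hτ₀, h₀⟩ := hz.exists_fst_eq (Real.log_lt_log hδ hδr)
  have hlt : ∀ τ < 0, (τ < τ₀ ↔ (z τ).1 < Real.log δ) := fun τ hτ => by
    rw [← h₀]
    exact (hz.strictMonoOn.lt_iff_lt (mem_Iic.2 hτ.le) (mem_Iic.2 hτ₀.le)).symm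
  refine ⟨τ₀, Subset.antisymm ?_ ?_⟩
  · rintro w ⟨hw, hw0, -, -⟩
    obtain ⟨t, ht, rfl⟩ := (mem_thetaGraph_iff hδ1).1 hw
    have hpos : 0 < 1 + t := by linarith [ht.1]
    have ht0 : 0 < t := by
      have : 0 < t / (1 + t) := hw0
      rwa [div_pos_iff_of_pos_right hpos] at this
    have hlog := Real.log_lt_log ht0 ht.2
    obtain ⟨τ, hτ, h⟩ := hz.exists_fst_eq (hlog.trans (Real.log_lt_log hδ hδr))
    refine ⟨τ, (hlt τ hτ).2 (by rwa [h]), ?_⟩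
    simp only
    rw [hz.polarState_eq s hτ, h, Real.exp_log ht0]
  · rintro _ ⟨τ, hτ, rfl⟩
    have hτ0 : τ < 0 := lt_trans hτ hτ₀
    refine ⟨?_, (polarState_mem n hs _).1⟩
    simp only
    rw [hz.polarState_eq s hτ0]
    refine (mem_thetaGraph_iff hδ1).2 ⟨_, ⟨by linarith [Real.exp_pos (z τ).1], ?_⟩, rfl⟩
    exact (Real.lt_log_iff_exp_lt hδ).1 ((hlt τ hτ0).1 hτ)

end IsOrbitOf

/-- A physical solution that emanates from the de Sitter point lies on the scalar field boundary
at early times. -/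
theorem eventually_omegaM_eq_zero_of_tendsto (hn : 1 ≤ n) (hγ : 0 < γ) (hs : s = 1 ∨ s = -1)
    {y : ℝ → State} {a : ℝ} (hy : IsSolutionOn (vectorField n γ) y (Iio a))
    (hphys : ∀ τ < a, y τ ∈ physicalSpace n) (hlim : Tendsto y atBot (𝓝 (deSitter s))) :
    ∀ᶠ τ in atBot, omegaM n (y τ) = 0 := by
  have hΩ : Tendsto (fun τ => omegaM n (y τ)) atBot (𝓝 0) := by
    have := ((continuous_omegaM n).tendsto _).comp hlim
    rwa [omegaM_deSitter n hs] at this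
  have hq : ∀ᶠ τ in atBot, 1 + decel n γ (y τ) < γ := by
    have h1 : Continuous fun z : State => 1 + decel n γ z := by
      have := continuous_omegaM n
      unfold decel
      fun_prop
    refine ((h1.tendsto _).comp hlim).eventually (Iio_mem_nhds ?_)
    rw [decel_deSitter n γ hs]
    linarith
  obtain ⟨b, hb⟩ := eventually_atBot.1 (hq.and (eventually_lt_atBot a))
  filter_upwards [eventually_le_atBot b] with τ hτ
  refine le_antisymm ?_ (hphys τ (hb τ hτ).2).2.2
  -- From `1 + q < γ` the rate `2 (1 + q) - 3γ` is negative. So `Ω_m ≥ 0` does not increase and has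
  -- limit `0` in the past.
  refine nonpos_of_deriv_nonpos_of_tendsto_atBot (b := b)
    (fun τ hτ => hasDerivAt_omegaM (hy τ (hb τ hτ).2)) (fun τ hτ => ?_) hΩ hτ
  obtain ⟨h1, h2⟩ := hb τ hτ
  obtain ⟨-, h3, h4⟩ := hphys τ h2
  rw [omegaM'_vectorField hn]
  exact mul_nonpos_of_nonpos_of_nonneg
    (mul_nonpos_of_nonneg_of_nonpos (by linarith) (by linarith)) h4

/-- A physical solution that emanates from the de Sitter point lies on every center manifold at
early times. -/
theorem eventually_mem_of_tendsto (hn : 1 ≤ n) (hγ : 0 < γ) (hs : s = 1 ∨ s = -1) {W : Set State}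
    (hW : IsLocalCenterManifold 1 (vectorField n γ) (deSitter s) W)
    {y : ℝ → State} {a : ℝ} (hy : IsSolutionOn (vectorField n γ) y (Iio a))
    (hphys : ∀ τ < a, y τ ∈ physicalSpace n) (hlim : Tendsto y atBot (𝓝 (deSitter s))) :
    ∀ᶠ τ in atBot, y τ ∈ W := by
  obtain ⟨c, c', ρ, hc, hcW⟩ := exists_isInvariantCurve hn hγ hs hW
  have hfst : Tendsto (fun τ => (y τ).1) atBot (𝓝 0) := (continuous_fst.tendsto _).comp hlim
  obtain ⟨b, hb⟩ := eventually_atBot.1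
    (((eventually_lt_atBot a).and (eventually_omegaM_eq_zero_of_tendsto hn hγ hs hy hphys hlim)).and
    ((hlim.eventually (eventually_isNearDeSitter n hs)).and
    (hfst.eventually ((hc.eventually_mem.and (hc.eventually_omegaM_eq_zero hn hγ hs)).and
      ((hc.tendsto.eventually (eventually_isNearDeSitter n hs)).and
        (hc.eventually_abs_deriv_le hn hs))))))
  have hD0 : Tendsto (fun τ => ((y τ).2.1 - (c (y τ).1).2.1) ^ 2) atBot (𝓝 0) := by
    have hp : Continuous fun z : State => z.2.1 := by fun_prop
    have h3 := ((hp.tendsto _).comp hlim).sub ((hp.tendsto _).comp (hc.tendsto.comp hfst))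
    simpa using h3.pow 2
  filter_upwards [eventually_le_atBot b] with τ hτ
  -- The solution is compared with the point of the curve at the same `T`; by `contraction` the
  -- squared distance does not increase, and it tends to `0` in the past.
  have hD : ((y τ).2.1 - (c (y τ).1).2.1) ^ 2 ≤ 0 := by
    refine nonpos_of_deriv_nonpos_of_tendsto_atBot (b := b)
      (φ' := fun τ => 2 * (((vectorField n γ (y τ)).2.1 -
        (vectorField n γ (y τ)).1 * (c' (y τ).1).2.1) * ((y τ).2.1 - (c (y τ).1).2.1)))
      (fun τ hτ => ?_) (fun τ hτ => ?_) hD0 hτ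
    · obtain ⟨⟨ha, -⟩, -, ⟨hm, -⟩, -⟩ := hb τ hτ
      obtain ⟨h1, h2, -⟩ := (hy τ ha).state_coords
      have h3 := (hc.hasDerivAt _ hm).state_coords.2.1.comp τ h1
      refine ((h2.sub h3).pow 2).congr_deriv ?_
      simp only [Pi.sub_apply, Function.comp]
      ring
    · obtain ⟨⟨-, hΩ⟩, hN, ⟨hm, hΩ'⟩, hN', hc'⟩ := hb τ hτ
      have := contraction hn hs hN hN' hΩ hΩ' (hc.fst _ hm).symm (hc.invariant _ hm) hc'
      linarith
  obtain ⟨⟨-, hΩ⟩, hN, ⟨hm, hΩ'⟩, hN', -⟩ := hb τ hτ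
  exact (hcW _ hm).2 (eq_of_omegaM_eq_zero hn hs hN hN' hΩ hΩ' (hc.fst _ hm).symm
    (sub_eq_zero.1 (pow_eq_zero_iff two_ne_zero |>.1 (le_antisymm hD (sq_nonneg _)))))

end ScalarCosmology

end

theorem mainTheorem2 (n : ℕ) (hn : 1 ≤ n) :
    ∃ (Θ : ℝ → ℝ) (δ : ℝ), 0 < δ ∧
      -- oddness and the expansion with its error term
      Function.Odd Θ ∧
      ((fun t => Θ t - ScalarCosmology.attractorExpansion n t) =O[𝓝 0] fun t : ℝ => t ^ 7) ∧
      ∀ γ : ℝ, 0 < γ → γ < 2 → ∀ s : ℝ, (s = 1 ∨ s = -1) →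
        -- a fixed point on `T = 0` (and on `Ω_m = 0`)
        ScalarCosmology.vectorField n γ (ScalarCosmology.deSitter s) = 0 ∧
        ScalarCosmology.deSitter s ∈
          ScalarCosmology.pastBoundary n ∩ ScalarCosmology.scalarBoundary n ∧
        -- the graph is its one-dimensional center manifold, which is locally unique
        Module.finrank ℝ (centerSubspace (ScalarCosmology.vectorField n γ)
          (ScalarCosmology.deSitter s)) = 1 ∧
        IsLocalCenterManifold 2 (ScalarCosmology.vectorField n γ) (ScalarCosmology.deSitter s)
          (ScalarCosmology.thetaGraph n s Θ δ) ∧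
        (∀ W : Set ScalarCosmology.State,
          IsLocalCenterManifold 1 (ScalarCosmology.vectorField n γ)
            (ScalarCosmology.deSitter s) W →
          ∀ᶠ z in 𝓝 (ScalarCosmology.deSitter s),
            z ∈ W ↔ z ∈ ScalarCosmology.thetaGraph n s Θ δ) ∧
        -- it is unstable and lies on the scalar field boundary
        EmanatesFrom (ScalarCosmology.vectorField n γ) (ScalarCosmology.deSitter s)
          (ScalarCosmology.thetaGraph n s Θ δ) ∧
        ScalarCosmology.thetaGraph n s Θ δ ⊆ ScalarCosmology.scalarBoundary n ∧
        -- in the physical state space it is a single orbit, the attractor solution, which is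
        -- the only physical orbit that originates from the fixed point
        ∃ x : ℝ → ScalarCosmology.State,
          IsSolutionOn (ScalarCosmology.vectorField n γ) x univ ∧
          (∀ τ, x τ ∈ ScalarCosmology.physicalSpace n ∩ ScalarCosmology.scalarBoundary n) ∧
          Tendsto x atBot (𝓝 (ScalarCosmology.deSitter s)) ∧
          (∃ τ₀ : ℝ, ScalarCosmology.thetaGraph n s Θ δ ∩ ScalarCosmology.physicalSpace n =
            x '' Iio τ₀) ∧
          ∀ (y : ℝ → ScalarCosmology.State) (a : ℝ),
            IsSolutionOn (ScalarCosmology.vectorField n γ) y (Iio a) →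
            (∀ τ < a, y τ ∈ ScalarCosmology.physicalSpace n) →
            Tendsto y atBot (𝓝 (ScalarCosmology.deSitter s)) →
            ∃ c : ℝ, ∀ τ < a, y τ = x (τ + c) := by
  obtain ⟨Θ, Θ₁, r, z, hc, hO, hz⟩ := ScalarCosmology.exists_isCenterCurve hn
  -- Any `δ < r` would do: the closed interval `[-δ, δ]` must lie in the domain of the invariance
  -- equation.
  have hδ : 0 < r / 2 := half_pos hc.pos
  have hδr : r / 2 < r := half_lt_self hc.pos
  refine ⟨Θ, r / 2, hδ, hc.odd, hO, fun γ hγ _ s hs => ?_⟩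
  have hW := hc.isLocalCenterManifold hn hs hγ hδ hδr
  have hW1 := hW.of_le (r' := 1) (by norm_num)
  have hΩ := ScalarCosmology.omegaM_deSitter n hs
  obtain ⟨τ₀, hτ₀⟩ := hz.exists_thetaGraph_inter_eq hn hc hs hδ hδr
  have hx := ScalarCosmology.isSolutionOn_polarState hn hs γ hz.isSolutionOn
  refine ⟨ScalarCosmology.vectorField_deSitter n γ hs, ⟨⟨rfl, hΩ.ge⟩, hΩ⟩,
    ScalarCosmology.finrank_centerSubspace hn hγ hs, hW,
    fun W hW' => ScalarCosmology.eventually_mem_iff_of_isLocalCenterManifold hn hγ hs hW1 hW',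
    hc.emanatesFrom hn hs γ hδ hδr,
    ScalarCosmology.IsCenterCurve.thetaGraph_subset_scalarBoundary hs,
    fun τ => ScalarCosmology.polarState n s (z τ), hx,
    fun τ => ScalarCosmology.polarState_mem n hs _, hz.tendsto_polarState hn hc s, ⟨τ₀, hτ₀⟩,
    fun y a hy hphys hlim => ?_⟩
  -- One early point of `y` lies on the physical part of the curve, hence on the attractor orbit.
  -- Uniqueness for the initial value problem then identifies the two solutions up to the time
  -- shift.
  obtain ⟨τ₁, hmem, hτ₁⟩ := ((ScalarCosmology.eventually_mem_of_tendsto hn hγ hs hW1 hy hphys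
    hlim).and (eventually_lt_atBot a)).exists
  obtain ⟨τ₂, -, h₂⟩ := hτ₀.subset ⟨hmem, hphys τ₁ hτ₁⟩
  have hlip := (ScalarCosmology.contDiff_vectorField n γ (r := 1)).locallyLipschitz
  refine ⟨τ₂ - τ₁, fun τ hτ => eqOn_Iio_of_isSolutionOn hlip hτ₁ hy
    (fun t _ => hx.comp_add_const (τ₂ - τ₁) t (mem_univ _)) ?_ hτ⟩
  simp only [add_sub_cancel]
  exact h₂.symm
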